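/- Call a loss $\ell:[0,1]\times\{0,1\}\to\mathbb{R}$ proper if $\mathbb{E}_{y\sim\mathrm{Ber}(q)}[\ell(p,y)-\ell(q,y)]\ge 0$ for all $p,q\in[0,1]$, and let $\mathcal{L}^*$ be the set of proper losses with $|\ell(p,1)-\ell(p,0)|\le 1$ for all $p\in[0,1]$. For $r\in\mathbb{N}$ let $\mathcal{M}_r$ be the set of functions $\kappa:[0,1]\to[0,1]$ such that for every $v\in\mathbb{R}$ the set $\{p\in[0,1]:\kappa(p)\ge v\}$ is a union of at most $r$ disjoint intervals (open, closed, half-open or singletons). For a probability distribution $J$ on $[0,1]\times\{0,1\}$ let \[ \mathsf{CDL}_{\mathcal{M}_r}(J)=\sup_{\ell\in\mathcal{L}^*,\,\kappa\in\mathcal{M}_r}\ \mathbb{E}_{(p,y)\sim J}\bigl[\ell(p,y)-\ell(\kappa(p),y)\bigr]. \] An $(\alpha,\beta)$-tester for $\mathsf{CDL}_{\mathcal{M}_r}$ is a (possibly randomized) algorithm that draws i.i.d. examples from an unknown $J$, outputs Accept or Reject, and for every $J$, with probability at least $2/3$ over the examples and its internal randomness, outputs Reject if $\mathsf{CDL}_{\mathcal{M}_r}(J)>\alpha$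 and Accept if $\mathsf{CDL}_{\mathcal{M}_r}(J)\le\beta$. Running time is the number of elementary operations on a real random-access machine, at unit cost: $+$, $-$, $\times$, $/$ and comparison of reals; $+$, $-$ and comparison of natural numbers, which also serve as memory addresses; conversion of naturals to reals; memory access; drawing an example; flipping a fair coin. \textbf{Corollary.} There are a single program and absolute constants $C>0$, $k\in\mathbb{N}$ such that for all integers $r\ge 1$ and all $\alpha,\varepsilon\in(0,1)$ the program, on input $(r,\alpha,\varepsilon)$, is an $(\alpha,\alpha-\varepsilon)$-tester for $\mathsf{CDL}_{\mathcal{M}_r}$ that on every run draws at most $C\,n\log^k(2+n)$ examples, where $n=r/\varepsilon^2$, and performs at most $C\,T\log^k(2+T)$ elementary operations, where $T=r^2/\varepsilon^3$. That is, its sample complexity is $\tilde{O}(r/\varepsilon^2)$ and its running time is $\tilde{O}(r^2/\varepsilon^3)$. -/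

import Mathlib

open MeasureTheory unitInterval

/-! ## Proper losses, generalized monotone functions and calibration decision loss -/

namespace Calib

/-- The expectation of `f y` for a Bernoulli label `y` with `Pr[y = 1] = q`
(labels in `{0, 1}` are Booleans). -/
def bernoulliMean (q : I) (f : Bool → ℝ) : ℝ :=
  (q : ℝ) * f true + (1 - (q : ℝ)) * f false

/-- A loss `ℓ : [0,1] × {0,1} → ℝ` is proper. -/
def IsProper (ℓ : I → Bool → ℝ) : Prop :=
  ∀ p q : I, 0 ≤ bernoulliMean q (fun y => ℓ p y - ℓ q y)

/-- The class of proper losses with `|ℓ(p, 1) - ℓ(p, 0)| ≤ 1` for all `p`. -/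
def properLosses : Set (I → Bool → ℝ) :=
  {ℓ | IsProper ℓ ∧ ∀ p : I, |ℓ p true - ℓ p false| ≤ 1}

/-- The class `M_r`: every superlevel set is a union of at most `r` disjoint intervals of `[0,1]`.
An order-connected subset of `[0,1]` is the same as an interval (open, closed, half-open, a
singleton or empty); since intervals may be empty, `r` of them stand for at most `r`. -/
def genMonotone (r : ℕ) : Set (I → I) :=
  {κ | ∀ v : ℝ, ∃ A : Fin r → Set I,
    (∀ i, (A i).OrdConnected) ∧ Pairwise (fun i j => Disjoint (A i) (A j)) ∧
      {p : I | v ≤ (κ p : ℝ)} = ⋃ i, A i}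

/-- The calibration decision loss of the joint law `J` of (prediction, label) relative to the
class `K`. -/
noncomputable def CDL (K : Set (I → I)) (J : Measure (I × Bool)) : ℝ :=
  sSup {x : ℝ | ∃ ℓ ∈ properLosses, ∃ κ ∈ K, x = ∫ z, (ℓ z.1 z.2 - ℓ (κ z.1) z.2) ∂J}

end Calib

/-! ## A real random-access machine

Programs use finitely many natural-number registers, real registers, and arrays of either kind,
addressed by natural numbers. The unit-cost operations are addition, truncated subtraction and
comparison of naturals, addition, subtraction, multiplication, division and comparison of reals,
conversion of a natural to a real, reading and writing a register or an array cell, drawing a fresh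
labelled example, and flipping a fair coin. There is no rounding of reals to integers. -/

namespace RealRAM

/-- Random input of a run: the stream of examples and the stream of coin flips. -/
abbrev Tape : Type := (ℕ → I × Bool) × (ℕ → Bool)

structure Store where
  /-- natural-number registers -/
  nreg : ℕ → ℕ
  /-- real registers -/
  rreg : ℕ → ℝ
  /-- arrays of naturals: `narr a i` is cell `i` of array `a` -/
  narr : ℕ → ℕ → ℕ
  /-- arrays of reals -/
  rarr : ℕ → ℕ → ℝ
  /-- number of examples drawn so far -/
  draws : ℕ
  /-- number of coins flipped so far -/
  flips : ℕ

inductive NatExp : Type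
  | const (n : ℕ)
  | reg (x : ℕ)
  | get (a : ℕ) (i : NatExp)
  | add (e f : NatExp)
  | sub (e f : NatExp)

inductive RealExp : Type
  | const (q : ℚ)
  | reg (x : ℕ)
  | get (a : ℕ) (i : NatExp)
  | cast (e : NatExp)
  | add (e f : RealExp)
  | sub (e f : RealExp)
  | mul (e f : RealExp)
  | div (e f : RealExp)

inductive Test : Type
  | natLe (e f : NatExp)
  | realLe (e f : RealExp)
  | neg (b : Test)
  | conj (b c : Test)

/-- Structured programs. -/
inductive Prog : Type
  | skip
  | setNat (x : ℕ) (e : NatExp)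
  | setReal (x : ℕ) (e : RealExp)
  | putNat (a : ℕ) (i : NatExp) (e : NatExp)
  | putReal (a : ℕ) (i : NatExp) (e : RealExp)
  | draw (x y : ℕ)
  | flip (x : ℕ)
  | seq (P Q : Prog)
  | ite (b : Test) (P Q : Prog)
  | loop (b : Test) (P : Prog)

def NatExp.eval (s : Store) : NatExp → ℕ
  | .const n => n
  | .reg x => s.nreg x
  | .get a i => s.narr a (i.eval s)
  | .add e f => e.eval s + f.eval s
  | .sub e f => e.eval s - f.eval s

noncomputable def RealExp.eval (s : Store) : RealExp → ℝ
  | .const q => (q : ℝ)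
  | .reg x => s.rreg x
  | .get a i => s.rarr a (i.eval s)
  | .cast e => (e.eval s : ℝ)
  | .add e f => e.eval s + f.eval s
  | .sub e f => e.eval s - f.eval s
  | .mul e f => e.eval s * f.eval s
  | .div e f => e.eval s / f.eval s

def Test.eval (s : Store) : Test → Prop
  | .natLe e f => e.eval s ≤ f.eval s
  | .realLe e f => e.eval s ≤ f.eval s
  | .neg b => ¬ b.eval s
  | .conj b c => b.eval s ∧ c.eval s

/-- Number of elementary operations in the evaluation of an expression. -/
def NatExp.cost : NatExp → ℕ
  | .const _ => 1
  | .reg _ => 1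
  | .get _ i => i.cost + 1
  | .add e f => e.cost + f.cost + 1
  | .sub e f => e.cost + f.cost + 1

def RealExp.cost : RealExp → ℕ
  | .const _ => 1
  | .reg _ => 1
  | .get _ i => i.cost + 1
  | .cast e => e.cost + 1
  | .add e f => e.cost + f.cost + 1
  | .sub e f => e.cost + f.cost + 1
  | .mul e f => e.cost + f.cost + 1
  | .div e f => e.cost + f.cost + 1

def Test.cost : Test → ℕ
  | .natLe e f => e.cost + f.cost + 1
  | .realLe e f => e.cost + f.cost + 1
  | .neg b => b.cost + 1
  | .conj b c => b.cost + c.cost + 1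

/-- Write `v` into cell `i` of array `a`. -/
def setCell {β : Type} (A : ℕ → ℕ → β) (a i : ℕ) (v : β) : ℕ → ℕ → β :=
  Function.update A a (Function.update (A a) i v)

/-- `Exec ω P s s' t`: with random input `ω`, the program `P` started in `s` halts in `s'` after
`t` elementary operations. -/
inductive Exec (ω : Tape) : Prog → Store → Store → ℕ → Prop
  | skip (s : Store) : Exec ω .skip s s 1
  | setNat (x : ℕ) (e : NatExp) (s : Store) :
      Exec ω (.setNat x e) s
        { s with nreg := Function.update s.nreg x (e.eval s) } (e.cost + 1)
  | setReal (x : ℕ) (e : RealExp) (s : Store) :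
      Exec ω (.setReal x e) s
        { s with rreg := Function.update s.rreg x (e.eval s) } (e.cost + 1)
  | putNat (a : ℕ) (i e : NatExp) (s : Store) :
      Exec ω (.putNat a i e) s
        { s with narr := setCell s.narr a (i.eval s) (e.eval s) } (i.cost + e.cost + 1)
  | putReal (a : ℕ) (i : NatExp) (e : RealExp) (s : Store) :
      Exec ω (.putReal a i e) s
        { s with rarr := setCell s.rarr a (i.eval s) (e.eval s) } (i.cost + e.cost + 1)
  /-- the prediction of the next example goes to real register `x`,
  its label (0 or 1) to natural register `y` -/
  | draw (x y : ℕ) (s : Store) :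
      Exec ω (.draw x y) s
        { s with
            rreg := Function.update s.rreg x ((ω.1 s.draws).1 : ℝ),
            nreg := Function.update s.nreg y ((ω.1 s.draws).2.toNat),
            draws := s.draws + 1 } 1
  | flip (x : ℕ) (s : Store) :
      Exec ω (.flip x) s
        { s with
            nreg := Function.update s.nreg x ((ω.2 s.flips).toNat),
            flips := s.flips + 1 } 1
  | seq {P Q : Prog} {s s' s'' : Store} {t t' : ℕ} :
      Exec ω P s s' t → Exec ω Q s' s'' t' → Exec ω (.seq P Q) s s'' (t + t')
  | ite_true {b : Test} {P Q : Prog} {s s' : Store} {t : ℕ} :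
      b.eval s → Exec ω P s s' t → Exec ω (.ite b P Q) s s' (b.cost + 1 + t)
  | ite_false {b : Test} {P Q : Prog} {s s' : Store} {t : ℕ} :
      ¬ b.eval s → Exec ω Q s s' t → Exec ω (.ite b P Q) s s' (b.cost + 1 + t)
  | loop_false {b : Test} {P : Prog} {s : Store} :
      ¬ b.eval s → Exec ω (.loop b P) s s (b.cost + 1)
  | loop_true {b : Test} {P : Prog} {s s' s'' : Store} {t t' : ℕ} :
      b.eval s → Exec ω P s s' t → Exec ω (.loop b P) s' s'' t' →
        Exec ω (.loop b P) s s'' (b.cost + 1 + t + t')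

/-- Runs are deterministic once the random input is fixed. -/
theorem Exec.det {ω : Tape} {P : Prog} {s s₁ s₂ : Store} {t₁ t₂ : ℕ}
    (h₁ : Exec ω P s s₁ t₁) (h₂ : Exec ω P s s₂ t₂) : s₁ = s₂ ∧ t₁ = t₂ := by
  induction h₁ generalizing s₂ t₂ with
  | skip | setNat | setReal | putNat | putReal | draw | flip => cases h₂; exact ⟨rfl, rfl⟩
  | seq _ _ ih ih' =>
    cases h₂ with
    | seq a b =>
      obtain ⟨rfl, rfl⟩ := ih a
      obtain ⟨rfl, rfl⟩ := ih' b
      exact ⟨rfl, rfl⟩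
  | ite_true hb _ ih =>
    cases h₂ with
    | ite_true _ a => obtain ⟨rfl, rfl⟩ := ih a; exact ⟨rfl, rfl⟩
    | ite_false hn _ => exact absurd hb hn
  | ite_false hn _ ih =>
    cases h₂ with
    | ite_true hb _ => exact absurd hb hn
    | ite_false _ a => obtain ⟨rfl, rfl⟩ := ih a; exact ⟨rfl, rfl⟩
  | loop_false hn =>
    cases h₂ with
    | loop_false => exact ⟨rfl, rfl⟩
    | loop_true hb => exact absurd hb hn
  | loop_true hb _ _ ih ih' =>
    cases h₂ with
    | loop_false hn => exact absurd hb hn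
    | loop_true _ a b =>
      obtain ⟨rfl, rfl⟩ := ih a
      obtain ⟨rfl, rfl⟩ := ih' b
      exact ⟨rfl, rfl⟩

/-- Initial store on input `(r, α, ε)`: the parameters sit in the first registers and everything
else is zero. -/
noncomputable def input (r : ℕ) (α ε : ℝ) : Store where
  nreg := Function.update (fun _ => 0) 0 r
  rreg := Function.update (Function.update (fun _ => 0) 0 α) 1 ε
  narr := fun _ _ => 0
  rarr := fun _ _ => 0
  draws := 0
  flips := 0

/-- The run halts and outputs "accept" (value 1 in natural register 0). -/
def Accepts (P : Prog) (s : Store) (ω : Tape) : Prop :=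
  ∃ s' t, Exec ω P s s' t ∧ s'.nreg 0 = 1

/-- The run halts and outputs "reject" (value 0 in natural register 0). -/
def Rejects (P : Prog) (s : Store) (ω : Tape) : Prop :=
  ∃ s' t, Exec ω P s s' t ∧ s'.nreg 0 = 0

/-- Law of the random input: i.i.d. examples from `J` and, independently, fair coins. -/
noncomputable def tapeLaw (J : Measure (I × Bool)) [IsProbabilityMeasure J] : Measure Tape :=
  (Measure.infinitePi (fun _ : ℕ => J)).prod
    (Measure.infinitePi (fun _ : ℕ => (PMF.uniformOfFintype Bool).toMeasure))

/-- `P`, started in `s`, is an `(α, β)`-tester for the calibration decision loss relative to `K`: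
it always outputs accept or reject, and for every law of the examples it does so correctly with
probability at least 2/3. -/
def IsTester (P : Prog) (s : Store) (α β : ℝ) (K : Set (I → I)) : Prop :=
  (∀ ω : Tape, Accepts P s ω ∨ Rejects P s ω) ∧
  ∀ (J : Measure (I × Bool)) [IsProbabilityMeasure J],
    (α < Calib.CDL K J → 2 / 3 ≤ tapeLaw J {ω | Rejects P s ω}) ∧
    (Calib.CDL K J ≤ β → 2 / 3 ≤ tapeLaw J {ω | Accepts P s ω})

/-- `P`, started in `s`, halts on every random input, after drawing at most `N` examples and
performing at most `T` elementary operations. -/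
def RunsWithin (P : Prog) (s : Store) (N T : ℝ) : Prop :=
  ∀ ω : Tape, ∃ s' t, Exec ω P s s' t ∧ (s'.draws : ℝ) ≤ N ∧ (t : ℝ) ≤ T

end RealRAM

/-! Analysis of the loss. Properness makes ℓ(·, 0) a convex function of the slope ℓ(p, 0) − ℓ(p, 1),
with subgradient p. Integrating the subgradient writes a loss with slopes in [-1, 1] as a mixture,
over u in (-1, 1], of V-shaped losses (`loss_sub_loss`). For a V-shaped loss with kink v, a
post-processing κ matters only through {κ ≥ v}, a union of at most r intervals, or through {κ > v},
a limit of such sets. Hence the calibration decision loss is twice the supremum of `gain J v X`, the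
expectation of (y − v)(1_X − 1_[v,1]), over v and over unions X of r intervals
(`two_mul_gain_le_CDL`, `CDL_le`).

Discretization. The number v in the factor y − v may be rounded to a grid of mesh 1/K at cost 1/K.
The set [v, 1] may not, since J can put much mass between v and the next grid point. So drawn
predictions are added to the grid, and [v, 1] becomes [S t, 1] with S t the least point above v. If
the points hit every block between consecutive M-quantiles, an interval without points has mass at
most 2/M. With M of order r/ε, moving the 2r endpoints of X to boundaries of cells costs O(ε)
(`exists_cut`, `CDL_le_of_stat_le`). Conversely, every statistic is close to a true gain with kink S
t (`stat_le_CDL`).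

Sampling. About (r/ε) log(r/ε) draws hit all blocks. Over the fixed quantile partition there are
only (2M+4)^(2r) step patterns, so Hoeffding and a union bound give frequencies uniformly close to
probabilities on all unions of r intervals from about (r/ε²) log(r/ε) examples
(`unifClose_of_cells`, `prob_not_good_le`). This uniformity covers the cells of the random points as
well.

Computation. A union of r intervals of cells is the odd part of a monotone sequence bounded by 2r,
so the best one is found by dynamic programming in O(N r) steps for N points (`sum_le_pathBest`,
`exists_sum_eq_pathBest`). Repeating this for the O(1/ε) grid values, and locating each of the n
examples by a scan of the N points, both cost r²/ε³ up to logarithms. -/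

namespace RealRAM

/-! ### Total correctness with time bounds -/

/-- `P` started in `s` halts within `B` elementary operations in a store satisfying `Q`. -/
def Runs (ω : Tape) (P : Prog) (s : Store) (B : ℕ) (Q : Store → Prop) : Prop :=
  ∃ s' t, Exec ω P s s' t ∧ t ≤ B ∧ Q s'

theorem Runs.mono {ω : Tape} {P : Prog} {s : Store} {B B' : ℕ} {Q Q' : Store → Prop}
    (h : Runs ω P s B Q) (hB : B ≤ B') (hQ : ∀ s', Q s' → Q' s') : Runs ω P s B' Q' := by
  obtain ⟨s', t, h₁, h₂, h₃⟩ := h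
  exact ⟨s', t, h₁, h₂.trans hB, hQ _ h₃⟩

theorem Runs.seq {ω : Tape} {P P' : Prog} {s : Store} {B B' : ℕ} {R Q : Store → Prop}
    (h : Runs ω P s B R) (h' : ∀ s', R s' → Runs ω P' s' B' Q) :
    Runs ω (.seq P P') s (B + B') Q := by
  obtain ⟨s', t, h₁, h₂, h₃⟩ := h
  obtain ⟨s'', t', h₁', h₂', h₃'⟩ := h' s' h₃
  exact ⟨s'', t + t', .seq h₁ h₁', by omega, h₃'⟩

/-- A loop that preserves an indexed invariant and exits exactly when the index reaches `N`. -/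
theorem Runs.loop {ω : Tape} {b : Test} {P : Prog} (Inv : ℕ → Store → Prop) {N B : ℕ} {s : Store}
    (h0 : Inv 0 s)
    (hstep : ∀ i < N, ∀ s, Inv i s → b.eval s ∧ Runs ω P s B (Inv (i + 1)))
    (hend : ∀ s, Inv N s → ¬ b.eval s) :
    Runs ω (.loop b P) s (N * (B + b.cost + 1) + b.cost + 1) (Inv N) := by
  suffices H : ∀ d i s, i + d = N → Inv i s →
      Runs ω (.loop b P) s (d * (B + b.cost + 1) + b.cost + 1) (Inv N) from
    H N 0 s (by omega) h0
  intro d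
  induction d with
  | zero =>
    intro i s hi hs
    obtain rfl : i = N := by omega
    exact ⟨s, _, .loop_false (hend s hs), by omega, hs⟩
  | succ d ih =>
    intro i s hi hs
    obtain ⟨hb, s', t, h₁, h₂, h₃⟩ := hstep i (by omega) s hs
    obtain ⟨s'', t', h₁', h₂', h₃'⟩ := ih (i + 1) s' (by omega) h₃
    refine ⟨s'', _, .loop_true hb h₁ h₁', ?_, h₃'⟩
    rw [Nat.succ_mul]
    omega

/-- Programs without loops. -/
def Prog.loopFree : Prog → Bool
  | .seq P Q => P.loopFree && Q.loopFree
  | .ite _ P Q => P.loopFree && Q.loopFree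
  | .loop _ _ => false
  | _ => true

/-- An upper bound on the number of operations of a loop-free program. -/
def Prog.straightCost : Prog → ℕ
  | .skip => 1
  | .setNat _ e => e.cost + 1
  | .setReal _ e => e.cost + 1
  | .putNat _ i e => i.cost + e.cost + 1
  | .putReal _ i e => i.cost + e.cost + 1
  | .draw _ _ => 1
  | .flip _ => 1
  | .seq P Q => P.straightCost + Q.straightCost
  | .ite b P Q => b.cost + 1 + max P.straightCost Q.straightCost
  | .loop _ _ => 0

open Classical in
/-- The final store of a loop-free program. -/
noncomputable def Prog.straightRun (ω : Tape) : Prog → Store → Store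
  | .skip, s => s
  | .setNat x e, s => { s with nreg := Function.update s.nreg x (e.eval s) }
  | .setReal x e, s => { s with rreg := Function.update s.rreg x (e.eval s) }
  | .putNat a i e, s => { s with narr := setCell s.narr a (i.eval s) (e.eval s) }
  | .putReal a i e, s => { s with rarr := setCell s.rarr a (i.eval s) (e.eval s) }
  | .draw x y, s =>
      { s with
          rreg := Function.update s.rreg x ((ω.1 s.draws).1 : ℝ),
          nreg := Function.update s.nreg y ((ω.1 s.draws).2.toNat),
          draws := s.draws + 1 }
  | .flip x, s =>
      { s with
          nreg := Function.update s.nreg x ((ω.2 s.flips).toNat),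
          flips := s.flips + 1 }
  | .seq P Q, s => Q.straightRun ω (P.straightRun ω s)
  | .ite b P Q, s => if b.eval s then P.straightRun ω s else Q.straightRun ω s
  | .loop _ _, s => s

/-- Without loops the final store is an explicit function of the initial one, so that verifying a
loop body reduces to evaluating that function. -/
theorem exec_straightRun (ω : Tape) (P : Prog) (hP : P.loopFree = true) (s : Store) :
    ∃ t ≤ P.straightCost, Exec ω P s (P.straightRun ω s) t := by
  induction P generalizing s with
  | skip => exact ⟨_, le_rfl, .skip s⟩
  | setNat x e => exact ⟨_, le_rfl, .setNat x e s⟩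
  | setReal x e => exact ⟨_, le_rfl, .setReal x e s⟩
  | putNat a i e => exact ⟨_, le_rfl, .putNat a i e s⟩
  | putReal a i e => exact ⟨_, le_rfl, .putReal a i e s⟩
  | draw x y => exact ⟨_, le_rfl, .draw x y s⟩
  | flip x => exact ⟨_, le_rfl, .flip x s⟩
  | seq P Q ihP ihQ =>
    simp only [Prog.loopFree, Bool.and_eq_true] at hP
    obtain ⟨t, ht, h⟩ := ihP hP.1 s
    obtain ⟨t', ht', h'⟩ := ihQ hP.2 (P.straightRun ω s)
    exact ⟨t + t', add_le_add ht ht', .seq h h'⟩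
  | ite b P Q ihP ihQ =>
    simp only [Prog.loopFree, Bool.and_eq_true] at hP
    obtain ⟨t, ht, h⟩ := ihP hP.1 s
    obtain ⟨t', ht', h'⟩ := ihQ hP.2 s
    by_cases hb : b.eval s
    · refine ⟨b.cost + 1 + t, by simp only [Prog.straightCost]; omega, ?_⟩
      simpa [Prog.straightRun, hb] using Exec.ite_true hb h
    · refine ⟨b.cost + 1 + t', by simp only [Prog.straightCost]; omega, ?_⟩
      simpa [Prog.straightRun, hb] using Exec.ite_false hb h'
  | loop b P => simp [Prog.loopFree] at hP

theorem Runs.straight {ω : Tape} {P : Prog} {s : Store} {Q : Store → Prop}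
    (hP : P.loopFree = true) (hQ : Q (P.straightRun ω s)) : Runs ω P s P.straightCost Q := by
  obtain ⟨t, ht, h⟩ := exec_straightRun ω P hP s
  exact ⟨_, t, h, ht, hQ⟩

theorem Runs.of_loopFree {ω : Tape} {P : Prog} {s : Store} {B : ℕ} {Q : Store → Prop}
    (hP : P.loopFree = true) (hB : P.straightCost ≤ B) (hQ : Q (P.straightRun ω s)) :
    Runs ω P s B Q :=
  (Runs.straight hP hQ).mono hB fun _ h => h

@[simp] theorem setCell_apply {β : Type} (A : ℕ → ℕ → β) (a i : ℕ) (v : β) (a' i' : ℕ) :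
    setCell A a i v a' i' = if a' = a ∧ i' = i then v else A a' i' := by
  unfold setCell
  by_cases h : a' = a
  · subst h
    by_cases h' : i' = i <;> simp [h']
  · simp [h]

end RealRAM

namespace RealRAM

open Finset

/-! ### The tester -/

/-- Number of points `S t`, `t < N`, that are `< x`, plus the number of those that are `≤ x`. The
level sets are the points and the gaps between consecutive points. -/
noncomputable def rank (S : ℕ → ℝ) (N : ℕ) (x : ℝ) : ℕ :=
  ∑ t ∈ range N, ((if S t < x then 1 else 0) + (if S t ≤ x then 1 else 0))

/-- `cellCount S N z n (2 * c + y)` counts the examples of label `y` in cell `c`. -/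
noncomputable def cellCount (S : ℕ → ℝ) (N : ℕ) (z : ℕ → I × Bool) (n a : ℕ) : ℕ :=
  ∑ j ∈ range n, if 2 * rank S N (z j).1 + (z j).2.toNat = a then 1 else 0

/-- The number of `t < N` with `S t ≤ x` and `2 * t + y = a`. -/
noncomputable def upIndex (S : ℕ → ℝ) (N : ℕ) (x : ℝ) (y : Bool) (a : ℕ) : ℕ :=
  ∑ t ∈ range N, if S t ≤ x ∧ 2 * t + y.toNat = a then 1 else 0

/-- `upCount S N z n (2 * t + y)` counts the examples of label `y` with prediction `≥ S t`. -/
noncomputable def upCount (S : ℕ → ℝ) (N : ℕ) (z : ℕ → I × Bool) (n a : ℕ) : ℕ :=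
  ∑ j ∈ range n, upIndex S N (z j).1 (z j).2 a

theorem rank_succ (S : ℕ → ℝ) (N : ℕ) (x : ℝ) : rank S (N + 1) x =
    rank S N x + ((if S N < x then 1 else 0) + (if S N ≤ x then 1 else 0)) :=
  sum_range_succ _ _

theorem upIndex_succ (S : ℕ → ℝ) (N : ℕ) (x : ℝ) (y : Bool) (a : ℕ) : upIndex S (N + 1) x y a =
    upIndex S N x y a + if S N ≤ x ∧ 2 * N + y.toNat = a then 1 else 0 :=
  sum_range_succ _ _

theorem cellCount_succ (S : ℕ → ℝ) (N : ℕ) (z : ℕ → I × Bool) (n a : ℕ) :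
    cellCount S N z (n + 1) a =
      cellCount S N z n a + if 2 * rank S N (z n).1 + (z n).2.toNat = a then 1 else 0 :=
  sum_range_succ _ _

theorem upCount_succ (S : ℕ → ℝ) (N : ℕ) (z : ℕ → I × Bool) (n a : ℕ) :
    upCount S N z (n + 1) a = upCount S N z n a + upIndex S N (z n).1 (z n).2 a :=
  sum_range_succ _ _

/-- `pathBest w c q` is the largest sum of weights `w i` over the indices `i < c` at which a
monotone sequence bounded by `q` is odd. -/
noncomputable def pathBest (w : ℕ → ℝ) : ℕ → ℕ → ℝ
  | 0, _ => 0
  | c + 1, 0 => pathBest w c 0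
  | c + 1, q + 1 =>
      max (pathBest w c (q + 1) + if Odd (q + 1) then w c else 0) (pathBest w (c + 1) q)

/-- The grid `0, 1/K, …, 1` followed by the first predictions drawn. -/
noncomputable def points (K : ℕ) (ω : Tape) (t : ℕ) : ℝ :=
  if t < K + 1 then (t : ℝ) / K else (ω.1 (t - (K + 1))).1

/-- `2 * (reg x) + reg y` -/
def NatExp.pair (x y : ℕ) : NatExp := .add (.add (.reg x) (.reg x)) (.reg y)

/-- Doubling replaces the logarithm, which is not an elementary operation. Natural registers: 0 is r
and finally the answer, 1 the scale L, 2 the grid size K, 3 the number N of points, 4 the number of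
draws in the current phase, 5 a label, 6 a rank, 7 a point, 8 a grid threshold, 9 a column of the
dynamic program, 10 the rejection flag, 11 a cell. Real registers: 0 is α, 1 is ε, 2 a power of two,
3 a prediction, 4 the threshold v, 5 a cell weight, 6 the parity of the column. Real arrays: 0 holds
the points, 1 the current row of the dynamic program. Natural arrays: 0 holds `cellCount`, 1 holds
`upCount`. -/
def scaleProg : Prog :=
  .seq (.setReal 2 (.const 1)) <| .seq (.setNat 1 (.const 1)) <|
  .loop (.neg (.realLe (.div (.cast (.reg 0)) (.reg 1)) (.reg 2)))
    (.seq (.setReal 2 (.mul (.const 2) (.reg 2))) (.setNat 1 (.add (.reg 1) (.const 1))))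

/-- The ceiling of 16/ε is found by counting upwards, as reals cannot be rounded; this costs only
O(1/ε). -/
def gridProg : Prog :=
  .seq
    (.loop (.neg (.realLe (.div (.const 16) (.reg 1)) (.cast (.reg 2))))
      (.setNat 2 (.add (.reg 2) (.const 1))))
    (.loop (.natLe (.reg 3) (.reg 2))
      (.seq (.putReal 0 (.reg 3) (.div (.cast (.reg 3)) (.cast (.reg 2))))
        (.setNat 3 (.add (.reg 3) (.const 1)))))

def pointProg : Prog :=
  .loop (.neg (.realLe
      (.mul (.mul (.const 4000) (.div (.cast (.reg 0)) (.reg 1))) (.cast (.reg 1)))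
      (.cast (.reg 4))))
    (.seq (.draw 3 5) <| .seq (.putReal 0 (.reg 3) (.reg 3)) <|
      .seq (.setNat 3 (.add (.reg 3) (.const 1))) (.setNat 4 (.add (.reg 4) (.const 1))))

/-- The points are left unsorted: a linear scan per example costs nN in total, which is within r²/ε³
up to logarithms. -/
def scanBody : Prog :=
  .seq (.ite (.realLe (.reg 3) (.get 0 (.reg 7))) .skip (.setNat 6 (.add (.reg 6) (.const 1)))) <|
  .seq (.ite (.realLe (.get 0 (.reg 7)) (.reg 3))
    (.seq (.setNat 6 (.add (.reg 6) (.const 1)))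
      (.putNat 1 (.pair 7 5) (.add (.get 1 (.pair 7 5)) (.const 1)))) .skip) <|
  .setNat 7 (.add (.reg 7) (.const 1))

def sampleProg : Prog :=
  .seq (.setNat 4 (.const 0)) <|
  .loop (.neg (.realLe
      (.mul (.mul (.const 50000) (.div (.div (.cast (.reg 0)) (.reg 1)) (.reg 1)))
        (.cast (.reg 1)))
      (.cast (.reg 4))))
    (.seq (.seq (.draw 3 5) <| .seq (.setNat 6 (.const 0)) (.setNat 7 (.const 0))) <|
    .seq (.loop (.natLe (.add (.reg 7) (.const 1)) (.reg 3)) scanBody) <|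
    .seq (.putNat 0 (.pair 6 5) (.add (.get 0 (.pair 6 5)) (.const 1)))
      (.setNat 4 (.add (.reg 4) (.const 1))))

/-- `W (2 x + 1) * (1 - v) - W (2 x) * v` for the array `W` of naturals number `a` -/
def RealExp.weight (a x : ℕ) : RealExp :=
  .sub (.mul (.cast (.get a (.add (.add (.reg x) (.reg x)) (.const 1)))) (.sub (.const 1) (.reg 4)))
    (.mul (.cast (.get a (.add (.reg x) (.reg x)))) (.reg 4))

def clearProg : Prog :=
  .seq (.setNat 9 (.const 0)) <|
  .loop (.natLe (.reg 9) (.add (.reg 0) (.reg 0)))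
    (.seq (.putReal 1 (.reg 9) (.const 0)) (.setNat 9 (.add (.reg 9) (.const 1))))

/-- The row is updated in place by increasing column, so the entry to the left already belongs to
the new row, as the recursion of `pathBest` requires. -/
def stepBody : Prog :=
  .seq (.putReal 1 (.reg 9) (.add (.get 1 (.reg 9)) (.mul (.reg 6) (.reg 5)))) <|
  .seq (.ite (.realLe (.get 1 (.sub (.reg 9) (.const 1))) (.get 1 (.reg 9))) .skip
    (.putReal 1 (.reg 9) (.get 1 (.sub (.reg 9) (.const 1))))) <|
  .seq (.setReal 6 (.sub (.const 1) (.reg 6))) (.setNat 9 (.add (.reg 9) (.const 1)))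

def dynProg : Prog :=
  .seq (.setNat 11 (.const 0)) <|
  .loop (.natLe (.reg 11) (.add (.reg 3) (.reg 3)))
    (.seq (.seq (.setReal 5 (.weight 0 11)) <| .seq (.setNat 9 (.const 0)) (.setReal 6 (.const 0))) <|
    .seq (.loop (.natLe (.reg 9) (.add (.reg 0) (.reg 0))) stepBody)
      (.setNat 11 (.add (.reg 11) (.const 1))))

/-- The condition S t ≤ v ≤ S t + 1/K makes rejection sound: the statistic is then close to a gain
with kink S t. The bound α − ε/2 lies halfway between the two cases to be told apart. -/
def compareBody : Prog :=
  .seq (.ite (.conj (.realLe (.get 0 (.reg 7)) (.reg 4))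
      (.conj (.realLe (.reg 4) (.add (.get 0 (.reg 7)) (.div (.const 1) (.cast (.reg 2)))))
        (.neg (.realLe
          (.mul (.const 2) (.sub (.get 1 (.add (.reg 0) (.reg 0))) (.weight 1 7)))
          (.mul (.sub (.reg 0) (.div (.reg 1) (.const 2))) (.cast (.reg 4)))))))
    (.setNat 10 (.const 1)) .skip)
  (.setNat 7 (.add (.reg 7) (.const 1)))

def compareProg : Prog :=
  .seq (.setNat 7 (.const 0)) <|
  .loop (.natLe (.add (.reg 7) (.const 1)) (.reg 3)) compareBody

def decideProg : Prog :=
  .seq (.seq (.setNat 10 (.const 0)) (.setNat 8 (.const 0))) <|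
  .seq (.loop (.natLe (.reg 8) (.reg 2))
    (.seq (.setReal 4 (.div (.cast (.reg 8)) (.cast (.reg 2)))) <|
    .seq clearProg <| .seq dynProg <| .seq compareProg
      (.setNat 8 (.add (.reg 8) (.const 1)))))
  (.setNat 0 (.sub (.const 1) (.reg 10)))

def tester : Prog :=
  .seq scaleProg <| .seq gridProg <| .seq pointProg <| .seq sampleProg decideProg

/-! ### Its parameters -/

noncomputable def scale (r : ℕ) (ε : ℝ) : ℕ := ⌈Real.logb 2 (r / ε)⌉₊ + 1

noncomputable def gridSize (ε : ℝ) : ℕ := ⌈16 / ε⌉₊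

noncomputable def pointDraws (r : ℕ) (ε : ℝ) : ℕ := ⌈4000 * (r / ε) * scale r ε⌉₊

noncomputable def sampleSize (r : ℕ) (ε : ℝ) : ℕ := ⌈50000 * (r / ε / ε) * scale r ε⌉₊

noncomputable def numPoints (r : ℕ) (ε : ℝ) : ℕ := gridSize ε + 1 + pointDraws r ε

/-- Store contents during the run: parameters `r, α, ε`, scale `L`, grid size `K`, points `S t` for
`t < N`, and `d` examples drawn. -/
structure Holds (r : ℕ) (α ε : ℝ) (L K N d : ℕ) (S : ℕ → ℝ) (s : Store) : Prop where
  hr : s.nreg 0 = r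
  hα : s.rreg 0 = α
  hε : s.rreg 1 = ε
  hL : s.nreg 1 = L
  hK : s.nreg 2 = K
  hN : s.nreg 3 = N
  hd : s.draws = d
  hS : ∀ t < N, s.rarr 0 t = S t

/-! ### Correctness and cost of the scale, grid and point phases -/

variable {ω : Tape} {r : ℕ} {α ε : ℝ}

theorem runs_scaleProg (hr : 1 ≤ r) (hε : 0 < ε) :
    Runs ω scaleProg (input r α ε) (20 * (scale r ε + 1)) fun s =>
      Holds r α ε (scale r ε) 0 0 0 (points (gridSize ε) ω) s ∧ s.nreg 4 = 0 ∧
        s.narr = fun _ _ => 0 := by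
  have hX : 0 < (r : ℝ) / ε := div_pos (by exact_mod_cast hr) hε
  have key : ∀ i : ℕ, i < ⌈Real.logb 2 (r / ε)⌉₊ ↔ (2 : ℝ) ^ i < r / ε := by
    intro i
    rw [Nat.lt_ceil, Real.lt_logb_iff_rpow_lt (by norm_num) hX, Real.rpow_natCast]
  have h1 : Runs ω (.setReal 2 (.const 1)) (input r α ε) 2 fun s =>
      s = { input r α ε with rreg := Function.update (input r α ε).rreg 2 1 } :=
    Runs.of_loopFree rfl (by norm_num [Prog.straightCost, RealExp.cost])
      (by simp [Prog.straightRun, RealExp.eval])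
  -- With N = 0 the clause of `Holds` on the points is vacuous, so the final sequence of points can
  -- be named from the start.
  let Inv : ℕ → Store → Prop := fun i s =>
    Holds r α ε (i + 1) 0 0 0 (points (gridSize ε) ω) s ∧ s.nreg 4 = 0 ∧
        s.narr = (fun _ _ => 0) ∧ s.rreg 2 = 2 ^ i
  refine (Runs.seq h1 (B' := 2 + (⌈Real.logb 2 (r / ε)⌉₊ * (18) + 8)) (Q := Inv ⌈Real.logb 2 (r / ε)⌉₊)
    fun s hs => Runs.seq (R := Inv 0) (B := 2) (B' := ⌈Real.logb 2 (r / ε)⌉₊ * 18 + 8) ?_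
      fun s' hs' => ?_).mono ?_ ?_
  · subst hs
    refine Runs.of_loopFree rfl (by norm_num [Prog.straightCost, NatExp.cost]) ?_
    refine ⟨⟨?_, ?_, ?_, ?_, ?_, ?_, ?_, ?_⟩, ?_, ?_, ?_⟩ <;>
      simp [Prog.straightRun, NatExp.eval, input]
  · refine (Runs.loop (B := 10) Inv hs' ?_ ?_).mono ?_ fun _ h => h
    · rintro i hi s ⟨hs, h4, hna, h2⟩
      refine ⟨?_, ?_⟩
      · simp [Test.eval, RealExp.eval, NatExp.eval, hs.hr, hs.hε, h2, ← key, hi]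
      · refine Runs.of_loopFree rfl (by norm_num [Prog.straightCost, RealExp.cost, NatExp.cost]) ?_
        refine ⟨⟨?_, ?_, ?_, ?_, ?_, ?_, ?_, ?_⟩, ?_, ?_, ?_⟩ <;>
          simp [Prog.straightRun, NatExp.eval, RealExp.eval, hs.hr, hs.hα,
            hs.hε, hs.hL, hs.hK, hs.hN, hs.hd, h4, hna, h2, pow_succ, mul_comm]
    · rintro s ⟨hs, h4, hna, h2⟩
      have := (key ⌈Real.logb 2 (r / ε)⌉₊).not.1 (lt_irrefl _)
      simpa [Test.eval, RealExp.eval, NatExp.eval, hs.hr, hs.hε, h2] using this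
    · simp only [Test.cost, RealExp.cost, NatExp.cost]
      omega
  · simp only [scale]; omega
  · rintro s ⟨hs, h4, hna, -⟩
    exact ⟨hs, h4, hna⟩

theorem runs_gridProg {s : Store} {L : ℕ} (hs : Holds r α ε L 0 0 0 (points (gridSize ε) ω) s ∧
      s.nreg 4 = 0 ∧ s.narr = fun _ _ => 0) :
    Runs ω gridProg s (40 * (gridSize ε + 1)) fun s =>
      Holds r α ε L (gridSize ε) (gridSize ε + 1) 0 (points (gridSize ε) ω) s ∧ s.nreg 4 = 0 ∧
        s.narr = fun _ _ => 0 := by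
  set K := gridSize ε with hKdef
  refine (Runs.seq (Runs.loop (B := 4) (N := K) (fun i s =>
    Holds r α ε L i 0 0 (points K ω) s ∧ s.nreg 4 = 0 ∧ s.narr = fun _ _ => 0) hs ?_ ?_)
    fun s' hs' => Runs.loop (B := 11) (N := K + 1) (fun i s =>
      Holds r α ε L K i 0 (points K ω) s ∧ s.nreg 4 = 0 ∧ s.narr = fun _ _ => 0) hs' ?_ ?_).mono
      ?_ fun _ h => h
  · rintro i hi s ⟨hs, h4, hna⟩
    refine ⟨?_, ?_⟩
    · rw [hKdef, gridSize, Nat.lt_ceil] at hi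
      simpa [Test.eval, RealExp.eval, NatExp.eval, hs.hε, hs.hK] using hi
    · refine Runs.of_loopFree rfl (by norm_num [Prog.straightCost, RealExp.cost, NatExp.cost]) ?_
      refine ⟨⟨?_, ?_, ?_, ?_, ?_, ?_, ?_, ?_⟩, ?_, ?_⟩ <;>
        simp [Prog.straightRun, NatExp.eval, hs.hr, hs.hα,
          hs.hε, hs.hL, hs.hK, hs.hN, hs.hd, h4, hna]
  · rintro s ⟨hs, h4, hna⟩
    simpa [Test.eval, RealExp.eval, NatExp.eval, hs.hε, hs.hK] using
      (show 16 / ε ≤ (K : ℝ) from Nat.le_ceil _)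
  · rintro i hi s ⟨hs, h4, hna⟩
    refine ⟨?_, ?_⟩
    · simp only [Test.eval, NatExp.eval, hs.hK, hs.hN]
      omega
    · refine Runs.of_loopFree rfl (by norm_num [Prog.straightCost, RealExp.cost, NatExp.cost]) ?_
      refine ⟨⟨?_, ?_, ?_, ?_, ?_, ?_, ?_, ?_⟩, ?_, ?_⟩
      case refine_8 =>
        intro t ht
        rcases Nat.lt_succ_iff_lt_or_eq.1 ht with h | rfl
        · simp [Prog.straightRun, NatExp.eval, RealExp.eval, hs.hN, h.ne, hs.hS t h]
        · simp [Prog.straightRun, NatExp.eval, RealExp.eval, hs.hN, hs.hK, points, hi]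
      all_goals
        simp [Prog.straightRun, NatExp.eval, hs.hr, hs.hα,
          hs.hε, hs.hL, hs.hK, hs.hN, hs.hd, h4, hna]
  · rintro s ⟨hs, h4, hna⟩
    simp [Test.eval, NatExp.eval, hs.hK, hs.hN]
  · simp only [Test.cost, RealExp.cost, NatExp.cost]
    omega

theorem runs_pointProg {s : Store}
    (hs : Holds r α ε (scale r ε) (gridSize ε) (gridSize ε + 1) 0 (points (gridSize ε) ω) s ∧
      s.nreg 4 = 0 ∧ s.narr = fun _ _ => 0) :
    Runs ω pointProg s (40 * (pointDraws r ε + 1)) fun s =>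
      Holds r α ε (scale r ε) (gridSize ε) (numPoints r ε) (pointDraws r ε)
        (points (gridSize ε) ω) s ∧ s.narr = fun _ _ => 0 := by
  set K := gridSize ε with hKdef
  refine (Runs.loop (B := 12) (N := pointDraws r ε) (fun i s =>
    Holds r α ε (scale r ε) K (K + 1 + i) i (points K ω) s ∧ s.nreg 4 = i ∧
      s.narr = fun _ _ => 0) hs ?_ ?_).mono ?_ ?_
  · rintro i hi s ⟨hs, h4, hna⟩
    refine ⟨?_, ?_⟩
    · rw [pointDraws, Nat.lt_ceil] at hi
      simpa [Test.eval, RealExp.eval, NatExp.eval, hs.hr, hs.hε, hs.hL, h4] using hi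
    · refine Runs.of_loopFree rfl (by norm_num [Prog.straightCost, RealExp.cost, NatExp.cost]) ?_
      refine ⟨⟨?_, ?_, ?_, ?_, ?_, ?_, ?_, ?_⟩, ?_, ?_⟩
      case refine_8 =>
        intro t ht
        rcases eq_or_ne t (K + 1 + i) with rfl | h
        · have : ¬ K + 1 + i ≤ K := by omega
          simp [Prog.straightRun, NatExp.eval, RealExp.eval, hs.hN, hs.hd, points, this]
        · simp [Prog.straightRun, NatExp.eval, RealExp.eval, hs.hN, h, hs.hS t (by omega)]
      all_goals
        simp [Prog.straightRun, NatExp.eval, hs.hr, hs.hα,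
          hs.hε, hs.hL, hs.hK, hs.hN, hs.hd, h4, hna, add_assoc]
  · rintro s ⟨hs, h4, hna⟩
    simpa [Test.eval, RealExp.eval, NatExp.eval, hs.hr, hs.hε, hs.hL, h4, pointDraws] using
      Nat.le_ceil (4000 * (r / ε) * scale r ε)
  · simp only [Test.cost, RealExp.cost, NatExp.cost]
    omega
  · rintro s ⟨hs, h4, hna⟩
    exact ⟨hs, hna⟩

end RealRAM

/-! ### Correctness and cost of the sampling phase -/

namespace RealRAM

open Finset

variable {ω : Tape} {r : ℕ} {α ε : ℝ}
set_option linter.unusedSimpArgs false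

theorem runs_scanLoop {L K N d : ℕ} {S : ℕ → ℝ} {s : Store} {W H : ℕ → ℕ} {i : ℕ} {x : ℝ} {y : Bool}
    (hs : Holds r α ε L K N d S s) (h4 : s.nreg 4 = i) (h3 : s.rreg 3 = x)
    (h5 : s.nreg 5 = y.toNat) (h6 : s.nreg 6 = 0) (h7 : s.nreg 7 = 0) (hW : s.narr 0 = W)
    (hH : s.narr 1 = H) :
    Runs ω (.loop (.natLe (.add (.reg 7) (.const 1)) (.reg 3)) scanBody) s (60 * N + 10) fun s' =>
      Holds r α ε L K N d S s' ∧ s'.nreg 4 = i ∧ s'.nreg 5 = y.toNat ∧ s'.nreg 6 = rank S N x ∧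
        s'.narr 0 = W ∧ s'.narr 1 = fun a => H a + upIndex S N x y a := by
  refine (Runs.loop (B := 50) (N := N) (fun j s' =>
      Holds r α ε L K N d S s' ∧ s'.nreg 4 = i ∧ s'.nreg 5 = y.toNat ∧ s'.nreg 6 = rank S j x ∧
        s'.narr 0 = W ∧ (s'.narr 1 = fun a => H a + upIndex S j x y a) ∧
        s'.nreg 7 = j ∧ s'.rreg 3 = x)
        ⟨hs, h4, h5, by simp [h6, rank], hW, by simp [hH, upIndex], h7, h3⟩ ?_ ?_).mono ?_ ?_
  · rintro j hj s ⟨hs, h4, h5, h6, hW, hH, h7, h3⟩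
    refine ⟨?_, ?_⟩
    · simp only [Test.eval, NatExp.eval, hs.hN, h7]
      omega
    · refine Runs.of_loopFree rfl (by
        norm_num [Prog.straightCost, scanBody, NatExp.pair, Test.cost, RealExp.cost, NatExp.cost]) ?_
      have hSj := hs.hS j hj
      have e3 : ∀ a, a = j + j + y.toNat ↔ 2 * j + y.toNat = a := fun a => by omega
      -- The rank grows by 2, 1 or 0 according as S j < x, S j = x or S j > x; an up-count changes
      -- only in the first two cases.
      by_cases hle : S j ≤ x
      · have hW' : ∀ a, s.narr 0 a = W a := fun a => congrFun hW a
        rcases hle.lt_or_eq with h | h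
        on_goal 1 => have h' : ¬ x ≤ S j := not_le.2 h
        on_goal 2 => have h' : x ≤ S j := h.ge
        all_goals
          refine ⟨⟨?_, ?_, ?_, ?_, ?_, ?_, ?_, fun t ht => ?_⟩, ?_, ?_, ?_, funext fun a => ?_,
            funext fun a => ?_, ?_, ?_⟩
          pick_goal 13
          · by_cases ha : 2 * j + y.toNat = a
            · have ha' : s.narr 1 (j + j + y.toNat) = H a + upIndex S j x y a := by
                rw [hH, ← ha, two_mul]
              simp [scanBody, NatExp.pair, Prog.straightRun, Test.eval, NatExp.eval, RealExp.eval,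
                h7, h3, h5, hSj, h', hle, upIndex_succ, e3, ha, ha']
              omega
            · simp [scanBody, NatExp.pair, Prog.straightRun, Test.eval, NatExp.eval, RealExp.eval,
                h7, h3, h5, hSj, h', hle, hH, upIndex_succ, e3, ha]
        all_goals simp [scanBody, NatExp.pair, Prog.straightRun, Test.eval, NatExp.eval,
            RealExp.eval, hs.hr, hs.hα, hs.hε, hs.hL, hs.hK, hs.hN, hs.hd, h4, h5, h6, h7, h3, hSj,
            h', h, hle, rank_succ, add_assoc, hW']
        all_goals exact hs.hS t ht
      · have h' := (not_le.1 hle).le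
        refine ⟨⟨?_, ?_, ?_, ?_, ?_, ?_, ?_, fun t ht => ?_⟩, ?_, ?_, ?_, ?_, funext fun a => ?_,
          ?_, ?_⟩
        all_goals simp [scanBody, Prog.straightRun, Test.eval, NatExp.eval, RealExp.eval, hs.hr,
            hs.hα, hs.hε, hs.hL, hs.hK, hs.hN, hs.hd, h4, h5, h6, h7, h3, hSj, hle, h',
            not_lt.2 h', rank_succ, upIndex_succ, hW, hH]
        exact hs.hS t ht
  · rintro s ⟨hs, h4, h5, h6, hW, hH, h7, h3⟩
    simp [Test.eval, NatExp.eval, hs.hN, h7]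
  · simp only [Test.cost, NatExp.cost]
    omega
  · rintro s ⟨hs, h4, h5, h6, hW, hH, h7, h3⟩
    exact ⟨hs, h4, h5, h6, hW, hH⟩

theorem runs_sampleProg {s : Store} {m K N : ℕ} {S : ℕ → ℝ}
    (hs : Holds r α ε (scale r ε) K N m S s ∧ s.narr = fun _ _ => 0) :
    Runs ω sampleProg s ((sampleSize r ε + 1) * (60 * N + 60)) fun s =>
      Holds r α ε (scale r ε) K N (m + sampleSize r ε) S s ∧ s.nreg 4 = sampleSize r ε ∧
        s.narr 0 = cellCount S N (fun j => ω.1 (m + j)) (sampleSize r ε) ∧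
        s.narr 1 = upCount S N (fun j => ω.1 (m + j)) (sampleSize r ε) := by
  let Inv : ℕ → Store → Prop := fun i s =>
      Holds r α ε (scale r ε) K N (m + i) S s ∧ s.nreg 4 = i ∧
        s.narr 0 = cellCount S N (fun j => ω.1 (m + j)) i ∧
        s.narr 1 = upCount S N (fun j => ω.1 (m + j)) i
  refine (Runs.seq (R := Inv 0) (B := 2) ?_ fun s' hs' =>
    Runs.loop (B := (60 * N + 40)) (N := sampleSize r ε) Inv hs' ?_ ?_).mono ?_ fun _ h => h
  · refine Runs.of_loopFree rfl (by norm_num [Prog.straightCost, NatExp.cost]) ?_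
    refine ⟨⟨?_, ?_, ?_, ?_, ?_, ?_, ?_, fun t ht => ?_⟩, ?_, funext fun a => ?_,
      funext fun a => ?_⟩
    all_goals simp [Prog.straightRun, NatExp.eval, hs.1.hr, hs.1.hα, hs.1.hε, hs.1.hL, hs.1.hK,
      hs.1.hN, hs.1.hd, hs.2, cellCount, upCount]
    exact hs.1.hS t ht
  · rintro i hi s ⟨hs, h4, hW, hH⟩
    refine ⟨?_, ?_⟩
    · rw [sampleSize, Nat.lt_ceil] at hi
      simpa [Test.eval, RealExp.eval, NatExp.eval, hs.hr, hs.hε, hs.hL, h4] using hi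
    · refine (Runs.seq (B := 5) (R := fun s => Holds r α ε (scale r ε) K N (m + (i + 1)) S s ∧
        s.nreg 4 = i ∧ s.narr 0 = cellCount S N (fun j => ω.1 (m + j)) i ∧
        s.narr 1 = upCount S N (fun j => ω.1 (m + j)) i ∧ s.nreg 6 = 0 ∧ s.nreg 7 = 0 ∧
        s.nreg 5 = (ω.1 (m + i)).2.toNat ∧ s.rreg 3 = (ω.1 (m + i)).1) ?_ fun s hs =>
        Runs.seq (runs_scanLoop hs.1 hs.2.1 hs.2.2.2.2.2.2.2 hs.2.2.2.2.2.2.1 hs.2.2.2.2.1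
          hs.2.2.2.2.2.1 hs.2.2.1 hs.2.2.2.1) (B' := 20) fun s hs => ?_).mono ?_ fun _ h => h
      · refine Runs.of_loopFree rfl (by norm_num [Prog.straightCost, NatExp.cost]) ?_
        refine ⟨⟨?_, ?_, ?_, ?_, ?_, ?_, ?_, fun t ht => ?_⟩, ?_, ?_, ?_, ?_, ?_, ?_, ?_⟩
        all_goals simp [Prog.straightRun, NatExp.eval, hs.hr, hs.hα, hs.hε, hs.hL, hs.hK,
          hs.hN, hs.hd, h4, hW, hH, add_assoc]
        exact hs.hS t ht
      · obtain ⟨hs, h4, h5, h6, hW, hH⟩ := hs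
        refine Runs.of_loopFree rfl
          (by norm_num [Prog.straightCost, NatExp.pair, Test.cost, RealExp.cost, NatExp.cost]) ?_
        refine ⟨⟨?_, ?_, ?_, ?_, ?_, ?_, ?_, fun t ht => ?_⟩, ?_, funext fun a => ?_,
          funext fun a => ?_⟩
        case refine_10 =>
          by_cases ha : 2 * rank S N (ω.1 (m + i)).1 + (ω.1 (m + i)).2.toNat = a
          · subst ha
            simp [Prog.straightRun, NatExp.pair, NatExp.eval, h5, h6, hW, cellCount_succ, two_mul]
          · have ha' : ¬ a = rank S N (ω.1 (m + i)).1 + rank S N (ω.1 (m + i)).1 +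
              (ω.1 (m + i)).2.toNat := by omega
            simp [Prog.straightRun, NatExp.pair, NatExp.eval, h5, h6, hW, cellCount_succ, ha, ha']
        all_goals simp [Prog.straightRun, NatExp.pair, NatExp.eval, hs.hr, hs.hα, hs.hε, hs.hL,
          hs.hK, hs.hN, hs.hd, h4, hH, upCount_succ]
        exact hs.hS t ht
      · omega
  · rintro s ⟨hs, h4, hW, hH⟩
    simpa [Test.eval, RealExp.eval, NatExp.eval, hs.hr, hs.hε, hs.hL, h4, sampleSize] using
      Nat.le_ceil (50000 * (r / ε / ε) * scale r ε)
  · simp only [Test.cost, RealExp.cost, NatExp.cost]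
    ring_nf
    omega

end RealRAM

/-! ### Correctness and cost of the dynamic program and the decision -/

namespace RealRAM

open Finset

variable {ω : Tape} {r : ℕ} {α ε : ℝ}
set_option linter.unusedSimpArgs false

/-- Weight of cell `c` at threshold `v`: the sum of `y - v` over its examples, where
`A (2 * c + y)` of them have label `y`. -/
noncomputable def weightOf (A : ℕ → ℕ) (v : ℝ) (c : ℕ) : ℝ :=
  A (2 * c + 1) * (1 - v) - A (2 * c) * v

/-- The condition under which the tester rejects at threshold `v` and point number `t`. -/
def Exceeds (r : ℕ) (α ε : ℝ) (K N n : ℕ) (S : ℕ → ℝ) (W H : ℕ → ℕ) (v : ℝ) (t : ℕ) : Prop :=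
  S t ≤ v ∧ v ≤ S t + 1 / K ∧
    (α - ε / 2) * n < 2 * (pathBest (weightOf W v) (2 * N + 1) (2 * r) - weightOf H v t)

/-- Store contents after sampling. -/
structure Sampled (r : ℕ) (α ε : ℝ) (L K N d n : ℕ) (S : ℕ → ℝ) (W H : ℕ → ℕ) (s : Store) : Prop
    extends Holds r α ε L K N d S s where
  hn : s.nreg 4 = n
  hW : s.narr 0 = W
  hH : s.narr 1 = H

open Classical in
/-- The truth value of `p` as a number. -/
noncomputable def flag (p : Prop) : ℕ := if p then 1 else 0

theorem flag_true {p : Prop} (h : p) : flag p = 1 := by simp [flag, h]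

theorem flag_false {p : Prop} (h : ¬ p) : flag p = 0 := by simp [flag, h]

variable {L K N d n : ℕ} {S : ℕ → ℝ} {W H : ℕ → ℕ} {v : ℝ} {k f : ℕ} {s : Store}

theorem runs_clearProg (hs : Sampled r α ε L K N d n S W H s ∧ s.rreg 4 = v ∧ s.nreg 8 = k ∧
      s.nreg 10 = f) :
    Runs ω clearProg s (40 * (r + 1)) fun s =>
      Sampled r α ε L K N d n S W H s ∧ s.rreg 4 = v ∧ s.nreg 8 = k ∧ s.nreg 10 = f ∧
        ∀ q ≤ 2 * r, s.rarr 1 q = 0 := by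
  let Inv : ℕ → Store → Prop := fun i s =>
      Sampled r α ε L K N d n S W H s ∧ s.rreg 4 = v ∧ s.nreg 8 = k ∧ s.nreg 10 = f ∧
        (∀ q < i, s.rarr 1 q = 0) ∧ s.nreg 9 = i
  refine (Runs.seq (R := Inv 0) (B := 2) ?_ fun s' hs' =>
    Runs.loop (B := 8) (N := 2 * r + 1) Inv hs' ?_ ?_).mono ?_ ?_
  · obtain ⟨hs, hv, h8, h10⟩ := hs
    refine Runs.of_loopFree rfl (by norm_num [Prog.straightCost, NatExp.cost]) ?_
    refine ⟨⟨⟨?_, ?_, ?_, ?_, ?_, ?_, ?_, fun t ht => ?_⟩, ?_, ?_, ?_⟩, ?_, ?_, ?_, ?_, ?_⟩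
    all_goals simp [Prog.straightRun, NatExp.eval, hs.hr, hs.hα, hs.hε, hs.hL, hs.hK, hs.hN, hs.hd,
      hs.hn, hs.hW, hs.hH, hv, h8, h10]
    exact hs.hS t ht
  · rintro i hi s ⟨hs, hv, h8, h10, hD, h9⟩
    refine ⟨?_, ?_⟩
    · simp only [Test.eval, NatExp.eval, hs.hr, h9]
      omega
    · refine Runs.of_loopFree rfl (by norm_num [Prog.straightCost, RealExp.cost, NatExp.cost]) ?_
      refine ⟨⟨⟨?_, ?_, ?_, ?_, ?_, ?_, ?_, fun t ht => ?_⟩, ?_, ?_, ?_⟩, ?_, ?_, ?_,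
        fun q (hq : q < i + 1) => ?_, ?_⟩
      case refine_8 => simpa [Prog.straightRun] using hs.hS t ht
      case refine_15 =>
        simp only [Prog.straightRun, NatExp.eval, RealExp.eval, h9, setCell_apply]
        rcases Nat.lt_succ_iff_lt_or_eq.1 hq with h | rfl
        · rw [if_neg (by omega)]
          exact hD q h
        · simp
      all_goals simp [Prog.straightRun, NatExp.eval, RealExp.eval, hs.hr, hs.hα, hs.hε, hs.hL,
        hs.hK, hs.hN, hs.hd, hs.hn, hs.hW, hs.hH, hv, h8, h9, h10]
  · rintro s ⟨hs, hv, h8, h10, hD, h9⟩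
    simp only [Test.eval, NatExp.eval, hs.hr, h9]
    omega
  · simp only [Test.cost, NatExp.cost]
    omega
  · rintro s ⟨hs, hv, h8, h10, hD, h9⟩
    exact ⟨hs, hv, h8, h10, fun q hq => hD q (Nat.lt_succ_of_le hq)⟩

theorem pathBest_zero_right (w : ℕ → ℝ) (c : ℕ) : pathBest w c 0 = 0 := by
  induction c with
  | zero => simp [pathBest]
  | succ c ih => simpa [pathBest] using ih

/-- The invariant after i columns: entries below i belong to row c + 1, the others still to row c.
-/
theorem runs_stepLoop {w : ℕ → ℝ} {c : ℕ}
    (hs : Sampled r α ε L K N d n S W H s ∧ s.rreg 4 = v ∧ s.nreg 8 = k ∧ s.nreg 10 = f ∧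
      s.nreg 11 = c ∧ s.rreg 5 = w c ∧ (∀ q ≤ 2 * r, s.rarr 1 q = pathBest w c q) ∧
      s.nreg 9 = 0 ∧ s.rreg 6 = 0) :
    Runs ω (.loop (.natLe (.reg 9) (.add (.reg 0) (.reg 0))) stepBody) s (100 * (r + 1)) fun s =>
      Sampled r α ε L K N d n S W H s ∧ s.rreg 4 = v ∧ s.nreg 8 = k ∧ s.nreg 10 = f ∧
        s.nreg 11 = c ∧ ∀ q ≤ 2 * r, s.rarr 1 q = pathBest w (c + 1) q := by
  refine (Runs.loop (B := 40) (N := 2 * r + 1) (fun i s =>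
      Sampled r α ε L K N d n S W H s ∧ s.rreg 4 = v ∧ s.nreg 8 = k ∧ s.nreg 10 = f ∧
      s.nreg 11 = c ∧ s.rreg 5 = w c ∧
      (∀ q ≤ 2 * r, s.rarr 1 q = if q < i then pathBest w (c + 1) q else pathBest w c q) ∧
      s.nreg 9 = i ∧ s.rreg 6 = if Odd i then 1 else 0) (by simpa using hs) ?_ ?_).mono ?_ ?_
  · rintro i hi s ⟨hs, hv, h8, h10, h11, hw, hD, h9, h6⟩
    refine ⟨?_, ?_⟩
    · simp only [Test.eval, NatExp.eval, hs.hr, h9]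
      omega
    · refine Runs.of_loopFree rfl
        (by norm_num [Prog.straightCost, stepBody, Test.cost, RealExp.cost, NatExp.cost]) ?_
      have hpar : (1 : ℝ) - (if Odd i then 1 else 0) = if Odd (i + 1) then 1 else 0 := by
        by_cases h : Odd i <;> simp [h, Nat.odd_add_one]
      have hDi := hD i (by omega)
      rw [if_neg (lt_irrefl i)] at hDi
      have hDi' : i ≠ 0 → s.rarr 1 (i - 1) = pathBest w (c + 1) (i - 1) := fun h0 => by
        rw [hD (i - 1) (by omega), if_pos (by omega)]
      -- In column 0 the index i - 1 truncates to 0: the entry is compared with itself and, the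
      -- parity being even, keeps the value 0.
      rcases Nat.eq_zero_or_pos i with rfl | hpos
      · refine ⟨⟨⟨?_, ?_, ?_, ?_, ?_, ?_, ?_, fun t ht => ?_⟩, ?_, ?_, ?_⟩, ?_, ?_, ?_, ?_, ?_,
          fun q hq => ?_, ?_, ?_⟩
        case refine_8 =>
          simpa [stepBody, Prog.straightRun, Test.eval, NatExp.eval, RealExp.eval, h9] using
            hs.hS t ht
        case refine_17 =>
          by_cases hq0 : q = 0
          · subst hq0
            simp [stepBody, Prog.straightRun, Test.eval, NatExp.eval, RealExp.eval, h9, h6, hDi,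
              pathBest_zero_right]
          · simpa [stepBody, Prog.straightRun, Test.eval, NatExp.eval, RealExp.eval, h9, hq0]
              using hD q hq
        all_goals simp [stepBody, Prog.straightRun, Test.eval, NatExp.eval, RealExp.eval, hs.hr,
          hs.hα, hs.hε, hs.hL, hs.hK, hs.hN, hs.hd, hs.hn, hs.hW, hs.hH, hv, h8, h9, h10, h11, hw,
          h6]
      · obtain ⟨j, rfl⟩ := Nat.exists_eq_add_of_le' hpos
        have hDj := hDi' (by omega)
        simp only [Nat.add_sub_cancel] at hDj
        by_cases hle : pathBest w (c + 1) j ≤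
          pathBest w c (j + 1) + if Odd (j + 1) then w c else 0
        all_goals
          refine ⟨⟨⟨?_, ?_, ?_, ?_, ?_, ?_, ?_, fun t ht => ?_⟩, ?_, ?_, ?_⟩, ?_, ?_, ?_, ?_, ?_,
            fun q hq => ?_, ?_, ?_⟩
          pick_goal 8
          · simpa [stepBody, Prog.straightRun, Test.eval, NatExp.eval, RealExp.eval, h9, h6, hw,
              hDi, hDj, hle] using hs.hS t ht
          pick_goal 16
          · by_cases hq0 : q = j + 1
            · subst hq0
              have hmax := pathBest.eq_3 w c j
              simp only [max_def', ge_iff_le, hle, if_true, if_false] at hmax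
              simp [stepBody, Prog.straightRun, Test.eval, NatExp.eval, RealExp.eval, h9, h6, hw,
                hDi, hDj, hle, hmax]
            · have h1 : (q < j + 1 + 1) = (q < j + 1) := propext (by omega)
              have h2 := hD q hq
              simpa [stepBody, Prog.straightRun, Test.eval, NatExp.eval, RealExp.eval, h9, h6, hw,
                hDi, hDj, hle, hq0, h1] using h2
          all_goals simp [stepBody, Prog.straightRun, Test.eval, NatExp.eval, RealExp.eval, hs.hr,
            hs.hα, hs.hε, hs.hL, hs.hK, hs.hN, hs.hd, hs.hn, hs.hW, hs.hH, hv, h8, h9, h10, h11, hw,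
            h6, hDi, hDj, hle, hpar]
  · rintro s ⟨hs, hv, h8, h10, h11, hw, hD, h9, h6⟩
    simp only [Test.eval, NatExp.eval, hs.hr, h9]
    omega
  · simp only [Test.cost, NatExp.cost]
    omega
  · rintro s ⟨hs, hv, h8, h10, h11, hw, hD, h9, h6⟩
    exact ⟨hs, hv, h8, h10, h11, fun q hq => by
      rw [hD q hq, if_pos (Nat.lt_succ_of_le hq)]⟩

theorem runs_dynProg (hs : Sampled r α ε L K N d n S W H s ∧ s.rreg 4 = v ∧ s.nreg 8 = k ∧
      s.nreg 10 = f ∧ ∀ q ≤ 2 * r, s.rarr 1 q = 0) :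
    Runs ω dynProg s ((2 * N + 2) * (100 * r + 200)) fun s =>
      Sampled r α ε L K N d n S W H s ∧ s.rreg 4 = v ∧ s.nreg 8 = k ∧ s.nreg 10 = f ∧
        ∀ q ≤ 2 * r, s.rarr 1 q = pathBest (weightOf W v) (2 * N + 1) q := by
  let Inv : ℕ → Store → Prop := fun i s =>
      Sampled r α ε L K N d n S W H s ∧ s.rreg 4 = v ∧ s.nreg 8 = k ∧ s.nreg 10 = f ∧
        (∀ q ≤ 2 * r, s.rarr 1 q = pathBest (weightOf W v) i q) ∧ s.nreg 11 = i
  refine (Runs.seq (R := Inv 0) (B := 2) ?_ fun s' hs' =>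
    Runs.loop (B := (100 * (r + 1) + 50)) (N := 2 * N + 1) Inv hs' ?_ ?_).mono ?_ ?_
  · obtain ⟨hs, hv, h8, h10, hD⟩ := hs
    refine Runs.of_loopFree rfl (by norm_num [Prog.straightCost, NatExp.cost]) ?_
    refine ⟨⟨⟨?_, ?_, ?_, ?_, ?_, ?_, ?_, fun t ht => ?_⟩, ?_, ?_, ?_⟩, ?_, ?_, ?_,
      fun q hq => ?_, ?_⟩
    case refine_8 => exact hs.hS t ht
    case refine_15 => simpa [pathBest, Prog.straightRun] using hD q hq
    all_goals simp [Prog.straightRun, NatExp.eval, hs.hr, hs.hα, hs.hε, hs.hL, hs.hK, hs.hN, hs.hd,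
      hs.hn, hs.hW, hs.hH, hv, h8, h10]
  · rintro i hi s ⟨hs, hv, h8, h10, hD, h11⟩
    refine ⟨?_, ?_⟩
    · simp only [Test.eval, NatExp.eval, hs.hN, h11]
      omega
    · refine (Runs.seq (B := 40) (R := fun s =>
        Sampled r α ε L K N d n S W H s ∧ s.rreg 4 = v ∧ s.nreg 8 = k ∧ s.nreg 10 = f ∧
        s.nreg 11 = i ∧ s.rreg 5 = weightOf W v i ∧
        (∀ q ≤ 2 * r, s.rarr 1 q = pathBest (weightOf W v) i q) ∧ s.nreg 9 = 0 ∧ s.rreg 6 = 0) ?_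
        fun s hs => Runs.seq (runs_stepLoop hs) (B' := 10) fun s hs => ?_).mono ?_ fun _ h => h
      · refine Runs.of_loopFree rfl
          (by norm_num [Prog.straightCost, RealExp.weight, RealExp.cost, NatExp.cost]) ?_
        refine ⟨⟨⟨?_, ?_, ?_, ?_, ?_, ?_, ?_, fun t ht => ?_⟩, ?_, ?_, ?_⟩, ?_, ?_, ?_, ?_, ?_,
          fun q hq => ?_, ?_, ?_⟩
        case refine_8 => exact hs.hS t ht
        case refine_17 => exact hD q hq
        all_goals simp [Prog.straightRun, RealExp.weight, weightOf, NatExp.eval, RealExp.eval, hs.hr,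
          hs.hα, hs.hε, hs.hL, hs.hK, hs.hN, hs.hd, hs.hn, hs.hW, hs.hH, hv, h8, h10, h11, two_mul]
      · obtain ⟨hs, hv, h8, h10, h11, hD⟩ := hs
        refine Runs.of_loopFree rfl (by norm_num [Prog.straightCost, NatExp.cost]) ?_
        refine ⟨⟨⟨?_, ?_, ?_, ?_, ?_, ?_, ?_, fun t ht => ?_⟩, ?_, ?_, ?_⟩, ?_, ?_, ?_,
          fun q hq => ?_, ?_⟩
        case refine_8 => exact hs.hS t ht
        case refine_15 => exact hD q hq
        all_goals simp [Prog.straightRun, NatExp.eval, hs.hr, hs.hα, hs.hε, hs.hL, hs.hK, hs.hN,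
          hs.hd, hs.hn, hs.hW, hs.hH, hv, h8, h10, h11]
      · omega
  · rintro s ⟨hs, hv, h8, h10, hD, h11⟩
    simp only [Test.eval, NatExp.eval, hs.hN, h11]
    omega
  · simp only [Test.cost, NatExp.cost]
    nlinarith
  · rintro s ⟨hs, hv, h8, h10, hD, h11⟩
    exact ⟨hs, hv, h8, h10, hD⟩

theorem runs_compareProg {F : Prop} (hs : Sampled r α ε L K N d n S W H s ∧ s.rreg 4 = v ∧
      s.nreg 8 = k ∧ s.nreg 10 = flag F ∧
        ∀ q ≤ 2 * r, s.rarr 1 q = pathBest (weightOf W v) (2 * N + 1) q) :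
    Runs ω compareProg s (100 * (N + 1)) fun s =>
      Sampled r α ε L K N d n S W H s ∧ s.nreg 8 = k ∧
        s.nreg 10 = flag (F ∨ ∃ t < N, Exceeds r α ε K N n S W H v t) := by
  let Inv : ℕ → Store → Prop := fun i s =>
      Sampled r α ε L K N d n S W H s ∧ s.rreg 4 = v ∧ s.nreg 8 = k ∧
        (∀ q ≤ 2 * r, s.rarr 1 q = pathBest (weightOf W v) (2 * N + 1) q) ∧ s.nreg 7 = i ∧
        s.nreg 10 = flag (F ∨ ∃ t < i, Exceeds r α ε K N n S W H v t)
  refine (Runs.seq (R := Inv 0) (B := 2) ?_ fun s' hs' =>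
    Runs.loop (B := 80) (N := N) Inv hs' ?_ ?_).mono ?_ ?_
  · obtain ⟨hs, hv, h8, h10, hD⟩ := hs
    refine Runs.of_loopFree rfl (by norm_num [Prog.straightCost, NatExp.cost]) ?_
    refine ⟨⟨⟨?_, ?_, ?_, ?_, ?_, ?_, ?_, fun t ht => ?_⟩, ?_, ?_, ?_⟩, ?_, ?_,
      fun q hq => ?_, ?_, ?_⟩
    case refine_8 => exact hs.hS t ht
    case refine_14 => exact hD q hq
    all_goals simp [Prog.straightRun, NatExp.eval, hs.hr, hs.hα, hs.hε, hs.hL, hs.hK, hs.hN, hs.hd,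
      hs.hn, hs.hW, hs.hH, hv, h8, h10]
  · rintro i hi s ⟨hs, hv, h8, hD, h7, h10⟩
    refine ⟨?_, ?_⟩
    · simp only [Test.eval, NatExp.eval, hs.hN, h7]
      omega
    · refine Runs.of_loopFree rfl (by norm_num [Prog.straightCost, compareBody, RealExp.weight,
        Test.cost, RealExp.cost, NatExp.cost]) ?_
      have hex : (∃ t < i + 1, Exceeds r α ε K N n S W H v t) ↔
          (∃ t < i, Exceeds r α ε K N n S W H v t) ∨ Exceeds r α ε K N n S W H v i := by
        constructor
        · rintro ⟨t, ht, h⟩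
          rcases Nat.lt_succ_iff_lt_or_eq.1 ht with h' | rfl
          exacts [.inl ⟨t, h', h⟩, .inr h]
        · rintro (⟨t, ht, h⟩ | h)
          exacts [⟨t, by omega, h⟩, ⟨i, by omega, h⟩]
      have hcond : (Test.conj (.realLe (.get 0 (.reg 7)) (.reg 4))
          (.conj (.realLe (.reg 4) (.add (.get 0 (.reg 7)) (.div (.const 1) (.cast (.reg 2)))))
          (.neg (.realLe
          (.mul (.const 2) (.sub (.get 1 (.add (.reg 0) (.reg 0))) (.weight 1 7)))
          (.mul (.sub (.reg 0) (.div (.reg 1) (.const 2))) (.cast (.reg 4))))))).eval s ↔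
          Exceeds r α ε K N n S W H v i := by
        simp [Test.eval, RealExp.eval, NatExp.eval, RealExp.weight, weightOf, Exceeds, h7, hs.hr,
          hs.hα, hs.hε, hs.hK, hs.hn, hs.hH, hv, hs.hS i hi, hD (r + r) (by omega), two_mul]
      by_cases hc : Exceeds r α ε K N n S W H v i
      all_goals
        have hc' := hc
        rw [← hcond] at hc'
        refine ⟨⟨⟨?_, ?_, ?_, ?_, ?_, ?_, ?_, fun t ht => ?_⟩, ?_, ?_, ?_⟩, ?_, ?_,
          fun q hq => ?_, ?_, ?_⟩
        pick_goal 8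
        · simpa [compareBody, Prog.straightRun, hc'] using hs.hS t ht
        pick_goal 13
        · simpa [compareBody, Prog.straightRun, hc'] using hD q hq
        pick_goal 14
        · rw [hex]
          simp [compareBody, Prog.straightRun, NatExp.eval, hc', hc, h10, flag_true]
        all_goals simp [compareBody, Prog.straightRun, NatExp.eval, hc', hs.hr,
          hs.hα, hs.hε, hs.hL, hs.hK, hs.hN, hs.hd, hs.hn, hs.hW, hs.hH, hv, h8, h7]
  · rintro s ⟨hs, hv, h8, hD, h7, h10⟩
    simp [Test.eval, NatExp.eval, hs.hN, h7]
  · simp only [Test.cost, NatExp.cost]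
    omega
  · rintro s ⟨hs, hv, h8, hD, h7, h10⟩
    exact ⟨hs, h8, h10⟩

theorem runs_decideProg (hs : Sampled r α ε L K N d n S W H s) :
    Runs ω decideProg s ((K + 2) * ((2 * N + 3) * (100 * r + 300))) fun s =>
      s.draws = d ∧ s.nreg 0 =
        1 - flag (∃ k ≤ K, ∃ t < N, Exceeds r α ε K N n S W H ((k : ℝ) / K) t) := by
  let Inv : ℕ → Store → Prop := fun i s =>
      Sampled r α ε L K N d n S W H s ∧ s.nreg 8 = i ∧
        s.nreg 10 = flag (∃ k < i, ∃ t < N, Exceeds r α ε K N n S W H ((k : ℝ) / K) t)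
  refine (Runs.seq (R := Inv 0) (B := 4) ?_ fun s' hs' => Runs.seq
    (Runs.loop (B := (2 * N + 2) * (100 * r + 200) + 40 * (r + 1) + 100 * (N + 1) + 10)
      (N := K + 1) Inv hs' ?_ ?_) (B' := 4) fun s hs => ?_).mono ?_ fun _ h => h
  · refine Runs.of_loopFree rfl (by norm_num [Prog.straightCost, NatExp.cost]) ?_
    refine ⟨⟨⟨?_, ?_, ?_, ?_, ?_, ?_, ?_, fun t ht => ?_⟩, ?_, ?_, ?_⟩, ?_, ?_⟩
    case refine_8 => exact hs.hS t ht
    all_goals simp [Prog.straightRun, NatExp.eval, hs.hr, hs.hα, hs.hε, hs.hL, hs.hK, hs.hN, hs.hd,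
      hs.hn, hs.hW, hs.hH, flag_false]
  · rintro i hi s ⟨hs, h8, h10⟩
    refine ⟨?_, ?_⟩
    · simp only [Test.eval, NatExp.eval, hs.hK, h8]
      omega
    · refine (Runs.seq (B := 6) (R := fun s => Sampled r α ε L K N d n S W H s ∧
          s.rreg 4 = (i : ℝ) / K ∧ s.nreg 8 = i ∧ s.nreg 10 =
            flag (∃ k < i, ∃ t < N, Exceeds r α ε K N n S W H ((k : ℝ) / K) t)) ?_
        fun s hs => Runs.seq (runs_clearProg hs) fun s hs => Runs.seq (runs_dynProg hs)
        fun s hs => Runs.seq (runs_compareProg hs) (B' := 4) fun s hs => ?_).mono ?_ fun _ h => h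
      · refine Runs.of_loopFree rfl (by norm_num [Prog.straightCost, RealExp.cost, NatExp.cost]) ?_
        refine ⟨⟨⟨?_, ?_, ?_, ?_, ?_, ?_, ?_, fun t ht => ?_⟩, ?_, ?_, ?_⟩, ?_, ?_, ?_⟩
        case refine_8 => exact hs.hS t ht
        all_goals simp [Prog.straightRun, RealExp.eval, NatExp.eval, hs.hr, hs.hα, hs.hε, hs.hL,
          hs.hK, hs.hN, hs.hd, hs.hn, hs.hW, hs.hH, h8, h10]
      · obtain ⟨hs, h8, h10⟩ := hs
        have hex : (∃ k < i + 1, ∃ t < N, Exceeds r α ε K N n S W H ((k : ℝ) / K) t) ↔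
            (∃ k < i, ∃ t < N, Exceeds r α ε K N n S W H ((k : ℝ) / K) t) ∨
              ∃ t < N, Exceeds r α ε K N n S W H ((i : ℝ) / K) t := by
          constructor
          · rintro ⟨t, ht, h⟩
            rcases Nat.lt_succ_iff_lt_or_eq.1 ht with h' | rfl
            exacts [.inl ⟨t, h', h⟩, .inr h]
          · rintro (⟨t, ht, h⟩ | h)
            exacts [⟨t, by omega, h⟩, ⟨i, by omega, h⟩]
        refine Runs.of_loopFree rfl (by norm_num [Prog.straightCost, NatExp.cost]) ?_
        refine ⟨⟨⟨?_, ?_, ?_, ?_, ?_, ?_, ?_, fun t ht => ?_⟩, ?_, ?_, ?_⟩, ?_, ?_⟩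
        case refine_8 => exact hs.hS t ht
        case refine_13 =>
          rw [hex]
          simpa [Prog.straightRun, NatExp.eval] using h10
        all_goals simp [Prog.straightRun, NatExp.eval, hs.hr, hs.hα, hs.hε, hs.hL,
          hs.hK, hs.hN, hs.hd, hs.hn, hs.hW, hs.hH, h8]
      · omega
  · rintro s ⟨hs, h8, h10⟩
    simp only [Test.eval, NatExp.eval, hs.hK, h8]
    omega
  · obtain ⟨hs, h8, h10⟩ := hs
    refine Runs.of_loopFree rfl (by norm_num [Prog.straightCost, NatExp.cost]) ⟨hs.hd, ?_⟩
    simp only [Nat.lt_succ_iff] at h10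
    simp only [Prog.straightRun, NatExp.eval, h10, Function.update_self]
  · simp only [Test.cost, NatExp.cost]
    nlinarith [Nat.zero_le (K * N), Nat.zero_le (K * r), Nat.zero_le (N * r)]

/-- The tester halts after `m + n` draws, with the stated answer. -/
theorem exists_exec_tester (hr : 1 ≤ r) (hε : 0 < ε) (ω : Tape) :
    Runs ω tester (input r α ε)
      (20 * (scale r ε + 1) + (40 * (gridSize ε + 1) + (40 * (pointDraws r ε + 1) +
        ((sampleSize r ε + 1) * (60 * numPoints r ε + 60) +
        (gridSize ε + 2) * ((2 * numPoints r ε + 3) * (100 * r + 300)))))) fun s =>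
      s.draws = pointDraws r ε + sampleSize r ε ∧
      ((∃ k ≤ gridSize ε, ∃ t < numPoints r ε, Exceeds r α ε (gridSize ε) (numPoints r ε)
          (sampleSize r ε) (points (gridSize ε) ω)
          (cellCount (points (gridSize ε) ω) (numPoints r ε)
            (fun j => ω.1 (pointDraws r ε + j)) (sampleSize r ε))
          (upCount (points (gridSize ε) ω) (numPoints r ε)
            (fun j => ω.1 (pointDraws r ε + j)) (sampleSize r ε)) ((k : ℝ) / gridSize ε) t) →
        s.nreg 0 = 0) ∧
      ((¬ ∃ k ≤ gridSize ε, ∃ t < numPoints r ε, Exceeds r α ε (gridSize ε) (numPoints r ε)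
          (sampleSize r ε) (points (gridSize ε) ω)
          (cellCount (points (gridSize ε) ω) (numPoints r ε)
            (fun j => ω.1 (pointDraws r ε + j)) (sampleSize r ε))
          (upCount (points (gridSize ε) ω) (numPoints r ε)
            (fun j => ω.1 (pointDraws r ε + j)) (sampleSize r ε)) ((k : ℝ) / gridSize ε) t) →
        s.nreg 0 = 1) := by
  refine Runs.mono (Runs.seq (runs_scaleProg hr hε) fun s hs => Runs.seq (runs_gridProg hs)
    fun s hs => Runs.seq (runs_pointProg hs) fun s hs => Runs.seq (runs_sampleProg hs)
    fun s hs => runs_decideProg ⟨hs.1, hs.2.1, hs.2.2.1, hs.2.2.2⟩) le_rfl ?_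
  rintro s ⟨hd, h0⟩
  refine ⟨hd, fun h => ?_, fun h => ?_⟩
  · rw [h0, flag_true h]
  · rw [h0, flag_false h]

end RealRAM

namespace Calib

open Set

/-! ### Unions of `r` intervals as odd level sets of monotone functions -/

/-- Monotone functions from `[0,1]` to `{0, …, 2 r}`; the points at which such a function is odd
form a union of at most `r` intervals. -/
def Steps (r : ℕ) : Set (I → ℕ) := {q | Monotone q ∧ ∀ x, q x ≤ 2 * r}

/-- Take q(x) to be twice the number of nonempty intervals lying entirely to the left of x, plus 1
if x is in X. When x in A j is left for some y > x outside X, the interval A j has been passed, so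
the loss of the summand 1 is made up by a gain of 2. -/
theorem exists_steps {r : ℕ} {X : Set I} (A : Fin r → Set I) (hA : ∀ i, (A i).OrdConnected)
    (hX : X = ⋃ i, A i) : ∃ q ∈ Steps r, X = {x | Odd (q x)} := by
  classical
  let passed : I → Finset (Fin r) := fun x =>
    Finset.univ.filter fun i => (A i).Nonempty ∧ ∀ a ∈ A i, a < x
  have hmono : ∀ x y, x ≤ y → passed x ⊆ passed y := fun x y hxy i hi => by
    simp only [passed, Finset.mem_filter, Finset.mem_univ, true_and] at hi ⊢
    exact ⟨hi.1, fun a ha => (hi.2 a ha).trans_le hxy⟩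
  have hmem : ∀ {x j}, x ∈ A j → j ∉ passed x := fun {x j} hx hj => by
    simp only [passed, Finset.mem_filter, Finset.mem_univ, true_and] at hj
    exact lt_irrefl x (hj.2 x hx)
  refine ⟨fun x => 2 * (passed x).card + if x ∈ X then 1 else 0, ⟨?_, ?_⟩, ?_⟩
  · intro x y hxy
    have hc := Finset.card_le_card (hmono x y hxy)
    by_cases hy : y ∈ X
    · simp only [hy, if_true]
      split_ifs <;> omega
    by_cases hx : x ∈ X
    · obtain ⟨j, hj⟩ := mem_iUnion.1 (hX ▸ hx)
      have hjy : j ∈ passed y := by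
        simp only [passed, Finset.mem_filter, Finset.mem_univ, true_and]
        refine ⟨⟨x, hj⟩, fun a ha => lt_of_not_ge fun hya => hy ?_⟩
        rw [hX]
        exact mem_iUnion.2 ⟨j, (hA j).out hj ha ⟨hxy, hya⟩⟩
      have := Finset.card_le_card (Finset.insert_subset hjy (hmono x y hxy))
      rw [Finset.card_insert_of_notMem (hmem hj)] at this
      simp only [hx, hy, if_true, if_false]
      omega
    · simp only [hx, hy, if_false]
      omega
  · intro x
    by_cases hx : x ∈ X
    · obtain ⟨j, hj⟩ := mem_iUnion.1 (hX ▸ hx)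
      have := Finset.card_lt_univ_of_notMem (hmem hj)
      rw [Fintype.card_fin] at this
      simp only [hx, if_true]
      omega
    · have := Finset.card_le_univ (passed x)
      rw [Fintype.card_fin] at this
      simp only [hx, if_false]
      omega
  · ext x
    by_cases hx : x ∈ X <;> simp [hx, Nat.odd_add]

theorem exists_steps_of_mem_genMonotone {r : ℕ} {κ : I → I} (hκ : κ ∈ genMonotone r) (v : ℝ) :
    ∃ q ∈ Steps r, {p : I | v ≤ (κ p : ℝ)} = {x | Odd (q x)} := by
  obtain ⟨A, hA, -, h⟩ := hκ v
  exact exists_steps A hA h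

-- For 0 < v ≤ 1 the superlevel set splits into the level sets q = 2i + 1, i < r, which are
-- intervals by monotonicity. For v ≤ 0 it is all of [0,1], which takes one interval, hence r ≥ 1.
open Classical in
theorem indicator_mem_genMonotone {r : ℕ} (hr : 1 ≤ r) {q : I → ℕ} (hq : q ∈ Steps r) :
    (fun x => if Odd (q x) then 1 else 0 : I → I) ∈ genMonotone r := by
  intro v
  rcases le_or_gt v 0 with h0 | h0
  · refine ⟨fun i => if i = ⟨0, hr⟩ then univ else ∅, fun i => ?_, fun i j hij => ?_, ?_⟩
    · by_cases h : i = ⟨0, hr⟩ <;> simp [h, ordConnected_univ, ordConnected_empty]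
    · by_cases h : i = ⟨0, hr⟩
      · have : j ≠ ⟨0, hr⟩ := fun h' => hij (h.trans h'.symm)
        simp [this]
      · simp [h]
    · ext x
      have : v ≤ (((if Odd (q x) then 1 else 0 : I)) : ℝ) := h0.trans (unitInterval.nonneg _)
      simp [this]
  rcases le_or_gt v 1 with h1 | h1
  · refine ⟨fun i => {x | q x = 2 * i + 1}, fun i => ⟨fun x hx y hy z hz => ?_⟩,
      fun i j hij => ?_, ?_⟩
    · have h1 := hq.1 hz.1
      have h2 := hq.1 hz.2
      simp only [mem_ofPred_eq] at hx hy ⊢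
      omega
    · refine Set.disjoint_left.2 ?_
      intro x hx hx'
      simp only [mem_ofPred_eq] at hx hx'
      exact hij (Fin.ext (by omega))
    · ext x
      simp only [mem_ofPred_eq, mem_iUnion]
      by_cases h : Odd (q x)
      · have hv : v ≤ (((if Odd (q x) then 1 else 0 : I)) : ℝ) := by simpa [h] using h1
        simp only [hv, true_iff]
        obtain ⟨k, hk⟩ := h
        have := hq.2 x
        exact ⟨⟨k, by omega⟩, hk⟩
      · have hv : ¬ v ≤ (((if Odd (q x) then 1 else 0 : I)) : ℝ) := by simpa [h] using h0
        simp only [hv, false_iff, not_exists]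
        exact fun i hi => h ⟨i, hi⟩
  · refine ⟨fun _ => ∅, fun i => ordConnected_empty, fun i j hij => by simp, ?_⟩
    ext x
    have : (((if Odd (q x) then 1 else 0 : I)) : ℝ) < v := (unitInterval.le_one _).trans_lt h1
    simp [not_le.2 this]

theorem const_mem_steps {r : ℕ} {m : ℕ} (hm : m ≤ 2 * r) : (fun _ => m : I → ℕ) ∈ Steps r :=
  ⟨monotone_const, fun _ => hm⟩

theorem measurable_of_mem_steps {r : ℕ} {q : I → ℕ} (hq : q ∈ Steps r) : Measurable q :=
  hq.1.measurable

theorem measurableSet_odd {r : ℕ} {q : I → ℕ} (hq : q ∈ Steps r) :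
    MeasurableSet {x | Odd (q x)} :=
  measurable_of_mem_steps hq (MeasurableSet.of_discrete (s := {n | Odd n}))

theorem measurable_of_mem_genMonotone {r : ℕ} {κ : I → I} (hκ : κ ∈ genMonotone r) :
    Measurable κ := by
  refine measurable_of_Ici fun v => ?_
  obtain ⟨q, hq, h⟩ := exists_steps_of_mem_genMonotone hκ v
  have : κ ⁻¹' Ici v = {x | Odd (q x)} := by
    rw [← h]
    rfl
  rw [this]
  exact measurableSet_odd hq

/-! ### Proper losses -/

/-- The slope `ℓ(p, 0) - ℓ(p, 1)`, nondecreasing in `p` for a proper loss. -/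
def slope (ℓ : I → Bool → ℝ) (p : I) : ℝ := ℓ p false - ℓ p true

/-- In this form properness says that ℓ(·, 0), viewed as a function of the slope, has subgradient q
at the slope of q. -/
theorem IsProper.mul_slope_sub_le {ℓ : I → Bool → ℝ} (h : IsProper ℓ) (p q : I) :
    (q : ℝ) * (slope ℓ p - slope ℓ q) ≤ ℓ p false - ℓ q false := by
  have := h p q
  simp only [bernoulliMean, slope] at this ⊢
  linarith

/-- Adding the subgradient inequalities for (p, q) and (q, p) gives (q − p)(slope q − slope p) ≥ 0.
-/
theorem IsProper.monotone_slope {ℓ : I → Bool → ℝ} (h : IsProper ℓ) : Monotone (slope ℓ) := by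
  intro p q hpq
  rcases hpq.eq_or_lt with rfl | hlt
  · exact le_rfl
  have h1 := h.mul_slope_sub_le p q
  have h2 := h.mul_slope_sub_le q p
  have hlt' : (p : ℝ) < q := hlt
  by_contra hcon
  nlinarith

theorem loss_eq (ℓ : I → Bool → ℝ) (p : I) (y : Bool) :
    ℓ p y = ℓ p false - slope ℓ p * (y.toNat : ℝ) := by
  cases y <;> simp [slope]

theorem abs_slope_le {ℓ : I → Bool → ℝ} (h : ℓ ∈ properLosses) (p : I) : |slope ℓ p| ≤ 1 := by
  rw [slope, abs_sub_comm]
  exact h.2 p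

theorem abs_loss_sub_le {ℓ : I → Bool → ℝ} (h : ℓ ∈ properLosses) (p q : I) (y : Bool) :
    |ℓ p y - ℓ q y| ≤ 4 := by
  have h1 := h.1.mul_slope_sub_le p q
  have h2 := h.1.mul_slope_sub_le q p
  have hp := abs_le.1 (abs_slope_le h p)
  have hq := abs_le.1 (abs_slope_le h q)
  have := p.2.1; have := p.2.2; have := q.2.1; have := q.2.2
  rw [loss_eq ℓ p y, loss_eq ℓ q y, abs_le]
  cases y <;> simp only [Bool.toNat_false, Bool.toNat_true, Nat.cast_zero, Nat.cast_one] <;>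
    constructor <;> nlinarith

/-- Needed because the real `sSup` of an unbounded set is the default value 0. -/
theorem bddAbove_CDL (K : Set (I → I)) (J : Measure (I × Bool)) [IsProbabilityMeasure J] :
    BddAbove {x : ℝ | ∃ ℓ ∈ properLosses, ∃ κ ∈ K, x = ∫ z, (ℓ z.1 z.2 - ℓ (κ z.1) z.2) ∂J} := by
  refine ⟨4, ?_⟩
  rintro x ⟨ℓ, hℓ, κ, -, rfl⟩
  refine (Real.le_norm_self _).trans ?_
  have := norm_integral_le_of_norm_le_const (μ := J) (C := 4)
    (f := fun z => ℓ z.1 z.2 - ℓ (κ z.1) z.2)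
    (Filter.Eventually.of_forall fun z => abs_loss_sub_le hℓ z.1 (κ z.1) z.2)
  simpa using this

/-! ### V-shaped losses and the lower bound on the calibration decision loss -/

/-- The expected gain, at decision threshold `v`, of acting on `X` instead of on `{p | v ≤ p}`. -/
noncomputable def gain (J : Measure (I × Bool)) (v : I) (X : Set I) : ℝ :=
  ∫ z, ((z.2.toNat : ℝ) - v) * (X.indicator 1 z.1 - (Ici v).indicator 1 z.1) ∂J

open Classical in
/-- The V-shaped loss with kink at `s`. -/
noncomputable def vLoss (s : I) (p : I) (y : Bool) : ℝ :=
  -((if s ≤ p then 1 else -1) * ((y.toNat : ℝ) - s))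

theorem vLoss_mem_properLosses (s : I) : vLoss s ∈ properLosses := by
  refine ⟨fun p q => ?_, fun p => ?_⟩
  · simp only [bernoulliMean, vLoss, Bool.toNat_true, Bool.toNat_false, Nat.cast_one,
      Nat.cast_zero]
    have hq : s ≤ q → (s : ℝ) ≤ q := fun h => h
    have hq' : ¬ s ≤ q → (q : ℝ) < s := fun h => not_le.1 h
    split_ifs with h1 h2 h2
    · linarith
    · linarith [hq' h2]
    · linarith [hq h2]
    · linarith
  · simp only [vLoss]
    split_ifs <;> simp

theorem zero_le_CDL {r : ℕ} (J : Measure (I × Bool)) [IsProbabilityMeasure J] :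
    0 ≤ CDL (genMonotone (r + 1)) J := by
  have hid : (fun x => x) ∈ genMonotone (r + 1) := by
    intro v
    refine ⟨fun i => if i = 0 then {p : I | v ≤ (p : ℝ)} else ∅, fun i => ?_, fun i j hij => ?_, ?_⟩
    · by_cases h : i = 0
      · simp only [h, if_true]
        exact ⟨fun x hx y _ z hz => le_trans hx (show (x : ℝ) ≤ z from hz.1)⟩
      · simp [h, ordConnected_empty]
    · by_cases h : i = 0
      · have : j ≠ 0 := fun h' => hij (h.trans h'.symm)
        simp [this]
      · simp [h]
    · ext x
      simp
  exact le_csSup (bddAbove_CDL _ J) ⟨vLoss 0, vLoss_mem_properLosses 0, _, hid, by simp⟩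

/-- Post-process by the indicator of X and score with the V-shaped loss with kink s: its sign jumps
by 2 exactly where X and [s, 1] disagree. For s = 0 the values 0 and 1 lie on the same side of the
kink, but then the gain is at most 0, because [s, 1] is everything. -/
theorem two_mul_gain_le_CDL {r : ℕ} (hr : 1 ≤ r) (J : Measure (I × Bool)) [IsProbabilityMeasure J]
    (s : I) {q : I → ℕ} (hq : q ∈ Steps r) :
    2 * gain J s {x | Odd (q x)} ≤ CDL (genMonotone r) J := by
  classical
  rcases eq_or_ne s 0 with rfl | hs
  · have h0 : gain J 0 {x | Odd (q x)} ≤ 0 := by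
      refine integral_nonpos fun z => ?_
      have : (Ici (0 : I)).indicator (1 : I → ℝ) z.1 = 1 := by
        rw [indicator_of_mem (show z.1 ∈ Ici (0 : I) from z.1.2.1)]; rfl
      have h1 : ({x | Odd (q x)} : Set I).indicator (1 : I → ℝ) z.1 ≤ 1 :=
        indicator_le_self' (fun _ _ => zero_le_one) _
      simp only [this, Pi.zero_apply, Icc.coe_zero, sub_zero]
      exact mul_nonpos_of_nonneg_of_nonpos (Nat.cast_nonneg _) (by linarith)
    obtain ⟨r, rfl⟩ := Nat.exists_eq_add_of_le' hr
    linarith [zero_le_CDL (r := r) J]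
  · have hs0 : 0 < s := lt_of_le_of_ne s.2.1 hs.symm
    refine le_csSup (bddAbove_CDL _ J)
      ⟨vLoss s, vLoss_mem_properLosses s, _, indicator_mem_genMonotone hr hq, ?_⟩
    rw [gain, ← integral_const_mul]
    refine integral_congr_ae (Filter.Eventually.of_forall fun z => ?_)
    have h1 : s ≤ 1 := s.2.2
    simp only [vLoss, indicator_apply, mem_ofPred_eq, mem_Ici, Pi.one_apply]
    by_cases ha : Odd (q z.1) <;> by_cases hb : s ≤ z.1 <;>
      simp [ha, hb, h1, not_le.2 hs0] <;> ring

end Calib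

/-! ### Proper losses as mixtures of V-shaped losses -/

namespace Calib

open Set Filter Topology

/-- A function whose increments are dominated by products of the increments of the identity and of
another function is constant. -/
theorem eq_of_abs_sub_le_mul {g D : I → ℝ}
    (h : ∀ x y, x ≤ y → |g y - g x| ≤ ((y : ℝ) - x) * (D y - D x)) {x y : I} (hxy : x ≤ y) :
    g y = g x := by
  have key : ∀ k : ℕ, ∀ x y : I, x ≤ y →
      |g y - g x| ≤ ((y : ℝ) - x) * (D y - D x) * (1 / 2) ^ k := by
    intro k
    induction k with
    | zero => simpa using h
    | succ k ih =>
      intro x y hxy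
      have hxy' : (x : ℝ) ≤ y := hxy
      -- Bisection: both halves have half the length and the increments of D add up, so the total
      -- bound halves.
      let m : I := ⟨((x : ℝ) + y) / 2, by
        constructor
        · linarith [x.2.1, y.2.1]
        · linarith [x.2.2, y.2.2]⟩
      have hm : (m : ℝ) = ((x : ℝ) + y) / 2 := rfl
      have h1 := ih x m (show (x : ℝ) ≤ m by rw [hm]; linarith)
      have h2 := ih m y (show (m : ℝ) ≤ y by rw [hm]; linarith)
      have h3 := abs_sub_le (g y) (g m) (g x)
      rw [hm] at h1 h2
      calc |g y - g x| ≤ _ := h3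
        _ ≤ _ := add_le_add h2 h1
        _ = _ := by rw [pow_succ]; ring
  have hlim : Tendsto (fun k : ℕ => ((y : ℝ) - x) * (D y - D x) * (1 / 2) ^ k) atTop (𝓝 0) := by
    simpa using (tendsto_pow_atTop_nhds_zero_of_lt_one (r := (1 / 2 : ℝ)) (by norm_num)
      (by norm_num)).const_mul (((y : ℝ) - x) * (D y - D x))
  have h0 := ge_of_tendsto' hlim fun k => key k x y hxy
  exact sub_eq_zero.1 (abs_nonpos_iff.1 h0)

/-- The generalized inverse of the slope of a loss. -/
noncomputable def kink (ℓ : I → Bool → ℝ) (u : ℝ) : I := sInf {t | u < slope ℓ t}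

theorem monotone_kink (ℓ : I → Bool → ℝ) : Monotone (kink ℓ) := fun _ _ h =>
  sInf_le_sInf fun _ ht => lt_of_le_of_lt h ht

theorem monotone_coe_kink (ℓ : I → Bool → ℝ) : Monotone fun u => (kink ℓ u : ℝ) := fun _ _ h =>
  monotone_kink ℓ h

/-- The first component of a proper loss is recovered from its slope. -/
theorem IsProper.false_sub_false {ℓ : I → Bool → ℝ} (h : IsProper ℓ) (p : I) :
    ℓ p false - ℓ 0 false = ∫ u in (slope ℓ 0)..(slope ℓ p), (kink ℓ u : ℝ) := by
  have hint : ∀ a b : ℝ, IntervalIntegrable (fun u => (kink ℓ u : ℝ)) volume a b := fun a b =>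
    (monotone_coe_kink ℓ).intervalIntegrable
  have key := eq_of_abs_sub_le_mul (D := slope ℓ)
    (g := fun p => ℓ p false - ∫ u in (slope ℓ 0)..(slope ℓ p), (kink ℓ u : ℝ))
    (fun x y hxy => ?_) (show 0 ≤ p from p.2.1)
  · simp only [intervalIntegral.integral_same, sub_zero] at key
    linarith
  · have hD := h.monotone_slope hxy
    have hsplit := intervalIntegral.integral_add_adjacent_intervals (hint (slope ℓ 0) (slope ℓ x))
      (hint (slope ℓ x) (slope ℓ y))
    have h1 := h.mul_slope_sub_le x y
    have h2 := h.mul_slope_sub_le y x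
    -- Between the two slopes the kink lies in [x, y]. Hence the increments of ℓ(·, 0) and of the
    -- integral both lie between x and y times the increment of the slope.
    have hmem : ∀ u ∈ Ioo (slope ℓ x) (slope ℓ y), x ≤ kink ℓ u ∧ kink ℓ u ≤ y := fun u hu =>
      ⟨le_sInf fun t ht => (h.monotone_slope.reflect_lt (hu.1.trans ht)).le, sInf_le hu.2⟩
    have hlo := intervalIntegral.integral_mono_on_of_le_Ioo hD
      (intervalIntegrable_const (c := (x : ℝ))) (hint _ _) fun u hu => (hmem u hu).1
    have hhi := intervalIntegral.integral_mono_on_of_le_Ioo hD (hint _ _)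
      (intervalIntegrable_const (c := (y : ℝ))) fun u hu => (hmem u hu).2
    simp only [intervalIntegral.integral_const, smul_eq_mul] at hlo hhi
    rw [abs_le]
    constructor <;> nlinarith

/-- A proper loss with slopes in `[-1, 1]` is a mixture of V-shaped losses. -/
theorem loss_sub_loss {ℓ : I → Bool → ℝ} (h : ℓ ∈ properLosses) (p p' : I) (y : Bool) :
    ℓ p y - ℓ p' y = ∫ u in Ioc (-1 : ℝ) 1, ((y.toNat : ℝ) - kink ℓ u) *
      ((Iio (slope ℓ p')).indicator 1 u - (Iio (slope ℓ p)).indicator 1 u) := by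
  have hint : ∀ a b : ℝ, IntervalIntegrable (fun u => (y.toNat : ℝ) - kink ℓ u) volume a b :=
    fun a b => intervalIntegrable_const.sub (monotone_coe_kink ℓ).intervalIntegrable
  have key : ∀ t : I, ∫ u in Ioc (-1 : ℝ) 1, ((y.toNat : ℝ) - kink ℓ u) *
      (Iio (slope ℓ t)).indicator 1 u = ∫ u in (-1)..(slope ℓ t), ((y.toNat : ℝ) - kink ℓ u) := by
    intro t
    have ht := abs_le.1 (abs_slope_le h t)
    have e : (fun u => ((y.toNat : ℝ) - kink ℓ u) * (Iio (slope ℓ t)).indicator 1 u) =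
        (Iio (slope ℓ t)).indicator fun u => ((y.toNat : ℝ) - kink ℓ u) := by
      funext u
      by_cases hu : u ∈ Iio (slope ℓ t) <;> simp [hu]
    have e2 : Ioc (-1 : ℝ) 1 ∩ Iio (slope ℓ t) = Ioo (-1) (slope ℓ t) := by
      ext u
      simp only [mem_inter_iff, mem_Ioc, mem_Iio, mem_Ioo]
      constructor
      · exact fun hu => ⟨hu.1.1, hu.2⟩
      · exact fun hu => ⟨⟨hu.1, hu.2.le.trans ht.2⟩, hu.2⟩
    rw [e, setIntegral_indicator measurableSet_Iio, e2,
      intervalIntegral.integral_of_le ht.1, integral_Ioc_eq_integral_Ioo]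
  have hI : ∀ t : I, IntegrableOn (fun u => ((y.toNat : ℝ) - kink ℓ u) *
      (Iio (slope ℓ t)).indicator 1 u) (Ioc (-1 : ℝ) 1) := by
    intro t
    have e : (fun u => ((y.toNat : ℝ) - kink ℓ u) * (Iio (slope ℓ t)).indicator 1 u) =
        (Iio (slope ℓ t)).indicator fun u => ((y.toNat : ℝ) - kink ℓ u) := by
      funext u
      by_cases hu : u ∈ Iio (slope ℓ t) <;> simp [hu]
    rw [e]
    exact ((intervalIntegrable_iff_integrableOn_Ioc_of_le (by norm_num)).1
      (hint (-1) 1)).indicator measurableSet_Iio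
  simp only [mul_sub]
  rw [integral_sub (hI p') (hI p), key, key]
  -- The part of the integral below the slope of 0 does not depend on t and cancels in the
  -- difference.
  have hs : ∀ t : I, ∫ u in (-1)..(slope ℓ t), ((y.toNat : ℝ) - kink ℓ u) =
      (∫ u in (-1)..(slope ℓ 0), ((y.toNat : ℝ) - kink ℓ u)) +
        ((slope ℓ t - slope ℓ 0) * (y.toNat : ℝ) - (ℓ t false - ℓ 0 false)) := by
    intro t
    rw [← intervalIntegral.integral_add_adjacent_intervals (hint (-1) (slope ℓ 0))
      (hint (slope ℓ 0) (slope ℓ t)), h.1.false_sub_false t]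
    congr 1
    rw [intervalIntegral.integral_sub intervalIntegrable_const
      (monotone_coe_kink ℓ).intervalIntegrable, intervalIntegral.integral_const, smul_eq_mul]
  rw [hs p, hs p', loss_eq ℓ p y, loss_eq ℓ p' y]
  ring

theorem measurable_label : Measurable fun z : I × Bool => (z.2.toNat : ℝ) :=
  (measurable_of_countable fun y : Bool => (y.toNat : ℝ)).comp measurable_snd

theorem abs_label_sub_mul_le {α : Type*} (y : Bool) (v : I) (A B : Set α) (s t : α) :
    |((y.toNat : ℝ) - v) * (A.indicator 1 s - B.indicator 1 t)| ≤ 1 := by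
  have h1 : |(y.toNat : ℝ) - v| ≤ 1 := by
    have h0 := v.2.1
    have h1 := v.2.2
    cases y <;> rw [abs_le] <;> constructor <;> simp <;> linarith
  have h2 : |A.indicator (1 : α → ℝ) s - B.indicator 1 t| ≤ 1 := by
    by_cases hs : s ∈ A <;> by_cases ht : t ∈ B <;> simp [hs, ht]
  rw [abs_mul]
  exact mul_le_one₀ h1 (abs_nonneg _) h2

theorem gain_univ_zero (J : Measure (I × Bool)) : gain J 0 univ = 0 := by
  have : Ici (0 : I) = univ := by
    ext x
    simp
  simp [gain, this]

/-- If all gains of unions of `r` intervals over up-sets `[v, 1]` are at most `B`, then so are all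
gains from replacing an arbitrary up-set `W` with infimum `v` by its preimage under `κ`. -/
theorem integral_upperSet_le {r : ℕ} (hr : 1 ≤ r) (J : Measure (I × Bool))
    [IsProbabilityMeasure J] {B : ℝ} (hB : ∀ v, ∀ q ∈ Steps r, gain J v {x | Odd (q x)} ≤ B)
    {κ : I → I} (hκ : κ ∈ genMonotone r) {W : Set I} (hW : IsUpperSet W) :
    ∫ z, ((z.2.toNat : ℝ) - (sInf W : I)) * (W.indicator 1 (κ z.1) - W.indicator 1 z.1) ∂J ≤ B := by
  set a := sInf W with ha
  have hIci : ∀ v : I, ∫ z, ((z.2.toNat : ℝ) - v) *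
      ((Ici v).indicator 1 (κ z.1) - (Ici v).indicator 1 z.1) ∂J ≤ B := by
    intro v
    obtain ⟨q, hq, h⟩ := exists_steps_of_mem_genMonotone hκ v
    refine le_trans (le_of_eq ?_) (hB v q hq)
    rw [gain, ← h]
    rfl
  by_cases haW : a ∈ W
  · have : W = Ici a := Subset.antisymm (fun t ht => sInf_le ht) fun t ht => hW ht haW
    rw [this]
    exact hIci a
  have hWa : W = Ioi a := by
    refine Subset.antisymm (fun t ht => lt_of_le_of_ne (sInf_le ht) fun h => haW ?_) ?_
    · rw [ha, h]
      exact ht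
    intro t ht
    obtain ⟨w, hw, hwt⟩ := sInf_lt_iff.1 (show sInf W < t from ht)
    exact hW hwt.le hw
  -- Here W is empty, with infimum 1, and the integral is 0. Nonnegativity of B comes from acting on
  -- all of [0,1] at threshold 0, which gains nothing.
  rcases eq_or_ne a 1 with h1 | h1
  · have hemp : W = ∅ := by
      rw [hWa, h1]
      exact Ioi_eq_empty_iff.2 isMax_top
    have h0 : 0 ≤ B := by
      have := hB 0 _ (const_mem_steps (m := 1) (by omega))
      rwa [show {x : I | Odd 1} = univ by simp, gain_univ_zero] at this
    simpa [hemp] using h0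
  -- The open up-set (a, 1] is the limit of the closed ones [v n, 1] with v n decreasing to a; the
  -- bound passes to the limit by dominated convergence.
  obtain ⟨v, -, hv, hlim⟩ := exists_seq_strictAnti_tendsto' (lt_of_le_of_ne (show a ≤ 1 from a.2.2) h1)
  have hind : ∀ t : I, Tendsto (fun n => (Ici (v n)).indicator (1 : I → ℝ) t) atTop
      (𝓝 (W.indicator 1 t)) := by
    intro t
    rw [hWa]
    by_cases ht : a < t
    · have hev : ∀ᶠ n in atTop, v n < t := hlim.eventually_lt_const ht
      refine tendsto_const_nhds.congr' (hev.mono fun n hn => ?_)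
      simp [ht, hn.le]
    · refine tendsto_const_nhds.congr fun n => ?_
      have : ¬ v n ≤ t := not_le.2 ((not_lt.1 ht).trans_lt (hv n).1)
      simp [ht, this]
  refine le_of_tendsto' (tendsto_integral_of_dominated_convergence (fun _ => 1) (fun n => ?_)
    (integrable_const _) (fun n => Eventually.of_forall fun z => ?_)
    (Eventually.of_forall fun z => ?_)) fun n => hIci (v n)
  · have hm : Measurable ((Ici (v n)).indicator (1 : I → ℝ)) :=
      measurable_one.indicator measurableSet_Ici
    have hκm := measurable_of_mem_genMonotone hκ
    exact ((measurable_label.sub_const _).mul ((hm.comp (hκm.comp measurable_fst)).sub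
      (hm.comp measurable_fst))).aestronglyMeasurable
  · exact abs_label_sub_mul_le _ _ _ _ _ _
  · have hv' : Tendsto (fun n => ((v n : I) : ℝ)) atTop (𝓝 (a : ℝ)) :=
      (continuous_subtype_val.tendsto a).comp hlim
    exact (tendsto_const_nhds.sub hv').mul ((hind _).sub (hind _))

/-- After Fubini, each u contributes the gain of a V-shaped loss, whose up-set {t | u < slope ℓ t}
has infimum `kink ℓ u`. The factor 2 is the length of (-1, 1]. -/
theorem CDL_le {r : ℕ} (hr : 1 ≤ r) (J : Measure (I × Bool)) [IsProbabilityMeasure J] {B : ℝ}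
    (hB : ∀ v, ∀ q ∈ Steps r, gain J v {x | Odd (q x)} ≤ B) :
    CDL (genMonotone r) J ≤ 2 * B := by
  have hne : (genMonotone r).Nonempty :=
    ⟨_, indicator_mem_genMonotone hr (const_mem_steps (Nat.zero_le _))⟩
  obtain ⟨κ₀, hκ₀⟩ := hne
  refine csSup_le ⟨_, vLoss 0, vLoss_mem_properLosses 0, κ₀, hκ₀, rfl⟩ ?_
  rintro x ⟨ℓ, hℓ, κ, hκ, rfl⟩
  have hκm := measurable_of_mem_genMonotone hκ
  have hDm : Measurable (slope ℓ) := hℓ.1.monotone_slope.measurable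
  have hkm : Measurable fun u => (kink ℓ u : ℝ) := (monotone_coe_kink ℓ).measurable
  let F : I × Bool → ℝ → ℝ := fun z u => ((z.2.toNat : ℝ) - kink ℓ u) *
      ((Iio (slope ℓ (κ z.1))).indicator 1 u - (Iio (slope ℓ z.1)).indicator 1 u)
  have hind : ∀ g : I → I, Measurable g → Measurable fun w : (I × Bool) × ℝ =>
      (Iio (slope ℓ (g w.1.1))).indicator (1 : ℝ → ℝ) w.2 := by
    intro g hg
    have hset : MeasurableSet {w : (I × Bool) × ℝ | w.2 < slope ℓ (g w.1.1)} :=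
      measurableSet_lt measurable_snd (hDm.comp (hg.comp (measurable_fst.comp measurable_fst)))
    have hone : Measurable fun _ : (I × Bool) × ℝ => (1 : ℝ) := measurable_const
    exact hone.indicator hset
  have hFm : Measurable (Function.uncurry F) :=
    ((measurable_label.comp measurable_fst).sub (hkm.comp measurable_snd)).mul
      ((hind κ hκm).sub (hind id measurable_id))
  have hFi : Integrable (Function.uncurry F) (J.prod (volume.restrict (Ioc (-1 : ℝ) 1))) :=
    (integrable_const (1 : ℝ)).mono' hFm.aestronglyMeasurable
      (Eventually.of_forall fun w => abs_label_sub_mul_le _ _ _ _ _ _)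
  calc ∫ z, (ℓ z.1 z.2 - ℓ (κ z.1) z.2) ∂J
      = ∫ z, (∫ u in Ioc (-1 : ℝ) 1, F z u) ∂J := by
        refine integral_congr_ae (Eventually.of_forall fun z => ?_)
        exact loss_sub_loss hℓ z.1 (κ z.1) z.2
    _ = ∫ u in Ioc (-1 : ℝ) 1, (∫ z, F z u ∂J) := integral_integral_swap hFi
    _ ≤ ∫ _ in Ioc (-1 : ℝ) 1, B := by
        refine integral_mono hFi.integral_prod_right (integrable_const _) fun u => ?_
        refine le_trans (le_of_eq ?_) (integral_upperSet_le hr J hB hκ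
          (W := {t | u < slope ℓ t}) fun s t hst hs => hs.trans_le (hℓ.1.monotone_slope hst))
        rfl
    _ = 2 * B := by
        rw [setIntegral_const, smul_eq_mul, measureReal_def, Real.volume_Ioc]
        norm_num

end Calib

namespace Calib

open Set RealRAM

/-! ### Cells -/

theorem monotone_rank (S : ℕ → ℝ) (N : ℕ) : Monotone (rank S N) := fun x y hxy => by
  refine Finset.sum_le_sum fun t _ => add_le_add ?_ ?_
  · by_cases h : S t < x
    · simp [h, h.trans_le hxy]
    · simp [h]
  · by_cases h : S t ≤ x
    · simp [h, h.trans hxy]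
    · simp [h]

theorem rank_le (S : ℕ → ℝ) (N : ℕ) (x : ℝ) : rank S N x ≤ 2 * N := by
  calc rank S N x ≤ ∑ _t ∈ Finset.range N, 2 := Finset.sum_le_sum fun t _ => by
        split_ifs <;> omega
    _ = 2 * N := by simp [mul_comm]

theorem rank_lt_rank {S : ℕ → ℝ} {N t : ℕ} (ht : t < N) {x y : ℝ} (hxy : x < y) (hx : x ≤ S t)
    (hy : S t ≤ y) : rank S N x < rank S N y := by
  refine Finset.sum_lt_sum (fun t _ => add_le_add ?_ ?_) ⟨t, Finset.mem_range.2 ht, ?_⟩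
  · by_cases h : S t < x
    · simp [h, h.trans hxy]
    · simp [h]
  · by_cases h : S t ≤ x
    · simp [h, h.trans hxy.le]
    · simp [h]
  · rcases hx.eq_or_lt with h | h
    · simp [← h, hxy, hxy.le]
    · simp only [not_lt.2 h.le, not_le.2 h, hy, if_false, if_true]
      omega

/-- The step function that counts the thresholds `θ j ≤ c`. -/
def cut {r : ℕ} (θ : Fin (2 * r) → ℕ) (c : ℕ) : ℕ := (Finset.univ.filter fun j => θ j ≤ c).card

theorem monotone_cut {r : ℕ} (θ : Fin (2 * r) → ℕ) : Monotone (cut θ) := fun c d hcd =>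
  Finset.card_le_card fun j hj => by
    simp only [Finset.mem_filter, Finset.mem_univ, true_and] at hj ⊢
    exact hj.trans hcd

theorem cut_le {r : ℕ} (θ : Fin (2 * r) → ℕ) (c : ℕ) : cut θ c ≤ 2 * r :=
  (Finset.card_le_univ _).trans (Fintype.card_fin _).le

theorem comp_rank_mem_steps {r : ℕ} {Q : ℕ → ℕ} (hQ : Monotone Q) (hle : ∀ c, Q c ≤ 2 * r)
    (S : ℕ → ℝ) (N : ℕ) : (fun x : I => Q (rank S N x)) ∈ Steps r :=
  ⟨fun _ _ h => hQ (monotone_rank S N h), fun _ => hle _⟩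

/-- The points at which the `j`-th jump of `q` is misplaced when it is moved to the start of its
cell. -/
def misplaced {r : ℕ} (S : ℕ → ℝ) (N : ℕ) (q : I → ℕ) (θ : Fin (2 * r) → ℕ) (j : Fin (2 * r)) :
    Set I := {x | q x ≤ j ∧ θ j ≤ rank S N x}

/-- A step function on `[0,1]` is a step function of the cell number outside of intervals, one for
each jump, each of them inside the interior of a cell. -/
theorem exists_cut {r : ℕ} (S : ℕ → ℝ) (N : ℕ) {q : I → ℕ} (hq : q ∈ Steps r) :
    ∃ θ : Fin (2 * r) → ℕ, (∀ j, θ j ≤ 2 * N + 1) ∧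
      (∀ x, (∀ j, x ∉ misplaced S N q θ j) → cut θ (rank S N x) = q x) ∧
      ∀ j, (misplaced S N q θ j).OrdConnected ∧ ∀ x ∈ misplaced S N q θ j,
        rank S N x = θ j ∧ ∀ t < N, (x : ℝ) ≠ S t := by
  classical
  let R : Fin (2 * r) → Set ℕ := fun j => {k | ∃ y : I, (j : ℕ) < q y ∧ rank S N y = k}
  -- The first cell in which q exceeds j. A jump that never occurs is put at 2N + 1, beyond every
  -- rank.
  let θ : Fin (2 * r) → ℕ := fun j => if (R j).Nonempty then sInf (R j) else 2 * N + 1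
  have hθle : ∀ (j : Fin (2 * r)) (y : I), (j : ℕ) < q y → θ j ≤ rank S N y := by
    intro j y hy
    have hmem : rank S N y ∈ R j := ⟨y, hy, rfl⟩
    have hne : (R j).Nonempty := ⟨_, hmem⟩
    simp only [θ, if_pos hne]
    exact Nat.sInf_le hmem
  have hθex : ∀ j, ∀ x : I, θ j ≤ rank S N x → ∃ y : I, (j : ℕ) < q y ∧ rank S N y = θ j := by
    intro j x hx
    have hne : (R j).Nonempty := by
      by_contra hne
      simp only [θ, if_neg hne] at hx
      have := rank_le S N x
      omega
    have := Nat.sInf_mem hne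
    simp only [θ, if_pos hne]
    exact this
  refine ⟨θ, fun j => ?_, fun x hx => ?_, fun j => ⟨⟨fun x hx y hy z hz => ?_⟩, fun x hx => ?_⟩⟩
  · by_cases hne : (R j).Nonempty
    · obtain ⟨k, y, hy, hk⟩ := hne
      exact (hθle j y hy).trans ((rank_le S N y).trans (by omega))
    · simp [θ, if_neg hne]
  · have : (Finset.univ.filter fun j : Fin (2 * r) => θ j ≤ rank S N x) =
        Finset.univ.filter fun j : Fin (2 * r) => (j : ℕ) < q x := by
      ext j
      simp only [Finset.mem_filter, Finset.mem_univ, true_and]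
      refine ⟨fun h => ?_, fun h => hθle j x h⟩
      by_contra hcon
      exact hx j ⟨not_lt.1 hcon, h⟩
    rw [cut, this, Fin.card_filter_val_lt, min_eq_right (hq.2 x)]
  · exact ⟨(hq.1 hz.2).trans hy.1, hx.2.trans (monotone_rank S N (show (x : ℝ) ≤ z from hz.1))⟩
  -- The point x precedes a y in the cell θ j at which q exceeds j, so x lies in that cell too; a
  -- point S t = x would give x and y different ranks.
  · obtain ⟨y, hy, hyθ⟩ := hθex j x hx.2
    have hxy : x < y := hq.1.reflect_lt (hx.1.trans_lt hy)
    have hxy' : (x : ℝ) < y := hxy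
    have hr := monotone_rank S N hxy'.le
    refine ⟨le_antisymm (hyθ ▸ hr) hx.2, fun t ht h => ?_⟩
    have := rank_lt_rank ht hxy' h.le (h ▸ hxy'.le)
    have := hx.2
    omega

/-! ### Masses of labelled sets -/

/-- The mass of the examples with label `b` and prediction in `X`. -/
noncomputable def mass (J : Measure (I × Bool)) (b : Bool) (X : Set I) : ℝ :=
  J.real {z | z.1 ∈ X ∧ z.2 = b}

/-- The integral of `y - v` over `X` with respect to a label-wise mass `M`. -/
def val (M : Bool → Set I → ℝ) (v : ℝ) (X : Set I) : ℝ := M true X * (1 - v) - M false X * v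

theorem integral_label_mul_indicator (J : Measure (I × Bool)) [IsProbabilityMeasure J] (v : ℝ)
    {X : Set I} (hX : MeasurableSet X) :
    ∫ z, ((z.2.toNat : ℝ) - v) * X.indicator 1 z.1 ∂J = val (mass J) v X := by
  have hm : ∀ b, MeasurableSet {z : I × Bool | z.1 ∈ X ∧ z.2 = b} := fun b =>
    (measurable_fst hX).inter (measurable_snd (measurableSet_singleton b))
  have e : (fun z : I × Bool => ((z.2.toNat : ℝ) - v) * X.indicator 1 z.1) = fun z =>
      {z : I × Bool | z.1 ∈ X ∧ z.2 = true}.indicator (fun _ => 1 - v) z -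
        {z : I × Bool | z.1 ∈ X ∧ z.2 = false}.indicator (fun _ => v) z := by
    funext ⟨p, y⟩
    by_cases hp : p ∈ X <;> cases y <;> simp [hp]
  rw [e, integral_sub ((integrable_const _).indicator (hm true))
    ((integrable_const _).indicator (hm false)), integral_indicator_const _ (hm true),
    integral_indicator_const _ (hm false)]
  rfl

theorem gain_eq (J : Measure (I × Bool)) [IsProbabilityMeasure J] (v : I) {X : Set I}
    (hX : MeasurableSet X) :
    gain J v X = val (mass J) v X - val (mass J) v (Ici v) := by
  have hint : ∀ Y : Set I, MeasurableSet Y → Integrable (fun z : I × Bool =>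
      ((z.2.toNat : ℝ) - v) * Y.indicator 1 z.1) J := by
    intro Y hY
    refine (integrable_const (1 : ℝ)).mono' ?_ (Filter.Eventually.of_forall fun z => ?_)
    · exact ((measurable_label.sub_const _).mul ((measurable_one.indicator hY).comp
        measurable_fst)).aestronglyMeasurable
    · simpa using abs_label_sub_mul_le z.2 v Y ∅ z.1 z.1
  rw [← integral_label_mul_indicator J v hX, ← integral_label_mul_indicator J v measurableSet_Ici,
    ← integral_sub (hint _ hX) (hint _ measurableSet_Ici), gain]
  simp only [mul_sub]

theorem abs_mass_sub_le (J : Measure (I × Bool)) [IsProbabilityMeasure J] (b : Bool)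
    {X Y D : Set I} (h : ∀ x, x ∉ D → (x ∈ X ↔ x ∈ Y)) :
    |mass J b X - mass J b Y| ≤ J.real (Prod.fst ⁻¹' D) := by
  have key : ∀ X Y : Set I, (∀ x, x ∉ D → (x ∈ X ↔ x ∈ Y)) →
      mass J b X ≤ mass J b Y + J.real (Prod.fst ⁻¹' D) := by
    intro X Y h
    refine (measureReal_mono (μ := J) (fun z hz => ?_)).trans (measureReal_union_le _ _)
    by_cases hD : z.1 ∈ D
    · exact .inr hD
    · exact .inl ⟨(h _ hD).1 hz.1, hz.2⟩
  have h1 := key X Y h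
  have h2 := key Y X fun x hx => (h x hx).symm
  rw [abs_le]
  constructor <;> linarith

/-- The coefficients 1 − v and −v have absolute values summing to 1, so the errors of the two labels
do not add up to 2η. -/
theorem abs_val_sub_le {M M' : Bool → Set I → ℝ} {v η : ℝ} (hv : v ∈ Icc (0 : ℝ) 1) {X Y : Set I}
    (h : ∀ b, |M b X - M' b Y| ≤ η) : |val M v X - val M' v Y| ≤ η := by
  have h1 := abs_le.1 (h true)
  have h2 := abs_le.1 (h false)
  obtain ⟨h0, h3⟩ := hv
  simp only [val]
  rw [abs_le]
  constructor <;> nlinarith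

/-- The difference is (v − w) times a difference of two total masses in [0, 1]. This is what allows
the threshold value to be rounded independently of the up-set. -/
theorem abs_val_sub_val_sub_le (J : Measure (I × Bool)) [IsProbabilityMeasure J] (v w : ℝ)
    (X Y : Set I) : |(val (mass J) v X - val (mass J) v Y) -
      (val (mass J) w X - val (mass J) w Y)| ≤ |v - w| := by
  have key : ∀ X : Set I, 0 ≤ mass J true X + mass J false X ∧
      mass J true X + mass J false X ≤ 1 := by
    intro X
    refine ⟨add_nonneg measureReal_nonneg measureReal_nonneg, ?_⟩
    have h := measureReal_inter_add_sdiff (μ := J) (s := Prod.fst ⁻¹' X)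
      (measurable_snd (measurableSet_singleton true))
    have e : (Prod.fst ⁻¹' X \ Prod.snd ⁻¹' {true} : Set (I × Bool)) =
        {z | z.1 ∈ X ∧ z.2 = false} := by
      ext z
      simp
    rw [e] at h
    calc mass J true X + mass J false X = J.real (Prod.fst ⁻¹' X) := h
      _ ≤ 1 := measureReal_le_one
  have hX := key X
  have hY := key Y
  have e : (val (mass J) v X - val (mass J) v Y) - (val (mass J) w X - val (mass J) w Y) =
      (v - w) * ((mass J true Y + mass J false Y) - (mass J true X + mass J false X)) := by
    simp only [val]
    ring
  rw [e, abs_mul]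
  refine mul_le_of_le_one_right (abs_nonneg _) ?_
  rw [abs_le]
  constructor <;> linarith

/-! ### Calibration decision loss against cell-wise statistics -/

/-- Every interval that avoids the points `S t`, `t < N`, has mass at most `δ`. -/
def SmallGaps (J : Measure (I × Bool)) (S : ℕ → ℝ) (N : ℕ) (δ : ℝ) : Prop :=
  ∀ A : Set I, A.OrdConnected → (∀ x ∈ A, ∀ t < N, (x : ℝ) ≠ S t) → J.real (Prod.fst ⁻¹' A) ≤ δ

theorem measureReal_iUnion_misplaced_le {J : Measure (I × Bool)} [IsProbabilityMeasure J]
    {r N : ℕ} {S : ℕ → ℝ} {δ : ℝ} (hS : SmallGaps J S N δ) {q : I → ℕ} {θ : Fin (2 * r) → ℕ}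
    (h : ∀ j, (misplaced S N q θ j).OrdConnected ∧ ∀ x ∈ misplaced S N q θ j,
        rank S N x = θ j ∧ ∀ t < N, (x : ℝ) ≠ S t) :
    J.real (Prod.fst ⁻¹' ⋃ j, misplaced S N q θ j) ≤ 2 * r * δ := by
  rw [preimage_iUnion]
  calc J.real (⋃ j, Prod.fst ⁻¹' misplaced S N q θ j)
      ≤ ∑ j, J.real (Prod.fst ⁻¹' misplaced S N q θ j) := measureReal_iUnion_fintype_le _
    _ ≤ ∑ _j : Fin (2 * r), δ :=
        Finset.sum_le_sum fun j _ => hS _ (h j).1 fun x hx => ((h j).2 x hx).2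
    _ = 2 * r * δ := by simp

/-- Uniform closeness of the label-wise masses on all unions of `r` intervals. -/
def UnifClose (J : Measure (I × Bool)) (r : ℕ) (E : Bool → Set I → ℝ) (η : ℝ) : Prop :=
  ∀ b, ∀ q ∈ Steps r, |E b {x | Odd (q x)} - mass J b {x | Odd (q x)}| ≤ η

/-- An up-set is a single interval, so it is covered by the class as soon as r ≥ 1. -/
theorem UnifClose.abs_up_le {J : Measure (I × Bool)} {r : ℕ} {E : Bool → Set I → ℝ} {η : ℝ}
    (h : UnifClose J r E η) (hr : 1 ≤ r) (b : Bool) (s : ℝ) :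
    |E b {x : I | s ≤ x} - mass J b {x : I | s ≤ x}| ≤ η := by
  classical
  have hq : (fun x : I => if s ≤ x then 1 else 0) ∈ Steps r := by
    refine ⟨fun x y hxy => ?_, fun x => ?_⟩
    · have hxy' : (x : ℝ) ≤ y := hxy
      by_cases h : s ≤ (x : ℝ)
      · simp [h, h.trans hxy']
      · simp [h]
    · by_cases h : s ≤ (x : ℝ) <;> simp [h]
      omega
  have e : {x : I | s ≤ x} = {x : I | Odd (if s ≤ (x : ℝ) then 1 else 0)} := by
    ext x
    by_cases h : s ≤ (x : ℝ) <;> simp [h]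
  rw [e]
  exact h b _ hq

/-- If no cell-wise statistic exceeds `β`, the calibration decision loss is about at most `β`. -/
theorem CDL_le_of_stat_le {J : Measure (I × Bool)} [IsProbabilityMeasure J] {r K N : ℕ}
    {S : ℕ → ℝ} {E : Bool → Set I → ℝ} {δ η β : ℝ} (hr : 1 ≤ r) (hK : 1 ≤ K) (hKN : K < N)
    (hSK : ∀ k ≤ K, S k = (k : ℝ) / K) (hgap : SmallGaps J S N δ) (hE : UnifClose J r E η)
    (hβ : ∀ k ≤ K, ∀ t < N, S t ≤ (k : ℝ) / K → (k : ℝ) / K ≤ S t + 1 / K →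
      ∀ Q : ℕ → ℕ, Monotone Q → (∀ c, Q c ≤ 2 * r) →
        2 * (val E ((k : ℝ) / K) {x : I | Odd (Q (rank S N x))} -
          val E ((k : ℝ) / K) {x : I | S t ≤ x}) ≤ β) :
    CDL (genMonotone r) J ≤ β + 2 * (1 / K + (2 * r + 1) * δ + 2 * η) := by
  have hK0 : (0 : ℝ) < K := by exact_mod_cast hK
  have : CDL (genMonotone r) J ≤ 2 * (β / 2 + (1 / K + (2 * r + 1) * δ + 2 * η)) := by
    refine CDL_le hr J fun v q hq => ?_
    rw [gain_eq J v (measurableSet_odd hq)]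
    obtain ⟨θ, -, hcut, hmis⟩ := exists_cut (r := r) S N hq
    -- the grid point above `v`
    obtain ⟨k, hkK, hvk, hkv⟩ : ∃ k ≤ K, (v : ℝ) ≤ (k : ℝ) / K ∧ (k : ℝ) / K ≤ v + 1 / K := by
      refine ⟨⌈(v : ℝ) * K⌉₊, ?_, ?_, ?_⟩
      · exact Nat.ceil_le.2 (by nlinarith [v.2.2])
      · rw [le_div_iff₀ hK0]
        exact Nat.le_ceil _
      · rw [div_le_iff₀ hK0, add_mul, one_div, inv_mul_cancel₀ hK0.ne']
        exact (Nat.ceil_lt_add_one (mul_nonneg v.2.1 hK0.le)).le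
    -- the least point above `v`
    obtain ⟨t, ht, hmin⟩ := Finset.exists_min_image
      ((Finset.range N).filter fun t => (v : ℝ) ≤ S t) S
      ⟨k, by simp only [Finset.mem_filter, Finset.mem_range]; exact ⟨by omega, by rwa [hSK k hkK]⟩⟩
    simp only [Finset.mem_filter, Finset.mem_range] at ht hmin
    -- The grid belongs to the points, so k/K competes for the minimum; with v ≤ S t this places S t
    -- within 1/K below k/K.
    have htk : S t ≤ (k : ℝ) / K := by
      rw [← hSK k hkK]
      exact hmin k ⟨by omega, by rwa [hSK k hkK]⟩
    have hkt : (k : ℝ) / K ≤ S t + 1 / K := by linarith [ht.2]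
    have hstat := hβ k hkK t ht.1 htk hkt (cut θ) (monotone_cut θ) (cut_le θ)
    have hvk01 : (k : ℝ) / K ∈ Icc (0 : ℝ) 1 :=
      ⟨by positivity, (div_le_one hK0).2 (by exact_mod_cast hkK)⟩
    -- The errors: 1/K for rounding the value v, 2rδ for moving the jumps of q to boundaries of
    -- cells, δ for replacing [v, 1] by [S t, 1] (no point lies in [v, S t)), and η for each of the
    -- two empirical terms.
    have h1 := abs_le.1 (abs_val_sub_val_sub_le J v ((k : ℝ) / K) {x | Odd (q x)} (Ici v))
    have h1' : |(v : ℝ) - (k : ℝ) / K| ≤ 1 / K := by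
      rw [abs_le]
      constructor <;> linarith [div_nonneg zero_le_one hK0.le]
    have h2 := abs_le.1 (abs_val_sub_le (M := mass J) (M' := mass J) hvk01
      (X := {x | Odd (q x)}) (Y := {x : I | Odd (cut θ (rank S N x))})
      (η := 2 * r * δ) fun b => (abs_mass_sub_le J b (D := ⋃ j, misplaced S N q θ j)
        fun x hx => by
          have := hcut x fun j hj => hx (mem_iUnion.2 ⟨j, hj⟩)
          simp only [mem_ofPred_eq, this]).trans (measureReal_iUnion_misplaced_le hgap hmis))
    have h3 := abs_le.1 (abs_val_sub_le (M := mass J) (M' := mass J) hvk01 (X := Ici v)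
      (Y := {x : I | S t ≤ x}) (η := δ) fun b =>
        (abs_mass_sub_le J b (D := {x : I | v ≤ x ∧ (x : ℝ) < S t}) fun x hx => by
          simp only [mem_ofPred_eq, not_and, not_lt, mem_Ici] at hx ⊢
          exact ⟨hx, fun h => show (v : ℝ) ≤ x from ht.2.trans h⟩).trans
        (hgap _ ⟨fun x hx y hy z hz => ⟨hx.1.trans hz.1, lt_of_le_of_lt hz.2 hy.2⟩⟩
          fun x hx t' ht' h => by
            have := hmin t' ⟨ht', by rw [← h]; exact hx.1⟩
            rw [← h] at this
            exact absurd hx.2 (not_lt.2 this)))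
    have h4 := abs_le.1 (abs_val_sub_le hvk01 fun b => hE b _
      (comp_rank_mem_steps (monotone_cut θ) (cut_le θ) S N))
    have h5 := abs_le.1 (abs_val_sub_le hvk01 fun b => hE.abs_up_le hr b (S t))
    linarith [h1.1, h1.2, h2.1, h2.2, h3.1, h3.2, h4.1, h4.2, h5.1, h5.2]
  linarith

/-- Every cell-wise statistic is about at most the calibration decision loss. -/
theorem stat_le_CDL {J : Measure (I × Bool)} [IsProbabilityMeasure J] {r : ℕ} {S : ℕ → ℝ} {N : ℕ}
    {E : Bool → Set I → ℝ} {η v h : ℝ} (hr : 1 ≤ r) (hE : UnifClose J r E η)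
    (hv : v ∈ Icc (0 : ℝ) 1) {s : ℝ} (hs : s ∈ Icc (0 : ℝ) 1) (hsv : |v - s| ≤ h)
    {Q : ℕ → ℕ} (hQ : Monotone Q) (hle : ∀ c, Q c ≤ 2 * r) :
    2 * (val E v {x : I | Odd (Q (rank S N x))} - val E v {x : I | s ≤ x}) ≤
      CDL (genMonotone r) J + 2 * (h + 2 * η) := by
  have hq := comp_rank_mem_steps hQ hle S N
  -- The kink is put at s, so that the up-set is exactly the one in the statistic; only the factor y
  -- − v changes, at cost h, and no assumption on gaps is needed.
  have h0 := two_mul_gain_le_CDL hr J ⟨s, hs⟩ hq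
  rw [gain_eq J _ (measurableSet_odd hq)] at h0
  have h1 := abs_le.1 ((abs_val_sub_val_sub_le J v s {x | Odd (Q (rank S N x))}
    {x : I | s ≤ x}).trans hsv)
  have h4 := abs_le.1 (abs_val_sub_le hv fun b => hE b _ hq)
  have h5 := abs_le.1 (abs_val_sub_le hv fun b => hE.abs_up_le hr b s)
  have e : (Ici (⟨s, hs⟩ : I)) = {x : I | s ≤ x} := rfl
  rw [e] at h0
  linarith [h1.1, h1.2, h4.1, h4.2, h5.1, h5.2]

end Calib

namespace Calib

open Set RealRAM Filter Topology ProbabilityTheory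

/-! ### Quantiles -/

/-- The infimum of the points where the distribution function reaches c: continuity of μ from above
gives the first inequality, continuity from below the second. -/
theorem exists_quantile (μ : Measure I) [IsProbabilityMeasure μ] {c : ℝ} (h0 : 0 ≤ c)
    (h1 : c ≤ 1) : ∃ t : I, c ≤ μ.real (Iic t) ∧ μ.real (Iio t) ≤ c := by
  set A : Set I := {t | c ≤ μ.real (Iic t)} with hA
  have hup : ∀ s ∈ A, ∀ t, s ≤ t → t ∈ A := fun s hs t hst =>
    le_trans hs (measureReal_mono (Iic_subset_Iic.2 hst))
  refine ⟨sInf A, ?_, ?_⟩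
  · rcases eq_or_ne (sInf A) 1 with h | h
    · have : Iic (1 : I) = univ := by
        ext x
        simp only [mem_Iic, mem_univ, iff_true]
        exact x.2.2
      rw [h, this]
      simpa using h1
    · obtain ⟨v, hv, hvm, hlim⟩ :=
        exists_seq_strictAnti_tendsto' (lt_of_le_of_ne (show sInf A ≤ 1 from (sInf A).2.2) h)
      have hI : Iic (sInf A) = ⋂ n, Iic (v n) := by
        ext x
        simp only [mem_Iic, mem_iInter]
        exact ⟨fun hx n => hx.trans (hvm n).1.le, fun hx => ge_of_tendsto' hlim hx⟩
      have hlim' := tendsto_measure_iInter_atTop (μ := μ) (s := fun n => Iic (v n))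
        (fun n => measurableSet_Iic.nullMeasurableSet)
        (fun i j hij => Iic_subset_Iic.2 (hv.antitone hij)) ⟨0, measure_ne_top _ _⟩
      rw [← hI] at hlim'
      refine ge_of_tendsto' ((ENNReal.tendsto_toReal (measure_ne_top _ _)).comp hlim') fun n => ?_
      obtain ⟨a, ha, hav⟩ := sInf_lt_iff.1 (hvm n).1
      exact hup a ha _ hav.le
  · rcases eq_or_ne (sInf A) 0 with h | h
    · have : Iio (0 : I) = ∅ := by
        ext x
        simp
      rw [h, this]
      simpa using h0
    · obtain ⟨v, hv, hvm, hlim⟩ := exists_seq_strictMono_tendsto'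
        (lt_of_le_of_ne (show 0 ≤ sInf A from (sInf A).2.1) h.symm)
      have hI : ⋃ n, Iic (v n) = Iio (sInf A) :=
        iUnion_Iic_eq_Iio_of_lt_of_tendsto (fun n => (hvm n).2) hlim
      have hlim' := tendsto_measure_iUnion_atTop (μ := μ) (s := fun n => Iic (v n))
        (fun i j hij => Iic_subset_Iic.2 (hv.monotone hij))
      rw [hI] at hlim'
      refine le_of_tendsto' ((ENNReal.tendsto_toReal (measure_ne_top _ _)).comp hlim') fun n => ?_
      by_contra hcon
      exact absurd (hvm n).2 (not_lt.2 (sInf_le (show v n ∈ A from (not_le.1 hcon).le)))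

/-- A quantile to the left of A would have too little mass up to it, and one to the right of A too
much mass before it. -/
theorem mem_of_quantile {μ : Measure I} [IsProbabilityMeasure μ] {A : Set I}
    (hA : A.OrdConnected) {c : ℝ} {t : I} (h1 : c ≤ μ.real (Iic t)) (h2 : μ.real (Iio t) ≤ c)
    (hlo : μ.real {z | ∀ a ∈ A, z < a} < c) (hhi : c < μ.real {z | ∀ a ∈ A, z < a} + μ.real A) :
    t ∈ A := by
  by_contra ht
  by_cases hl : ∀ a ∈ A, t < a
  · exact absurd (h1.trans (measureReal_mono (s₂ := {z | ∀ a ∈ A, z < a})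
      fun z (hz : z ≤ t) a ha => hz.trans_lt (hl a ha))) (not_le.2 hlo)
  · push Not at hl
    obtain ⟨a, ha, hat⟩ := hl
    have hlt : ∀ a' ∈ A, a' < t := fun a' ha' => lt_of_not_ge fun h => ht (hA.out ha ha' ⟨hat, h⟩)
    have hd : Disjoint {z | ∀ a ∈ A, z < a} A :=
      Set.disjoint_left.2 fun z hz hzA => lt_irrefl z (hz z hzA)
    have hu := measureReal_union (μ := μ) hd hA.measurableSet
    have : μ.real ({z | ∀ a ∈ A, z < a} ∪ A) ≤ μ.real (Iio t) := measureReal_mono (by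
      rintro z (hz | hz)
      · exact (hz a ha).trans (hlt a ha)
      · exact hlt z hz)
    linarith

/-- The blocks are closed, so they keep mass at least 1/M even when J has atoms and quantiles
coincide. -/
theorem exists_quantiles (μ : Measure I) [IsProbabilityMeasure μ] {M : ℕ} (hM : 1 ≤ M) :
    ∃ t : ℕ → I, (∀ i < M, 1 / (M : ℝ) ≤ μ.real (Icc (t i) (t (i + 1)))) ∧
      ∀ A : Set I, A.OrdConnected → 2 / (M : ℝ) < μ.real A →
        ∃ i < M, t i ∈ A ∧ t (i + 1) ∈ A := by
  have hM0 : (0 : ℝ) < M := by exact_mod_cast hM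
  have hex : ∀ i : ℕ, ∃ t : I, i ≤ M → (i : ℝ) / M ≤ μ.real (Iic t) ∧ μ.real (Iio t) ≤ (i : ℝ) / M := by
    intro i
    by_cases hi : i ≤ M
    · obtain ⟨t, ht⟩ := exists_quantile μ (c := (i : ℝ) / M) (by positivity)
        ((div_le_one hM0).2 (by exact_mod_cast hi))
      exact ⟨t, fun _ => ht⟩
    · exact ⟨0, fun h => absurd h hi⟩
  choose t ht using hex
  refine ⟨t, fun i hi => ?_, fun A hA hμA => ?_⟩
  · have h1 := (ht (i + 1) hi).1
    have h2 := (ht i hi.le).2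
    have : μ.real (Iic (t (i + 1))) ≤ μ.real (Iio (t i)) + μ.real (Icc (t i) (t (i + 1))) := by
      refine (measureReal_mono fun z hz => ?_).trans (measureReal_union_le _ _)
      rcases lt_or_ge z (t i) with h | h
      exacts [.inl h, .inr ⟨h, hz⟩]
    push_cast at h1
    rw [add_div] at h1
    linarith
  · set f := μ.real {z | ∀ a ∈ A, z < a} with hf
    have hd : Disjoint {z | ∀ a ∈ A, z < a} A :=
      Set.disjoint_left.2 fun z hz hzA => lt_irrefl z (hz z hzA)
    have hle1 : f + μ.real A ≤ 1 := by
      rw [hf, ← measureReal_union hd hA.measurableSet]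
      exact measureReal_le_one
    have hf0 : 0 ≤ f := measureReal_nonneg
    have hfl := Nat.floor_le (mul_nonneg hf0 hM0.le)
    have hfl' := Nat.lt_floor_add_one (f * M)
    -- With f the mass to the left of A, both (k+1)/M and (k+2)/M lie strictly between f and f +
    -- μ(A).
    set k := ⌊f * M⌋₊ with hk
    have e : 2 / (M : ℝ) = 1 / M + 1 / M := by ring
    have a1 : (k : ℝ) / M ≤ f := by rwa [div_le_iff₀ hM0]
    have a2 : f < ((k + 1 : ℕ) : ℝ) / M := by
      rw [lt_div_iff₀ hM0]
      push_cast
      exact hfl'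
    have a3 : ((k + 1 : ℕ) : ℝ) / M = k / M + 1 / M := by push_cast; ring
    have a4 : ((k + 1 + 1 : ℕ) : ℝ) / M = k / M + 1 / M + 1 / M := by push_cast; ring
    have hpos : 0 < 1 / (M : ℝ) := by positivity
    have hkM : k + 1 + 1 ≤ M := by
      have : ((k + 1 + 1 : ℕ) : ℝ) / M ≤ 1 := by linarith
      rw [div_le_one hM0] at this
      exact_mod_cast this
    have q1 := ht (k + 1) (by omega)
    have q2 := ht (k + 1 + 1) hkM
    exact ⟨k + 1, by omega, mem_of_quantile hA q1.1 q1.2 a2 (by linarith),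
      mem_of_quantile hA q2.1 q2.2 (by linarith) (by linarith)⟩

/-- Points that hit all blocks between consecutive quantiles leave small gaps. -/
theorem smallGaps_of_hits {J : Measure (I × Bool)} [IsProbabilityMeasure J] {M N : ℕ} {t : ℕ → I}
    (ht : ∀ A : Set I, A.OrdConnected → 2 / (M : ℝ) < J.fst.real A → ∃ i < M, t i ∈ A ∧ t (i + 1) ∈ A)
    {S : ℕ → ℝ} (hS : ∀ i < M, ∃ s < N, ∃ x : I, S s = x ∧ x ∈ Icc (t i) (t (i + 1))) :
    SmallGaps J S N (2 / M) := by
  intro A hA hne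
  rw [measureReal_def, ← Measure.fst_apply hA.measurableSet, ← measureReal_def]
  by_contra hcon
  obtain ⟨i, hi, h1, h2⟩ := ht A hA (not_le.1 hcon)
  obtain ⟨s, hs, x, hx, hxm⟩ := hS i hi
  exact hne x (hA.out h1 h2 hxm) s hs hx.symm

/-! ### Concentration -/

/-- By independence the probability is (1 − J(E))^m, and 1 − c ≤ exp(−c). -/
theorem prob_miss_le {α : Type*} [MeasurableSpace α] (J : Measure α) [IsProbabilityMeasure J]
    {E : Set α} (hE : MeasurableSet E) {c : ℝ} (hc : c ≤ J.real E) (m : ℕ) :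
    (Measure.infinitePi fun _ : ℕ => J).real {z | ∀ j < m, z j ∉ E} ≤ Real.exp (-(m * c)) := by
  have hset : {z : ℕ → α | ∀ j < m, z j ∉ E} = Set.pi (Finset.range m) fun _ => Eᶜ := by
    ext z
    simp [Set.mem_pi]
  rw [hset, measureReal_def, Measure.infinitePi_pi _ fun _ _ => hE.compl, Finset.prod_const,
    Finset.card_range, ENNReal.toReal_pow, ← measureReal_def, probReal_compl_eq_one_sub hE,
    ← mul_neg, Real.exp_nat_mul]
  have h1 : J.real E ≤ 1 := measureReal_le_one
  exact pow_le_pow_left₀ (by linarith) (by linarith [Real.add_one_le_exp (-c)]) m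

/-- The fraction of the first `n` examples that lie in `E`. -/
noncomputable def freq {α : Type*} (z : ℕ → α) (n : ℕ) (E : Set α) : ℝ :=
  (∑ j ∈ Finset.range n, E.indicator 1 (z j)) / n

/-- Hoeffding's inequality applied to both tails: a centred indicator is subgaussian with parameter
1/4. The shift by m skips the examples spent on points. -/
theorem prob_freq_le {α : Type*} [MeasurableSpace α] (J : Measure α) [IsProbabilityMeasure J]
    {E : Set α} (hE : MeasurableSet E) (m : ℕ) {n : ℕ} (hn : 1 ≤ n) {η : ℝ} (hη : 0 ≤ η) :
    (Measure.infinitePi fun _ : ℕ => J).real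
      {z | η < |freq (fun j => z (m + j)) n E - J.real E|} ≤ 2 * Real.exp (-(2 * n * η ^ 2)) := by
  have hn0 : (0 : ℝ) < n := by exact_mod_cast hn
  set P := Measure.infinitePi fun _ : ℕ => J with hP
  have hind : Measurable (E.indicator (1 : α → ℝ)) := measurable_one.indicator hE
  have hI : iIndepFun (fun (j : ℕ) (z : ℕ → α) => E.indicator (1 : α → ℝ) (z (m + j)) - J.real E) P :=
    (iIndepFun_infinitePi (P := fun _ : ℕ => J)
      (X := fun _ a => E.indicator (1 : α → ℝ) a - J.real E) fun _ => hind.sub_const _).precomp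
      (g := fun j => m + j) (add_right_injective m)
  have hmean : ∀ j : ℕ, ∫ z, E.indicator (1 : α → ℝ) (z (m + j)) ∂P = J.real E := by
    intro j
    have := integral_map (μ := P) (φ := fun z : ℕ → α => z (m + j))
      (measurable_pi_apply _).aemeasurable (f := E.indicator (1 : α → ℝ))
      hind.aestronglyMeasurable
    rw [← this, hP]
    have hmap := Measure.infinitePi_map_eval (fun _ : ℕ => J) (m + j)
    have : (Measure.infinitePi fun _ : ℕ => J).map (fun z : ℕ → α => z (m + j)) = J := hmap
    rw [this, integral_indicator_one hE]
  have hsub : ∀ j : ℕ, HasSubgaussianMGF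
      (fun z : ℕ → α => E.indicator (1 : α → ℝ) (z (m + j)) - J.real E) ((‖(1 : ℝ) - 0‖₊ / 2) ^ 2) P := by
    intro j
    have := hasSubgaussianMGF_of_mem_Icc (μ := P) (a := 0) (b := 1)
      (X := fun z : ℕ → α => E.indicator (1 : α → ℝ) (z (m + j)))
      (hind.comp (measurable_pi_apply _)).aemeasurable (Eventually.of_forall fun z => by
        by_cases h : z (m + j) ∈ E <;> simp [h])
    rwa [hmean j] at this
  have hexp : ∀ x : ℝ, x = n * η → Real.exp (-x ^ 2 / (2 * n * (((‖(1 : ℝ) - 0‖₊ / 2) ^ 2 : NNReal) : ℝ))) =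
      Real.exp (-(2 * n * η ^ 2)) := by
    rintro x rfl
    congr 1
    simp
    field_simp
  have hup := HasSubgaussianMGF.measure_sum_range_ge_le_of_iIndepFun hI (n := n)
    (fun j _ => hsub j) (ε := n * η) (by positivity)
  have hlo := HasSubgaussianMGF.measure_sum_range_ge_le_of_iIndepFun
    (hI.comp (fun _ x => -x) fun _ => measurable_neg) (n := n)
    (fun j _ => (hsub j).neg) (ε := n * η) (by positivity)
  rw [hexp _ rfl] at hup hlo
  refine (measureReal_mono (s₂ := _ ∪ _) fun z hz => ?_).trans
    ((measureReal_union_le _ _).trans ((add_le_add hup hlo).trans_eq (two_mul _).symm))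
  have hsum : ∑ j ∈ Finset.range n, (E.indicator (1 : α → ℝ) (z (m + j)) - J.real E) =
      n * (freq (fun j => z (m + j)) n E - J.real E) := by
    rw [freq, Finset.sum_sub_distrib, Finset.sum_const, Finset.card_range, nsmul_eq_mul, mul_sub,
      mul_div_cancel₀ _ hn0.ne']
  rcases lt_abs.1 (show η < |freq (fun j => z (m + j)) n E - J.real E| from hz) with h | h
  · left
    rw [mem_ofPred_eq, hsum]
    gcongr
  · right
    simp only [mem_ofPred_eq, Function.comp_def, Finset.sum_neg_distrib, hsum]
    rw [← mul_neg]
    gcongr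

end Calib

/-! ### Uniform convergence over unions of r intervals -/

namespace Calib

open Set RealRAM

/-- The fraction of the examples with label `b` and prediction in `X`. -/
noncomputable def freqMass (z : ℕ → I × Bool) (n : ℕ) (b : Bool) (X : Set I) : ℝ :=
  freq z n {w | w.1 ∈ X ∧ w.2 = b}

theorem abs_freqMass_sub_le (z : ℕ → I × Bool) (n : ℕ) (b : Bool) {X Y D : Set I}
    (h : ∀ x, x ∉ D → (x ∈ X ↔ x ∈ Y)) :
    |freqMass z n b X - freqMass z n b Y| ≤ freq z n (Prod.fst ⁻¹' D) := by
  rw [freqMass, freqMass, freq, freq, freq, ← sub_div, ← Finset.sum_sub_distrib, abs_div,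
    Nat.abs_cast]
  refine div_le_div_of_nonneg_right ((Finset.abs_sum_le_sum_abs _ _).trans
    (Finset.sum_le_sum fun j _ => ?_)) (Nat.cast_nonneg n)
  by_cases hD : (z j).1 ∈ D
  · rw [indicator_of_mem (show z j ∈ Prod.fst ⁻¹' D from hD)]
    by_cases hX : z j ∈ {w : I × Bool | w.1 ∈ X ∧ w.2 = b} <;>
      by_cases hY : z j ∈ {w : I × Bool | w.1 ∈ Y ∧ w.2 = b} <;>
      simp only [hX, hY, indicator_of_mem, indicator_of_notMem, not_false_eq_true] <;> simp
  · have e : z j ∈ {w : I × Bool | w.1 ∈ X ∧ w.2 = b} ↔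
        z j ∈ {w : I × Bool | w.1 ∈ Y ∧ w.2 = b} := by
      simp only [mem_ofPred_eq, h _ hD]
    by_cases hX : z j ∈ {w : I × Bool | w.1 ∈ X ∧ w.2 = b}
    · simp [indicator_of_mem hX, indicator_of_mem (e.1 hX), hD]
    · simp [indicator_of_notMem hX, indicator_of_notMem fun h' => hX (e.2 h'), hD]

/-- Closeness on the sets cut out by cell numbers implies closeness on all unions of `r`
intervals. -/
theorem unifClose_of_cells {J : Measure (I × Bool)} [IsProbabilityMeasure J] {r N : ℕ} {T : ℕ → ℝ}
    {δ η : ℝ} (hT : SmallGaps J T N δ) (hδ : 0 ≤ δ) {z : ℕ → I × Bool} {n : ℕ}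
    (h1 : ∀ b, ∀ θ : Fin (2 * r) → Fin (2 * N + 2),
      |freq z n {w | w.1 ∈ {x : I | Odd (cut (fun j => (θ j : ℕ)) (rank T N x))} ∧ w.2 = b} -
        J.real {w | w.1 ∈ {x : I | Odd (cut (fun j => (θ j : ℕ)) (rank T N x))} ∧ w.2 = b}| ≤ η)
    (h2 : ∀ g : Fin (2 * r) → Fin (2 * N + 2),
      |freq z n (Prod.fst ⁻¹' {x : I | ∃ j, rank T N x = g j}) -
        J.real (Prod.fst ⁻¹' {x : I | ∃ j, rank T N x = g j})| ≤ η) :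
    UnifClose J r (freqMass z n) (2 * η + 4 * r * δ) := by
  classical
  intro b q hq
  obtain ⟨θ, hθ, hcut, hmis⟩ := exists_cut (r := r) T N hq
  let θ' : Fin (2 * r) → Fin (2 * N + 2) := fun j => ⟨θ j, by have := hθ j; omega⟩
  -- The exceptional set D consists of whole cells, so it depends only on g, which has finitely many
  -- values. The last index 2N + 1 stands for an empty cell.
  let g : Fin (2 * r) → Fin (2 * N + 2) := fun j =>
    if (misplaced T N q θ j).Nonempty then θ' j else Fin.last _
  set D : Set I := {x : I | ∃ j, rank T N x = g j} with hD
  have hDmis : ∀ x j, x ∈ misplaced T N q θ j → x ∈ D := fun x j hx => by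
    refine ⟨j, ?_⟩
    have hne : (misplaced T N q θ j).Nonempty := ⟨x, hx⟩
    simp only [g, if_pos hne, θ']
    exact ((hmis j).2 x hx).1
  have hagree : ∀ x, x ∉ D → (x ∈ {x | Odd (q x)} ↔ x ∈ {x : I | Odd (cut θ (rank T N x))}) := by
    intro x hx
    have := hcut x fun j hj => hx (hDmis x j hj)
    simp only [mem_ofPred_eq, this]
  have hDJ : J.real (Prod.fst ⁻¹' D) ≤ 2 * r * δ := by
    have e : (Prod.fst ⁻¹' D : Set (I × Bool)) =
        ⋃ j, Prod.fst ⁻¹' {x : I | rank T N x = g j} := by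
      ext w
      simp [hD]
    rw [e]
    calc _ ≤ ∑ j, J.real (Prod.fst ⁻¹' {x : I | rank T N x = g j}) :=
          measureReal_iUnion_fintype_le _
      _ ≤ ∑ _j : Fin (2 * r), δ := Finset.sum_le_sum fun j _ => ?_
      _ = 2 * r * δ := by simp
    by_cases hne : (misplaced T N q θ j).Nonempty
    · have hg : (g j : ℕ) = θ j := by simp [g, if_pos hne, θ']
      refine hT _ ⟨fun x hx y hy w hw => ?_⟩ fun x hx t ht hxt => ?_
      · have h1 := monotone_rank T N (show (x : ℝ) ≤ w from hw.1)
        have h2 := monotone_rank T N (show (w : ℝ) ≤ y from hw.2)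
        simp only [mem_ofPred_eq] at hx hy ⊢
        omega
      -- A misplaced x0 shows that its cell is a gap: a point T t in the cell would have to equal
      -- x0, but misplaced points avoid all T t.
      · obtain ⟨x0, hx0⟩ := hne
        obtain ⟨e1, e2⟩ := (hmis j).2 x0 hx0
        simp only [mem_ofPred_eq] at hx
        rcases lt_trichotomy (x : ℝ) x0 with h | h | h
        · have := rank_lt_rank ht h hxt.le (hxt ▸ h.le)
          omega
        · exact e2 t ht (h ▸ hxt)
        · have := rank_lt_rank ht h (hxt ▸ h.le) hxt.ge
          omega
    · have hemp : {x : I | rank T N x = g j} = ∅ := by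
        ext x
        have := rank_le T N x
        simp only [mem_ofPred_eq, mem_empty_iff_false, iff_false]
        simp only [g, if_neg hne, Fin.val_last]
        omega
      rw [hemp]
      simpa using hδ
  -- The budget: η on the cell set, η + 2rδ for the frequency of D, and 2rδ for its mass.
  have a1 := abs_le.1 (abs_freqMass_sub_le z n b hagree)
  have a2 := abs_le.1 (abs_mass_sub_le J b hagree)
  have a3 := abs_le.1 (h1 b θ')
  have a4 := abs_le.1 (h2 g)
  rw [← hD] at a4
  change _ ≤ freqMass z n b {x : I | Odd (cut θ (rank T N x))} -
    mass J b {x : I | Odd (cut θ (rank T N x))} ∧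
    freqMass z n b {x : I | Odd (cut θ (rank T N x))} -
    mass J b {x : I | Odd (cut θ (rank T N x))} ≤ _ at a3
  rw [abs_le]
  constructor <;> linarith [a1.1, a1.2, a2.1, a2.2, a3.1, a3.2, a4.1, a4.2]

theorem measurableSet_rank_preimage (T : ℕ → ℝ) (N : ℕ) (G : Set ℕ) :
    MeasurableSet {x : I | rank T N x ∈ G} :=
  (monotone_rank T N).measurable.comp measurable_subtype_coe
    (MeasurableSet.of_discrete (s := G))

/-- With the stated probability, the first `m` predictions leave small gaps and the next `n`
examples have frequencies uniformly close to their probabilities. -/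
theorem prob_not_good_le (J : Measure (I × Bool)) [IsProbabilityMeasure J] {r M m n : ℕ}
    (hM : 1 ≤ M) (hn : 1 ≤ n) {η : ℝ} (hη : 0 ≤ η) {N : ℕ}
    (S : (ℕ → I × Bool) → ℕ → ℝ) (hS : ∀ z, ∀ j < m, ∃ s < N, S z s = (z j).1) :
    (Measure.infinitePi fun _ : ℕ => J).real {z | ¬ (SmallGaps J (S z) N (2 / M) ∧
      UnifClose J r (freqMass (fun j => z (m + j)) n) (2 * η + 4 * r * (2 / M)))} ≤
    M * Real.exp (-(m * (1 / M))) +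
      3 * (2 * M + 4) ^ (2 * r) * (2 * Real.exp (-(2 * n * η ^ 2))) := by
  set P := Measure.infinitePi fun _ : ℕ => J
  obtain ⟨t, ht1, ht2⟩ := exists_quantiles J.fst hM
  -- The quantiles hit their own blocks. Being deterministic, they give a fixed finite family of
  -- sets for the union bound, whatever the random points are.
  have hT : SmallGaps J (fun i => (t i : ℝ)) (M + 1) (2 / M) := by
    have hmono : ∀ i < M, t i ≤ t (i + 1) := fun i hi => by
      by_contra hcon
      have := ht1 i hi
      rw [Icc_eq_empty hcon, measureReal_empty] at this
      have : (0 : ℝ) < 1 / M := by positivity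
      linarith
    exact smallGaps_of_hits ht2 fun i hi => ⟨i, by omega, t i, rfl, le_rfl, hmono i hi⟩
  let θs := Fin (2 * r) → Fin (2 * (M + 1) + 2)
  let E1 : Bool → θs → Set (I × Bool) := fun b θ =>
    {w | w.1 ∈ {x : I | Odd (cut (fun j => (θ j : ℕ)) (rank (fun i => (t i : ℝ)) (M + 1) x))} ∧
      w.2 = b}
  let E2 : θs → Set (I × Bool) := fun g =>
    Prod.fst ⁻¹' {x : I | ∃ j, rank (fun i => (t i : ℝ)) (M + 1) x = g j}
  let E3 : ℕ → Set (I × Bool) := fun i => Prod.fst ⁻¹' Icc (t i) (t (i + 1))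
  have hE1 : ∀ b θ, MeasurableSet (E1 b θ) := fun b θ =>
    (measurable_fst (measurableSet_rank_preimage _ _
      {c | Odd (cut (fun j => (θ j : ℕ)) c)})).inter (measurable_snd (measurableSet_singleton b))
  have hE2 : ∀ g, MeasurableSet (E2 g) := fun g =>
    measurable_fst (measurableSet_rank_preimage _ _ {c | ∃ j, c = g j})
  have hE3 : ∀ i, MeasurableSet (E3 i) := fun i => measurable_fst measurableSet_Icc
  let B : Set (I × Bool) → Set (ℕ → I × Bool) := fun E =>
    {z | η < |freq (fun j => z (m + j)) n E - J.real E|}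
  have hsub : {z | ¬ (SmallGaps J (S z) N (2 / M) ∧
      UnifClose J r (freqMass (fun j => z (m + j)) n) (2 * η + 4 * r * (2 / M)))} ⊆
      (⋃ i : Fin M, {z | ∀ j < m, z j ∉ E3 i}) ∪
        ((⋃ p : Bool × θs, B (E1 p.1 p.2)) ∪ ⋃ g, B (E2 g)) := by
    intro z hz
    by_contra hcon
    simp only [mem_union, mem_iUnion, not_or, not_exists, Prod.forall, B, mem_ofPred_eq,
      not_lt, not_forall, not_not] at hcon
    obtain ⟨h3, h1, h2⟩ := hcon
    refine hz ⟨smallGaps_of_hits ht2 fun i hi => ?_, unifClose_of_cells hT (by positivity) h1 h2⟩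
    obtain ⟨j, hj, hjE⟩ := h3 ⟨i, hi⟩
    obtain ⟨s, hs, hsj⟩ := hS z j hj
    exact ⟨s, hs, _, hsj, hjE⟩
  have hcard : (Fintype.card θs : ℝ) = (2 * M + 4) ^ (2 * r) := by
    simp only [θs, Fintype.card_fun, Fintype.card_fin]
    push_cast
    ring
  have b3 : P.real (⋃ i : Fin M, {z | ∀ j < m, z j ∉ E3 i}) ≤ M * Real.exp (-(m * (1 / M))) := by
    calc _ ≤ ∑ i : Fin M, P.real {z | ∀ j < m, z j ∉ E3 i} := measureReal_iUnion_fintype_le _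
      _ ≤ ∑ _i : Fin M, Real.exp (-(m * (1 / M))) := Finset.sum_le_sum fun i _ => by
          refine prob_miss_le J (hE3 i) ?_ m
          have := ht1 i i.2
          rwa [measureReal_def, Measure.fst_apply measurableSet_Icc] at this
      _ = _ := by simp
  have b1 : P.real (⋃ p : Bool × θs, B (E1 p.1 p.2)) ≤
      2 * (2 * M + 4) ^ (2 * r) * (2 * Real.exp (-(2 * n * η ^ 2))) := by
    calc _ ≤ ∑ p : Bool × θs, P.real (B (E1 p.1 p.2)) := measureReal_iUnion_fintype_le _
      _ ≤ ∑ _p : Bool × θs, 2 * Real.exp (-(2 * n * η ^ 2)) := Finset.sum_le_sum fun p _ =>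
          prob_freq_le J (hE1 p.1 p.2) m hn hη
      _ = _ := by
          rw [Finset.sum_const, nsmul_eq_mul, Finset.card_univ, Fintype.card_prod,
            Fintype.card_bool, Nat.cast_mul, hcard]
          norm_num
  have b2 : P.real (⋃ g, B (E2 g)) ≤
      (2 * M + 4) ^ (2 * r) * (2 * Real.exp (-(2 * n * η ^ 2))) := by
    calc _ ≤ ∑ g : θs, P.real (B (E2 g)) := measureReal_iUnion_fintype_le _
      _ ≤ ∑ _g : θs, 2 * Real.exp (-(2 * n * η ^ 2)) := Finset.sum_le_sum fun g _ =>
          prob_freq_le J (hE2 g) m hn hη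
      _ = _ := by rw [Finset.sum_const, nsmul_eq_mul, Finset.card_univ, hcard]
  have hle := (measureReal_mono (μ := P) hsub).trans ((measureReal_union_le _ _).trans
    (add_le_add b3 ((measureReal_union_le _ _).trans (add_le_add b1 b2))))
  linarith

end Calib

namespace RealRAM

open Finset

/-! ### Correctness of the statistics computed by the tester -/

/-- Either Q equals q at the last index, which is the first option of the recursion, or by
monotonicity all its values are below q and the bound can be lowered. -/
theorem sum_le_pathBest (w : ℕ → ℝ) (c q : ℕ) (Q : ℕ → ℕ) (hQ : Monotone Q)
    (hle : ∀ i < c, Q i ≤ q) :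
    ∑ i ∈ range c, (if Odd (Q i) then w i else 0) ≤ pathBest w c q := by
  induction c generalizing q with
  | zero => simp [pathBest]
  | succ c ih =>
    induction q with
    | zero =>
      rw [pathBest_zero_right]
      refine (sum_eq_zero fun i hi => ?_).le
      have : Q i = 0 := Nat.le_zero.1 (hle i (mem_range.1 hi))
      simp [this]
    | succ q ihq =>
      rcases (hle c (by omega)).eq_or_lt with h | h
      · rw [sum_range_succ, h, pathBest]
        exact le_max_of_le_left (add_le_add (ih _ fun i hi => hle i (by omega)) le_rfl)
      · rw [pathBest]
        exact le_max_of_le_right (ihq fun i hi => (hQ (by omega : i ≤ c)).trans (by omega))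

theorem exists_sum_eq_pathBest (w : ℕ → ℝ) (c q : ℕ) :
    ∃ Q : ℕ → ℕ, Monotone Q ∧ (∀ i, Q i ≤ q) ∧
      ∑ i ∈ range c, (if Odd (Q i) then w i else 0) = pathBest w c q := by
  induction c generalizing q with
  | zero => exact ⟨fun _ => 0, monotone_const, fun _ => Nat.zero_le _, by simp [pathBest]⟩
  | succ c ih =>
    induction q with
    | zero =>
      exact ⟨fun _ => 0, monotone_const, fun _ => Nat.zero_le _, by simp [pathBest_zero_right]⟩
    | succ q ihq =>
      rw [pathBest]
      rcases max_choice (pathBest w c (q + 1) + if Odd (q + 1) then w c else 0)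
        (pathBest w (c + 1) q) with h | h
      · obtain ⟨Q, hQ, hle, hs⟩ := ih (q + 1)
        refine ⟨fun i => if i < c then Q i else q + 1, fun i j hij => ?_, fun i => ?_, ?_⟩
        · dsimp only
          split_ifs with h1 h2
          · exact hQ hij
          · exact hle i
          · omega
          · exact le_rfl
        · dsimp only
          split_ifs
          · exact hle i
          · exact le_rfl
        · rw [h, sum_range_succ, ← hs]
          simp only [lt_irrefl, if_false]
          congr 1
          refine sum_congr rfl fun i hi => ?_
          simp only [if_pos (mem_range.1 hi)]
      · obtain ⟨Q, hQ, hle, hs⟩ := ihq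
        exact ⟨Q, hQ, fun i => (hle i).trans (Nat.le_succ q), by rw [h, hs]⟩

theorem weightOf_cellCount (S : ℕ → ℝ) (N : ℕ) (z : ℕ → I × Bool) (n : ℕ) (v : ℝ) (c : ℕ) :
    weightOf (cellCount S N z n) v c =
      ∑ j ∈ range n, if rank S N (z j).1 = c then ((z j).2.toNat : ℝ) - v else 0 := by
  simp only [weightOf, cellCount, Nat.cast_sum, sum_mul, ← sum_sub_distrib]
  refine sum_congr rfl fun j _ => ?_
  by_cases h : rank S N (z j).1 = c
  · cases hy : (z j).2 <;> simp [h]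
  · cases hy : (z j).2
    · have h1 : ¬ 2 * rank S N (z j).1 = 2 * c + 1 := by omega
      simp [h, h1]
    · have h1 : ¬ 2 * rank S N (z j).1 + 1 = 2 * c := by omega
      simp [h, h1]

theorem weightOf_upCount {S : ℕ → ℝ} {N t : ℕ} (ht : t < N) (z : ℕ → I × Bool) (n : ℕ) (v : ℝ) :
    weightOf (upCount S N z n) v t =
      ∑ j ∈ range n, if S t ≤ (z j).1 then ((z j).2.toNat : ℝ) - v else 0 := by
  have key : ∀ (x : ℝ) (y : Bool) (b : Bool), upIndex S N x y (2 * t + b.toNat) =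
      if S t ≤ x ∧ y = b then 1 else 0 := by
    intro x y b
    rw [upIndex, sum_eq_single_of_mem t (mem_range.2 ht)]
    · refine if_congr (and_congr_right fun _ => ?_) rfl rfl
      cases y <;> cases b <;> simp
    · intro t' _ hne
      refine if_neg fun h => hne ?_
      have h2 := h.2
      have := Bool.toNat_le y
      have := Bool.toNat_le b
      omega
  have k1 := fun x y => key x y true
  have k0 := fun x y => key x y false
  simp only [Bool.toNat_true, Bool.toNat_false, add_zero] at k1 k0
  simp only [weightOf, upCount, k1, k0, Nat.cast_sum, sum_mul, ← sum_sub_distrib]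
  refine sum_congr rfl fun j _ => ?_
  by_cases h : S t ≤ (z j).1 <;> cases hy : (z j).2 <;> simp [h]

open Calib

theorem mul_val_freqMass (z : ℕ → I × Bool) {n : ℕ} (hn : 1 ≤ n) (v : ℝ) (X : Set I)
    [DecidablePred (· ∈ X)] : n * val (freqMass z n) v X =
      ∑ j ∈ range n, if (z j).1 ∈ X then ((z j).2.toNat : ℝ) - v else 0 := by
  classical
  have hn0 : (n : ℝ) ≠ 0 := by positivity
  have e : ∀ b, (n : ℝ) * freqMass z n b X =
      ∑ j ∈ range n, if (z j).1 ∈ X ∧ (z j).2 = b then 1 else 0 := by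
    intro b
    rw [freqMass, freq, mul_div_cancel₀ _ hn0]
    exact sum_congr rfl fun j _ => by simp [Set.indicator_apply]
  rw [Calib.val, mul_sub, ← mul_assoc, ← mul_assoc, e, e, sum_mul, sum_mul, ← sum_sub_distrib]
  refine sum_congr rfl fun j _ => ?_
  by_cases h : (z j).1 ∈ X <;> cases hy : (z j).2 <;> simp [h]

/-- Each example lies in exactly one of the 2N + 1 cells, so exchanging the sums over cells and
examples regroups the weights. -/
theorem sum_odd_weightOf_cellCount (S : ℕ → ℝ) (N : ℕ) (z : ℕ → I × Bool) {n : ℕ} (hn : 1 ≤ n)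
    (v : ℝ) (Q : ℕ → ℕ) :
    ∑ c ∈ range (2 * N + 1), (if Odd (Q c) then weightOf (cellCount S N z n) v c else 0) =
      n * val (freqMass z n) v {x : I | Odd (Q (rank S N x))} := by
  classical
  rw [mul_val_freqMass z hn]
  have e : ∀ c, (if Odd (Q c) then weightOf (cellCount S N z n) v c else 0) =
      ∑ j ∈ range n, if rank S N (z j).1 = c then
        (if Odd (Q c) then ((z j).2.toNat : ℝ) - v else 0) else 0 := by
    intro c
    split_ifs
    · exact weightOf_cellCount S N z n v c
    · simp
  simp only [e]
  rw [sum_comm]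
  refine sum_congr rfl fun j _ => ?_
  rw [sum_ite_eq, if_pos (mem_range.2 (Nat.lt_succ_of_le (rank_le S N _)))]
  rfl

/-- The rejection condition holds if and only if some cell-wise statistic is large. -/
theorem exceeds_iff {r K N n t : ℕ} {α ε v : ℝ} {S : ℕ → ℝ} {z : ℕ → I × Bool} (hn : 1 ≤ n)
    (ht : t < N) :
    Exceeds r α ε K N n S (cellCount S N z n) (upCount S N z n) v t ↔
      S t ≤ v ∧ v ≤ S t + 1 / K ∧ ∃ Q : ℕ → ℕ, Monotone Q ∧ (∀ c, Q c ≤ 2 * r) ∧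
        α - ε / 2 < 2 * (val (freqMass z n) v {x : I | Odd (Q (rank S N x))} -
          val (freqMass z n) v {x : I | S t ≤ x}) := by
  classical
  have hn0 : (0 : ℝ) < n := by exact_mod_cast hn
  have hup : weightOf (upCount S N z n) v t = n * val (freqMass z n) v {x : I | S t ≤ x} := by
    rw [weightOf_upCount ht, mul_val_freqMass z hn]
    rfl
  have key : ∀ a b : ℝ, (α - ε / 2) * n < 2 * (n * a - n * b) ↔ α - ε / 2 < 2 * (a - b) := by
    intro a b
    rw [show 2 * (n * a - n * b) = 2 * (a - b) * n by ring]
    exact mul_lt_mul_iff_left₀ hn0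
  unfold Exceeds
  refine and_congr_right fun _ => and_congr_right fun _ => ⟨fun h => ?_, ?_⟩
  · obtain ⟨Q, hQ, hle, hs⟩ := exists_sum_eq_pathBest (weightOf (cellCount S N z n) v)
      (2 * N + 1) (2 * r)
    rw [← hs, sum_odd_weightOf_cellCount S N z hn, hup, key] at h
    exact ⟨Q, hQ, hle, h⟩
  · rintro ⟨Q, hQ, hle, h⟩
    have hs := sum_le_pathBest (weightOf (cellCount S N z n) v) (2 * N + 1) (2 * r) Q hQ
      fun i _ => hle i
    rw [sum_odd_weightOf_cellCount S N z hn] at hs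
    rw [← key] at h
    rw [hup]
    linarith

end RealRAM

namespace RealRAM

open Calib Real

/-! ### Success probability -/

/-- The number of cells of the quantile partition used in the analysis. -/
noncomputable def cellNumber (r : ℕ) (ε : ℝ) : ℕ := ⌈352 * (r / ε)⌉₊

/-- The examples `z` represent `J` well: their first part leaves no large gap between the points,
and their second part has frequencies uniformly close to the probabilities. -/
def Good (J : Measure (I × Bool)) (r : ℕ) (ε : ℝ) (z : ℕ → I × Bool) : Prop :=
  SmallGaps J (points (gridSize ε) (z, fun _ => false)) (numPoints r ε) (2 / cellNumber r ε) ∧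
    UnifClose J r (freqMass (fun j => z (pointDraws r ε + j)) (sampleSize r ε))
      (2 * (ε / 64) + 4 * r * (2 / cellNumber r ε))

variable {r : ℕ} {α ε : ℝ}

theorem one_le_ratio (hr : 1 ≤ r) (hε : 0 < ε) (hε1 : ε < 1) : 1 ≤ (r : ℝ) / ε := by
  have : (1 : ℝ) ≤ r := by exact_mod_cast hr
  rw [le_div_iff₀ hε]
  linarith

theorem one_le_scale : (1 : ℝ) ≤ scale r ε := by
  rw [scale]
  push_cast
  linarith [Nat.cast_nonneg (α := ℝ) ⌈logb 2 ((r : ℝ) / ε)⌉₊]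

/-- The scale is at least log₂(r/ε) + 1, and 2 ≤ e. The surplus 1 serves to absorb constants into
exponentials. -/
theorem ratio_le_exp (hr : 1 ≤ r) (hε : 0 < ε) (hε1 : ε < 1) :
    (r : ℝ) / ε ≤ exp (scale r ε - 1) := by
  have hX := one_le_ratio hr hε hε1
  have h : logb 2 (r / ε) ≤ (scale r ε : ℝ) - 1 := by
    rw [scale]
    push_cast
    linarith [Nat.le_ceil (logb 2 ((r : ℝ) / ε))]
  rw [logb, div_le_iff₀ (log_pos one_lt_two)] at h
  rw [← log_le_iff_le_exp (by linarith)]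
  have h2 : log 2 ≤ 1 := by linarith [log_two_lt_d9]
  nlinarith [one_le_scale (r := r) (ε := ε)]

theorem one_le_gridSize (hε : 0 < ε) : 1 ≤ gridSize ε :=
  Nat.one_le_ceil_iff.2 (by positivity)

theorem one_div_gridSize_le (hε : 0 < ε) : 1 / (gridSize ε : ℝ) ≤ ε / 16 := by
  have h : 16 / ε ≤ gridSize ε := Nat.le_ceil _
  rw [div_le_iff₀ (by exact_mod_cast one_le_gridSize hε)]
  rw [div_le_iff₀ hε] at h
  linarith

theorem one_le_cellNumber (hr : 1 ≤ r) (hε : 0 < ε) : 1 ≤ cellNumber r ε :=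
  Nat.one_le_ceil_iff.2 (by positivity)

theorem one_le_sampleSize (hr : 1 ≤ r) (hε : 0 < ε) : 1 ≤ sampleSize r ε :=
  Nat.one_le_ceil_iff.2 (mul_pos (by positivity) (by linarith [one_le_scale (r := r) (ε := ε)]))

theorem mul_two_div_cellNumber_le (hr : 1 ≤ r) (hε : 0 < ε) :
    r * (2 / cellNumber r ε) ≤ ε / 176 := by
  have h : 352 * (r / ε) ≤ cellNumber r ε := Nat.le_ceil _
  have hM : (0 : ℝ) < cellNumber r ε := by exact_mod_cast one_le_cellNumber hr hε
  rw [← mul_div_assoc, div_le_iff₀ hε] at h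
  rw [mul_div_assoc', div_le_iff₀ hM]
  linarith

theorem exp_neg_ten_le : exp (-10) ≤ 1 / 20000 := by
  have h : (2.7 : ℝ) ^ 10 ≤ exp 1 ^ 10 :=
    pow_le_pow_left₀ (by norm_num) (by linarith [exp_one_gt_d9]) 10
  rw [← exp_nat_mul] at h
  rw [exp_neg, inv_eq_one_div]
  refine one_div_le_one_div_of_le (by norm_num) (le_trans (by norm_num) (h.trans ?_))
  norm_num

theorem le_exp_seven : 710 ≤ exp 7 := by
  have h : (2.7 : ℝ) ^ 7 ≤ exp 1 ^ 7 :=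
    pow_le_pow_left₀ (by norm_num) (by linarith [exp_one_gt_d9]) 7
  rw [← exp_nat_mul] at h
  refine le_trans (by norm_num) (h.trans ?_)
  norm_num

theorem prob_not_good_le_third (J : Measure (I × Bool)) [IsProbabilityMeasure J] (hr : 1 ≤ r)
    (hε : 0 < ε) (hε1 : ε < 1) :
    (Measure.infinitePi fun _ : ℕ => J).real {z | ¬ Good J r ε z} ≤ 1 / 3 := by
  have hp : ∀ z : ℕ → I × Bool, ∀ j < pointDraws r ε, ∃ s < numPoints r ε,
      points (gridSize ε) (z, fun _ => false) s = (z j).1 := by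
    intro z j hj
    refine ⟨gridSize ε + 1 + j, by rw [numPoints]; omega, ?_⟩
    rw [points, if_neg (by omega), show gridSize ε + 1 + j - (gridSize ε + 1) = j by omega]
  refine (prob_not_good_le J (one_le_cellNumber hr hε) (one_le_sampleSize hr hε)
    (by positivity : (0 : ℝ) ≤ ε / 64) _ hp).trans ?_
  have hX := one_le_ratio hr hε hε1
  have hXe := ratio_le_exp hr hε hε1
  have hL := one_le_scale (r := r) (ε := ε)
  have hr1 : (1 : ℝ) ≤ r := by exact_mod_cast hr
  have hM0 : (0 : ℝ) < cellNumber r ε := by exact_mod_cast one_le_cellNumber hr hε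
  have hM : (cellNumber r ε : ℝ) ≤ 353 * (r / ε) := by
    have : (cellNumber r ε : ℝ) < 352 * (r / ε) + 1 := Nat.ceil_lt_add_one (by positivity)
    linarith
  have hm : 4000 * (r / ε) * scale r ε ≤ pointDraws r ε := Nat.le_ceil _
  have hn : 50000 * (r / ε / ε) * scale r ε ≤ sampleSize r ε := Nat.le_ceil _
  set L : ℝ := (scale r ε : ℝ)
  set M : ℝ := (cellNumber r ε : ℝ)
  -- Since 4000 ≥ 11 · 353, the exponent is at least 11L, of which L − 1 pays for the factor M.
  have h1 : M * exp (-(pointDraws r ε * (1 / M))) ≤ 1 / 6 := by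
    have : 11 * L ≤ pointDraws r ε * (1 / M) := by
      rw [mul_one_div, le_div_iff₀ hM0]
      nlinarith
    calc M * exp (-(pointDraws r ε * (1 / M)))
        ≤ (353 * exp (L - 1)) * exp (-(11 * L)) := by gcongr; linarith
      _ = 353 * exp (-(10 * L) - 1) := by rw [mul_assoc, ← exp_add]; ring_nf
      _ ≤ 353 * exp (-10) := by gcongr; linarith
      _ ≤ 1 / 6 := by linarith [exp_neg_ten_le]
  -- The family has at most exp(14rL) members up to the factor 3, while 2 · 50000/64² > 24, so a
  -- factor exp(−10rL) is left.
  have h2 : 3 * (2 * M + 4) ^ (2 * r) * (2 * exp (-(2 * sampleSize r ε * (ε / 64) ^ 2))) ≤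
      1 / 6 := by
    have hb : 2 * M + 4 ≤ exp (7 * L) := by
      calc 2 * M + 4 ≤ 710 * exp (L - 1) := by linarith
        _ ≤ exp 7 * exp (L - 1) := by gcongr; exact le_exp_seven
        _ = exp (7 + (L - 1)) := (exp_add _ _).symm
        _ ≤ exp (7 * L) := exp_le_exp.2 (by linarith)
    have hb' : (2 * M + 4) ^ (2 * r) ≤ exp (14 * (r * L)) := by
      refine (pow_le_pow_left₀ (by positivity) hb _).trans_eq ?_
      rw [← exp_nat_mul]
      push_cast
      ring_nf
    have hc : 24 * (r * L) ≤ 2 * sampleSize r ε * (ε / 64) ^ 2 := by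
      have e : 50000 * (r / ε / ε) * L * ε ^ 2 = 50000 * (r * L) := by
        field_simp
      have := mul_le_mul_of_nonneg_right hn (sq_nonneg ε)
      rw [e] at this
      have : 0 ≤ r * L := by positivity
      nlinarith
    have hrL : 1 ≤ r * L := one_le_mul_of_one_le_of_one_le hr1 hL
    calc 3 * (2 * M + 4) ^ (2 * r) * (2 * exp (-(2 * sampleSize r ε * (ε / 64) ^ 2)))
        ≤ 3 * exp (14 * (r * L)) * (2 * exp (-(24 * (r * L)))) := by gcongr
      _ = 6 * exp (-(10 * (r * L))) := by
        rw [show -(10 * (r * L)) = 14 * (r * L) + -(24 * (r * L)) by ring, exp_add]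
        ring
      _ ≤ 6 * exp (-10) := by gcongr; linarith
      _ ≤ 1 / 6 := by linarith [exp_neg_ten_le]
  linarith

/-- An event that contains the tapes with good examples has probability at least `2 / 3`. -/
theorem two_thirds_le_tapeLaw (J : Measure (I × Bool)) [IsProbabilityMeasure J] (hr : 1 ≤ r)
    (hε : 0 < ε) (hε1 : ε < 1) {A : Set Tape} (hA : ∀ ω : Tape, Good J r ε ω.1 → ω ∈ A) :
    2 / 3 ≤ tapeLaw J A := by
  have hbad : tapeLaw J {ω | ¬ Good J r ε ω.1} ≤ ENNReal.ofReal (1 / 3) := by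
    have e : {ω : Tape | ¬ Good J r ε ω.1} = {z | ¬ Good J r ε z} ×ˢ Set.univ := by
      ext ω
      simp
    rw [tapeLaw, e, Measure.prod_prod, measure_univ, mul_one,
      ← ofReal_measureReal (measure_ne_top _ _)]
    exact ENNReal.ofReal_le_ofReal (prob_not_good_le_third J hr hε hε1)
  have htot : 1 ≤ tapeLaw J A + ENNReal.ofReal (1 / 3) := by
    have huniv : tapeLaw J Set.univ = 1 := by
      rw [tapeLaw]
      exact measure_univ
    rw [← huniv]
    -- Subadditivity of the outer measure is enough, so A need not be measurable.
    refine (measure_mono fun ω _ => ?_).trans ((measure_union_le A _).trans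
      (add_le_add le_rfl hbad))
    by_cases h : Good J r ε ω.1
    · exact Or.inl (hA ω h)
    · exact Or.inr h
  have e1 : (1 : ENNReal) = 2 / 3 + ENNReal.ofReal (1 / 3) := by
    have : (2 / 3 : ENNReal) = ENNReal.ofReal (2 / 3) := by
      rw [ENNReal.ofReal_div_of_pos (by norm_num)]
      simp
    rw [this, ← ENNReal.ofReal_add (by norm_num) (by norm_num)]
    norm_num
  rw [e1] at htot
  exact (ENNReal.add_le_add_iff_right ENNReal.ofReal_ne_top).1 htot

theorem points_mem_Icc {K : ℕ} (hK : 1 ≤ K) (ω : Tape) (t : ℕ) :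
    points K ω t ∈ Set.Icc (0 : ℝ) 1 := by
  have hK0 : (0 : ℝ) < K := by exact_mod_cast hK
  rw [points]
  split_ifs with h
  · refine ⟨by positivity, ?_⟩
    rw [div_le_one hK0]
    exact_mod_cast Nat.lt_succ_iff.1 h
  · exact (ω.1 _).1.2

/-- The tester rejects on the tape `ω`: some grid threshold and some point exceed the bound. -/
def Flagged (r : ℕ) (α ε : ℝ) (ω : Tape) : Prop :=
  ∃ k ≤ gridSize ε, ∃ t < numPoints r ε, Exceeds r α ε (gridSize ε) (numPoints r ε)
    (sampleSize r ε) (points (gridSize ε) ω)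
    (cellCount (points (gridSize ε) ω) (numPoints r ε)
      (fun j => ω.1 (pointDraws r ε + j)) (sampleSize r ε))
    (upCount (points (gridSize ε) ω) (numPoints r ε)
      (fun j => ω.1 (pointDraws r ε + j)) (sampleSize r ε)) ((k : ℝ) / gridSize ε) t

/-- With δ = 2/M and rδ ≤ ε/176 the total error 2(1/K + (2r+1)δ + 2η) is at most 2(ε/16 + 3ε/176 +
ε/16 + 8ε/176) = 3ε/8, below the margin ε/2. -/
theorem flagged_of_lt_CDL {J : Measure (I × Bool)} [IsProbabilityMeasure J] (hr : 1 ≤ r)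
    (hε : 0 < ε) {ω : Tape} (hω : Good J r ε ω.1) (h : α < CDL (genMonotone r) J) :
    Flagged r α ε ω := by
  by_contra hcon
  have hb := CDL_le_of_stat_le (β := α - ε / 2) hr (one_le_gridSize hε)
    (by rw [numPoints]; omega : gridSize ε < numPoints r ε)
    (S := points (gridSize ε) ω) (fun k hk => if_pos (Nat.lt_succ_of_le hk)) hω.1 hω.2
    fun k hk t ht h1 h2 Q hQ hle => not_lt.1 fun hlt => hcon ⟨k, hk, t, ht,
      (exceeds_iff (one_le_sampleSize hr hε) ht).2 ⟨h1, h2, Q, hQ, hle, hlt⟩⟩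
  have h1 := one_div_gridSize_le hε
  have h2 := mul_two_div_cellNumber_le hr hε
  have h3 : 2 / (cellNumber r ε : ℝ) ≤ r * (2 / cellNumber r ε) :=
    le_mul_of_one_le_left (by positivity) (by exact_mod_cast hr)
  linarith

/-- Here the error 2(1/K + 2η) is at most ε/4 + ε/11, again below ε/2. -/
theorem not_flagged_of_CDL_le {J : Measure (I × Bool)} [IsProbabilityMeasure J] (hr : 1 ≤ r)
    (hε : 0 < ε) {ω : Tape} (hω : Good J r ε ω.1) (h : CDL (genMonotone r) J ≤ α - ε) :
    ¬ Flagged r α ε ω := by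
  rintro ⟨k, hk, t, ht, hex⟩
  obtain ⟨h1, h2, Q, hQ, hle, hlt⟩ := (exceeds_iff (one_le_sampleSize hr hε) ht).1 hex
  have hK := one_le_gridSize hε
  have hv : (k : ℝ) / gridSize ε ∈ Set.Icc (0 : ℝ) 1 := by
    refine ⟨by positivity, ?_⟩
    rw [div_le_one (by exact_mod_cast hK)]
    exact_mod_cast hk
  have hb := stat_le_CDL (S := points (gridSize ε) ω) (N := numPoints r ε)
    (h := 1 / gridSize ε) hr hω.2 hv (points_mem_Icc hK ω t)
    (abs_le.2 ⟨by linarith [show (0 : ℝ) ≤ 1 / gridSize ε by positivity], by linarith⟩) hQ hle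
  have h3 := one_div_gridSize_le hε
  have h4 := mul_two_div_cellNumber_le hr hε
  linarith

theorem isTester_tester (hr : 1 ≤ r) (hε : 0 < ε) (hε1 : ε < 1) :
    IsTester tester (input r α ε) α (α - ε) (genMonotone r) := by
  have hrej : ∀ ω, Flagged r α ε ω → Rejects tester (input r α ε) ω := fun ω h => by
    obtain ⟨s, t, hex, -, hs⟩ := exists_exec_tester (α := α) hr hε ω
    exact ⟨s, t, hex, hs.2.1 h⟩
  have hacc : ∀ ω, ¬ Flagged r α ε ω → Accepts tester (input r α ε) ω := fun ω h => by
    obtain ⟨s, t, hex, -, hs⟩ := exists_exec_tester (α := α) hr hε ω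
    exact ⟨s, t, hex, hs.2.2 h⟩
  refine ⟨fun ω => ?_, fun J _ => ⟨fun h => ?_, fun h => ?_⟩⟩
  · by_cases h : Flagged r α ε ω
    · exact Or.inr (hrej ω h)
    · exact Or.inl (hacc ω h)
  · exact two_thirds_le_tapeLaw J hr hε hε1 fun ω hω => hrej ω (flagged_of_lt_CDL hr hε hω h)
  · exact two_thirds_le_tapeLaw J hr hε hε1 fun ω hω => hacc ω (not_flagged_of_CDL_le hr hε hω h)

/-! ### Sample complexity and running time -/

/-- Any W ≥ r/ε is allowed, so the same bound serves r/ε² for the draws and r²/ε³ for the time. -/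
theorem scale_le (hr : 1 ≤ r) (hε : 0 < ε) (hε1 : ε < 1) {W : ℝ} (hW : (r : ℝ) / ε ≤ W) :
    (scale r ε : ℝ) ≤ 4 * log (2 + W) := by
  have hX := one_le_ratio hr hε hε1
  have h1 : 1 ≤ log (2 + W) := by
    rw [le_log_iff_exp_le (by linarith)]
    linarith [exp_one_lt_d9]
  have h2 : log (r / ε) ≤ log (2 + W) := log_le_log (by linarith) (by linarith)
  have h0 : 0 ≤ log (r / ε) := log_nonneg hX
  have h3 : logb 2 (r / ε) ≤ 2 * log (r / ε) := by
    rw [logb, div_le_iff₀ (log_pos one_lt_two)]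
    nlinarith [log_two_gt_d9]
  have h4 : (⌈logb 2 ((r : ℝ) / ε)⌉₊ : ℝ) < logb 2 (r / ε) + 1 :=
    Nat.ceil_lt_add_one (logb_nonneg one_lt_two hX)
  rw [scale]
  push_cast
  linarith

theorem size_bounds (hr : 1 ≤ r) (hε : 0 < ε) (hε1 : ε < 1) :
    (gridSize ε : ℝ) ≤ 17 * (1 / ε) ∧
    (pointDraws r ε : ℝ) ≤ 4001 * (r / ε) * scale r ε ∧
    (sampleSize r ε : ℝ) ≤ 50001 * (r / ε / ε) * scale r ε := by
  have hX := one_le_ratio hr hε hε1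
  have hL := one_le_scale (r := r) (ε := ε)
  have hy : 1 ≤ 1 / ε := by rw [le_div_iff₀ hε]; linarith
  have hXL : 1 ≤ r / ε * scale r ε := one_le_mul_of_one_le_of_one_le hX hL
  have hXy : 1 ≤ r / ε / ε := by rw [le_div_iff₀ hε]; linarith
  have hXyL : 1 ≤ r / ε / ε * scale r ε := one_le_mul_of_one_le_of_one_le hXy hL
  have h1 : (gridSize ε : ℝ) < 16 / ε + 1 := Nat.ceil_lt_add_one (by positivity)
  have h2 : (pointDraws r ε : ℝ) < 4000 * (r / ε) * scale r ε + 1 :=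
    Nat.ceil_lt_add_one (by positivity)
  have h3 : (sampleSize r ε : ℝ) < 50000 * (r / ε / ε) * scale r ε + 1 :=
    Nat.ceil_lt_add_one (by positivity)
  refine ⟨?_, by linarith, by linarith⟩
  rw [show 16 / ε = 16 * (1 / ε) by ring] at h1
  linarith

/-- Estimate of the total number of operations, with `X = r / ε`, `y = 1 / ε` and scale `L`. -/
theorem total_cost_le {X y L R K m n N : ℝ} (hy : 1 ≤ y) (hL : 1 ≤ L) (hR : 1 ≤ R)
    (hRX : R ≤ X) (hyX : y ≤ X) (hK0 : 0 ≤ K) (hm0 : 0 ≤ m)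
    (hK : K ≤ 17 * y) (hm : m ≤ 4001 * X * L) (hn : n ≤ 50001 * (X * y) * L) (hN : N = K + 1 + m) :
    20 * (L + 1) + (40 * (K + 1) + (40 * (m + 1) + ((n + 1) * (60 * N + 60) +
      (K + 2) * ((2 * N + 3) * (100 * R + 300))))) ≤ 10 ^ 11 * (X ^ 2 * y) * L ^ 2 := by
  have hX : 1 ≤ X := hy.trans hyX
  have hXL : X ≤ X * L := le_mul_of_one_le_right (by linarith) hL
  have hXL1 : 1 ≤ X * L := hX.trans hXL
  have hXyL : 1 ≤ X * y * L :=
    one_le_mul_of_one_le_of_one_le (one_le_mul_of_one_le_of_one_le hX hy) hL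
  have hNb : N ≤ 4019 * (X * L) := by linarith
  have hN0 : 0 ≤ N := by linarith
  have hU : 1 ≤ X ^ 2 * y * L := by
    rw [sq, mul_assoc, mul_assoc]
    exact one_le_mul_of_one_le_of_one_le hX (by rwa [← mul_assoc])
  have hU2 : X ^ 2 * y * L ≤ X ^ 2 * y * L ^ 2 := by
    rw [sq L, ← mul_assoc]
    exact le_mul_of_one_le_right (by linarith) hL
  have hXLU : X * L ≤ X ^ 2 * y * L := by
    rw [show X ^ 2 * y * L = X * L * (X * y) by ring]
    exact le_mul_of_one_le_right (by linarith) (one_le_mul_of_one_le_of_one_le hX hy)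
  have hLX : L ≤ X * L := le_mul_of_one_le_left (by linarith) hX
  have t1 : (n + 1) * (60 * N + 60) ≤ (50002 * (X * y * L)) * (60 * (4020 * (X * L))) :=
    mul_le_mul (by linarith) (by linarith) (by linarith) (by linarith)
  have t2 : (K + 2) * ((2 * N + 3) * (100 * R + 300)) ≤
      (19 * y) * ((8041 * (X * L)) * (400 * X)) :=
    mul_le_mul (by linarith) (mul_le_mul (by linarith) (by linarith) (by linarith) (by linarith))
      (mul_nonneg (by linarith) (by linarith)) (by linarith)
  rw [show (50002 * (X * y * L)) * (60 * (4020 * (X * L))) =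
    50002 * 60 * 4020 * (X ^ 2 * y * L ^ 2) by ring] at t1
  rw [show (19 * y) * ((8041 * (X * L)) * (400 * X)) =
    19 * 8041 * 400 * (X ^ 2 * y * L) by ring] at t2
  linarith

theorem runsWithin_tester (hr : 1 ≤ r) (hε : 0 < ε) (hε1 : ε < 1) :
    RunsWithin tester (input r α ε)
      (10 ^ 13 * ((r : ℝ) / ε ^ 2) * log (2 + (r : ℝ) / ε ^ 2) ^ 2)
      (10 ^ 13 * ((r : ℝ) ^ 2 / ε ^ 3) * log (2 + (r : ℝ) ^ 2 / ε ^ 3) ^ 2) := by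
  intro ω
  obtain ⟨s, t, hex, ht, hs, -⟩ := exists_exec_tester (α := α) hr hε ω
  obtain ⟨hK, hm, hn⟩ := size_bounds hr hε hε1
  have hX := one_le_ratio hr hε hε1
  have hL := one_le_scale (r := r) (ε := ε)
  have hr1 : (1 : ℝ) ≤ r := by exact_mod_cast hr
  have hy : 1 ≤ 1 / ε := by rw [le_div_iff₀ hε]; linarith
  have eN : (r : ℝ) / ε ^ 2 = r / ε * (1 / ε) := by field_simp
  have eT : (r : ℝ) ^ 2 / ε ^ 3 = (r / ε) ^ 2 * (1 / ε) := by field_simp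
  have hyX : 1 / ε ≤ r / ε := by gcongr
  have hRX : (r : ℝ) ≤ r / ε := by
    rw [le_div_iff₀ hε]
    nlinarith
  have e2 : (r : ℝ) / ε / ε = r / ε * (1 / ε) := by field_simp
  rw [e2] at hn
  have hXy : r / ε ≤ r / ε * (1 / ε) := le_mul_of_one_le_right (by linarith) hy
  have hX2y : r / ε ≤ (r / ε) ^ 2 * (1 / ε) := by
    rw [sq, mul_assoc]
    exact le_mul_of_one_le_right (by linarith) (hX.trans hXy)
  have hLN := scale_le hr hε hε1 hXy
  have hLT := scale_le hr hε hε1 hX2y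
  refine ⟨s, t, hex, ?_, ?_⟩
  · rw [hs, eN]
    push_cast
    generalize (r : ℝ) / ε = X at *
    generalize (1 : ℝ) / ε = y at *
    generalize (scale r ε : ℝ) = L at *
    generalize log (2 + X * y) = Λ at *
    have h1 : X * L ≤ X * y * L := mul_le_mul_of_nonneg_right hXy (by linarith)
    -- One logarithm would do for the draws; L ≤ L² ≤ 16Λ² gives the exponent 2 that the running
    -- time needs.
    have h2 : X * y * L ≤ X * y * (16 * Λ ^ 2) :=
      mul_le_mul_of_nonneg_left (by nlinarith) (by linarith)
    nlinarith [mul_nonneg (by linarith : 0 ≤ X * y) (sq_nonneg Λ)]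
  · have hc : (t : ℝ) ≤ 10 ^ 11 * ((r / ε) ^ 2 * (1 / ε)) * (scale r ε : ℝ) ^ 2 := by
      refine le_trans (Nat.cast_le.2 ht) ?_
      push_cast
      exact total_cost_le hy hL hr1 hRX hyX (Nat.cast_nonneg _) (Nat.cast_nonneg _)
        hK hm hn (by rw [numPoints]; push_cast; ring)
    rw [eT]
    refine hc.trans ?_
    have h2 : (scale r ε : ℝ) ^ 2 ≤ 16 * log (2 + (r / ε) ^ 2 * (1 / ε)) ^ 2 := by nlinarith
    have h3 : (0 : ℝ) ≤ (r / ε) ^ 2 * (1 / ε) := by positivity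
    have h4 := mul_le_mul_of_nonneg_left h2 h3
    nlinarith [mul_nonneg h3 (sq_nonneg (log (2 + ((r : ℝ) / ε) ^ 2 * (1 / ε))))]

end RealRAM

theorem mainTheorem8 :
    ∃ (P : RealRAM.Prog) (C : ℝ) (k : ℕ), 0 < C ∧
      ∀ (r : ℕ) (α ε : ℝ), 1 ≤ r → 0 < α → α < 1 → 0 < ε → ε < 1 →
        RealRAM.IsTester P (RealRAM.input r α ε) α (α - ε) (Calib.genMonotone r) ∧
        RealRAM.RunsWithin P (RealRAM.input r α ε)
          (C * ((r : ℝ) / ε ^ 2) * Real.log (2 + (r : ℝ) / ε ^ 2) ^ k)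
          (C * ((r : ℝ) ^ 2 / ε ^ 3) * Real.log (2 + (r : ℝ) ^ 2 / ε ^ 3) ^ k) :=
  ⟨RealRAM.tester, 10 ^ 13, 2, by norm_num, fun _ _ _ hr _ _ hε hε1 =>
    ⟨RealRAM.isTester_tester hr hε hε1, RealRAM.runsWithin_tester hr hε hε1⟩⟩
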